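/- Let $d \ge 1$ and fix $\rho \ge \sqrt d$. For $A \subseteq \mathbb{R}^d$ put $\widetilde A := \{z \in \mathbb{Z}^d : B_\rho(z) \cap A \ne \emptyset\}$, where $B_\rho(z)$ is the closed Euclidean ball of radius $\rho$ centred at $z$. Call $A \subset \mathbb{R}^d$ Riemann measurable if it is bounded with Lebesgue-null boundary, and write $|A|$ for its Lebesgue measure. Let $B_0 \subset \mathbb{R}^d$ be Riemann measurable with $|B_0| > 0$, and let $\mathcal{R}(B_0)$ be the collection of Riemann measurable subsets of $B_0$. Let $(E, \mathcal{E}, P_0)$ be a probability space and let $X = (X_z)_{z \in \mathbb{Z}^d}$ be i.i.d. random elements of $E$ with law $P_0$; let $X_*$ be a further random element with law $P_0$, independent of $X$. For $y \in \mathbb{Z}^d$ let $\tau_y X := (X_{z+y})_{z \in \mathbb{Z}^d}$, let $X^{\mathbf 0}$ be $X$ with the value at the origin replaced by $X_*$, and let $\mathcal{F}_{\mathbf 0}$ be the $\sigma$-field generated by the $X_z$ with $z \preceq \mathbf 0$ in the lexicographic order on $\mathbb{Z}^d$. A random set function on $B_0$ is a family $H = (H_t(A) : t \ge 1,\ A \in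 \mathcal{R}(B_0))$ in which each $H_t(A) = H_t(X, A)$ is a real-valued measurable function of $(X_z,\ z \in \widetilde{tB_0})$. Its increments are $$\Delta^H_{t,y}(A) := H_t(\tau_y X, A) - H_t(\tau_y X^{\mathbf 0}, A), \qquad t \ge 1,\ y \in \mathbb{Z}^d,\ A \in \mathcal{R}(B_0).$$ Let $H^1, \dots, H^k$ be random set functions on $B_0$ such that, for each $i$: (a) there is a random variable $\Delta^{i}_\infty$ such that for every $A \in \mathcal{R}(B_0)$ and every sequence $(t_n, y_n)_{n \ge 1}$ in $[1,\infty) \times \mathbb{Z}^d$, with $\liminf_n S_n := \bigcup_n \bigcap_{m \ge n} S_m$ for sets $S_n$, $$\Delta^{H^i}_{t_n,y_n}(A) \xrightarrow{P} \Delta^{i}_\infty \quad \text{if } \liminf_{n} \,(y_n + t_n A) = \mathbb{R}^d,$$ $$\Delta^{H^i}_{t_n,y_n}(A) \xrightarrow{P} 0 \quad \text{if } \liminf_{n} \,(y_n + t_n (B_0 \setminus A)) = \mathbb{R}^d;$$ (b) there is $\gamma > 2$ (possibly depending on $i$) such that $\sup\{ \mathbb{E}[|\Delta^{H^i}_{t,-y}(A)|^\gamma]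 : A \in \mathcal{R}(B_0),\ t \ge 1,\ y \in \widetilde{tB_0} \} < \infty$. Put $\sigma^*_{ij} := \mathbb{E}\big[\mathbb{E}(\Delta^{i}_\infty \mid \mathcal{F}_{\mathbf 0})\, \mathbb{E}(\Delta^{j}_\infty \mid \mathcal{F}_{\mathbf 0})\big]$ and let $A_1, \dots, A_k \in \mathcal{R}(B_0)$. Then all $\Delta^i_\infty$ and all $H^i_t(A_i)$, $t \ge 1$, are square integrable; for all $i, j \in \{1, \dots, k\}$, $$\lim_{t \to \infty} t^{-d}\, \mathrm{Cov}(H^i_t(A_i), H^j_t(A_j)) = \sigma^*_{ij}\, |A_i \cap A_j|;$$ the matrix $(\sigma^*_{ij} |A_i \cap A_j|)_{i,j=1}^k$ is nonnegative definite; and as $t \to \infty$ $$\big( t^{-d/2} ( H^i_t(A_i) - \mathbb{E} H^i_t(A_i) ) \big)_{i=1}^k \xrightarrow{\mathcal{D}} \mathcal{N}\big(\mathbf 0, (\sigma^*_{ij} |A_i \cap A_j|)_{i,j=1}^k\big),$$ the centred (possibly degenerate) multivariate normal distribution with that covariance matrix. -/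

import Mathlib

open MeasureTheory ProbabilityTheory Filter Topology
open scoped Pointwise ENNReal NNReal

namespace LatticeCLT

/-- A set is Riemann (Jordan) measurable if it is bounded with Lebesgue-null boundary. -/
def IsRiemannMeasurable {d : ℕ} (A : Set (EuclideanSpace ℝ (Fin d))) : Prop :=
  Bornology.IsBounded A ∧ volume (frontier A) = 0

/-- The collection `𝓡(B₀)` of Riemann measurable subsets of `B₀`. -/
abbrev RiemannSubset {d : ℕ} (B₀ : Set (EuclideanSpace ℝ (Fin d))) : Type :=
  {A : Set (EuclideanSpace ℝ (Fin d)) // IsRiemannMeasurable A ∧ A ⊆ B₀}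

/-- The inclusion of `ℤ^d` in `ℝ^d`. -/
noncomputable def latticePoint {d : ℕ} (z : Fin d → ℤ) : EuclideanSpace ℝ (Fin d) :=
  WithLp.toLp 2 fun i => (z i : ℝ)

/-- The discretization of `A`: the lattice points whose closed `ρ`-ball meets `A`. -/
def discretization {d : ℕ} (ρ : ℝ) (A : Set (EuclideanSpace ℝ (Fin d))) : Set (Fin d → ℤ) :=
  {z | (Metric.closedBall (latticePoint z) ρ ∩ A).Nonempty}

/-- The lower limit `⋃ₙ ⋂_{m ≥ n} Sₘ` of a sequence of sets. -/
def setLiminf {α : Type*} (S : ℕ → Set α) : Set α :=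
  ⋃ n, ⋂ m, ⋂ (_ : n ≤ m), S m

/-- The translated configuration `τ_y x = (x_{z+y})_z`. -/
def shift {d : ℕ} {E : Type*} (y : Fin d → ℤ) (x : (Fin d → ℤ) → E) : (Fin d → ℤ) → E :=
  fun z => x (z + y)

/-- A random set function on `B₀`: for every `t ≥ 1` and every Riemann measurable `A ⊆ B₀`, a
measurable real function of the configuration on the discretization of `t B₀`. -/
structure RandomSetFunction {d : ℕ} (E : Type*) [MeasurableSpace E] (ρ : ℝ)
    (B₀ : Set (EuclideanSpace ℝ (Fin d))) where
  toFun : ∀ t : Set.Ici (1 : ℝ), RiemannSubset B₀ →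
    (discretization ρ ((t : ℝ) • B₀) → E) → ℝ
  measurable_toFun : ∀ t A, Measurable (toFun t A)

namespace RandomSetFunction

variable {d : ℕ} {E : Type*} [MeasurableSpace E] {ρ : ℝ} {B₀ : Set (EuclideanSpace ℝ (Fin d))}

/-- `H_t(x, A)` for a configuration `x` on the whole lattice. -/
def eval (H : RandomSetFunction E ρ B₀) (t : Set.Ici (1 : ℝ)) (x : (Fin d → ℤ) → E)
    (A : RiemannSubset B₀) : ℝ :=
  H.toFun t A fun z => x z

/-- The random variable `H_t(A) = H_t(X, A)`. -/
def var {Ω : Type*} (H : RandomSetFunction E ρ B₀) (X : (Fin d → ℤ) → Ω → E)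
    (t : Set.Ici (1 : ℝ)) (A : RiemannSubset B₀) (ω : Ω) : ℝ :=
  H.eval t (fun z => X z ω) A

/-- The increment `Δ_{t,y}(A) = H_t(τ_y X, A) - H_t(τ_y X⁰, A)`, where `X⁰` is the field `X` with
its value at the origin replaced by `Xs`. -/
def increment {Ω : Type*} (H : RandomSetFunction E ρ B₀) (X : (Fin d → ℤ) → Ω → E) (Xs : Ω → E)
    (t : Set.Ici (1 : ℝ)) (y : Fin d → ℤ) (A : RiemannSubset B₀) (ω : Ω) : ℝ :=
  H.eval t (shift y fun z => X z ω) A -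
    H.eval t (shift y (Function.update (fun z => X z ω) 0 (Xs ω))) A

/-- The two stabilization conditions, with limiting increment the random variable `D`. -/
def Stabilizes {Ω : Type*} [MeasurableSpace Ω] (P : Measure Ω) (H : RandomSetFunction E ρ B₀)
    (X : (Fin d → ℤ) → Ω → E) (Xs : Ω → E) (D : Ω → ℝ) : Prop :=
  Measurable D ∧
  ∀ (A : RiemannSubset B₀) (t : ℕ → Set.Ici (1 : ℝ)) (y : ℕ → Fin d → ℤ),
    (setLiminf (fun n => latticePoint (y n) +ᵥ ((t n : ℝ) • (A : Set (EuclideanSpace ℝ (Fin d))))) = Set.univ →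
      TendstoInMeasure P (fun n => H.increment X Xs (t n) (y n) A) atTop D) ∧
    (setLiminf (fun n => latticePoint (y n) +ᵥ ((t n : ℝ) • (B₀ \ (A : Set (EuclideanSpace ℝ (Fin d)))))) = Set.univ →
      TendstoInMeasure P (fun n => H.increment X Xs (t n) (y n) A) atTop (fun _ => 0))

/-- The moments condition: for some `γ > 2`, the `γ`-th absolute moments of the increments
`Δ_{t,-y}(A)` are bounded uniformly in `A`, `t ≥ 1` and `y` in the discretization of `t B₀`. -/
def BoundedMoments {Ω : Type*} [MeasurableSpace Ω] (P : Measure Ω) (H : RandomSetFunction E ρ B₀)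
    (X : (Fin d → ℤ) → Ω → E) (Xs : Ω → E) : Prop :=
  ∃ γ : ℝ, 2 < γ ∧ ∃ C : ℝ≥0, ∀ (A : RiemannSubset B₀) (t : Set.Ici (1 : ℝ)),
    ∀ y ∈ discretization ρ ((t : ℝ) • B₀),
      ∫⁻ ω, ‖H.increment X Xs t (-y) A ω‖ₑ ^ γ ∂P ≤ C

end RandomSetFunction

/-- The σ-field `𝓕_y` generated by the `X_z` with `z` at or before `y` in the lexicographic
order. -/
abbrev lexPast {d : ℕ} {Ω E : Type*} [MeasurableSpace E] (X : (Fin d → ℤ) → Ω → E)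
    (y : Fin d → ℤ) : MeasurableSpace Ω :=
  ⨆ (z : Fin d → ℤ) (_ : toLex z ≤ toLex y), MeasurableSpace.comap (X z) inferInstance

/-- `σ*_{ij} = 𝔼[𝔼(D_i | 𝓕_0) 𝔼(D_j | 𝓕_0)]`. -/
noncomputable def sigmaStar {d k : ℕ} {Ω E : Type*} [MeasurableSpace Ω] [MeasurableSpace E]
    (P : Measure Ω) (X : (Fin d → ℤ) → Ω → E) (D : Fin k → Ω → ℝ) (i j : Fin k) : ℝ :=
  ∫ ω, (P[D i | lexPast X 0]) ω * (P[D j | lexPast X 0]) ω ∂P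

/-- The matrix with entries `σ*_{ij} |A_i ∩ A_j|`. -/
noncomputable def limitCov {d k : ℕ} {Ω E : Type*} [MeasurableSpace Ω] [MeasurableSpace E]
    (P : Measure Ω) (X : (Fin d → ℤ) → Ω → E) (D : Fin k → Ω → ℝ)
    {B₀ : Set (EuclideanSpace ℝ (Fin d))} (A : Fin k → RiemannSubset B₀) :
    Matrix (Fin k) (Fin k) ℝ :=
  Matrix.of fun i j =>
    sigmaStar P X D i j * volume.real ((A i : Set (EuclideanSpace ℝ (Fin d))) ∩ A j)

end LatticeCLT

/-!
Order `ℤ^d` lexicographically. The centred variable `H_t(A)` is the sum over the sites `y` of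
`t B₀` of the martingale differences `𝔼(H_t(A) | 𝓕_y) - 𝔼(H_t(A) | 𝓕_{y-})`. Resampling the
value at `y` does not change the second conditional expectation, so each difference is the
conditional expectation given `𝓕_y` of an increment of `H_t(A)`. By stabilization and the moment
condition, the difference at `y` is close in `L²` to `g ∘ τ_y`, with `g = 𝔼(D | 𝓕_0)`, when `y` is
deep inside `t A`, and close to `0` when `y` is deep inside `t (B₀ \ A)`; the other sites are
`o(t^d)` in number because `A` and `B₀` have null boundaries. Orthogonality then gives
`H_t(A) - 𝔼 H_t(A) = ∑_{y ∈ t A} g ∘ τ_y + o(t^{d/2})` in `L²`.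

For linear combinations of such sums over several `A_i`, the central limit theorem follows from
the telescoping of `∏ (1 + i u X_y)` for bounded stationary martingale differences and a law of
large numbers for their squares, after truncating `g` and recentring the truncation.
-/

namespace LatticeCLT

section ConditionalExpectation

variable {α β F : Type*} {m : MeasurableSpace β} {mα : MeasurableSpace α} {mβ : MeasurableSpace β}
  [NormedAddCommGroup F] {μ : Measure β}

theorem memLp_comp_iff {ν : Measure α} {T : α → β} (hT : MeasurePreserving T ν μ) {f : β → F}
    (hf : AEStronglyMeasurable f μ) {p : ℝ≥0∞} : MemLp (f ∘ T) p ν ↔ MemLp f p μ := by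
  rw [← hT.map_eq] at hf ⊢
  exact (memLp_map_measure_iff hf hT.measurable.aemeasurable).symm

variable [NormedSpace ℝ F]

theorem integral_comp_measurePreserving {ν : Measure α} {T : α → β} (hT : MeasurePreserving T ν μ)
    {f : β → F} (hf : AEStronglyMeasurable f μ) : ∫ x, f (T x) ∂ν = ∫ x, f x ∂μ := by
  rw [← hT.map_eq] at hf ⊢
  exact (integral_map hT.measurable.aemeasurable hf).symm

theorem condExp_comp_measurePreserving [CompleteSpace F] {ν : Measure α} [IsFiniteMeasure ν]
    [IsFiniteMeasure μ] {T : α → β} (hT : MeasurePreserving T ν μ)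
    (hm : m ≤ mβ) {f : β → F} (hf : Integrable f μ) :
    ν[f ∘ T | m.comap T] =ᵐ[ν] (μ[f | m]) ∘ T := by
  have hle : m.comap T ≤ mα := (MeasurableSpace.comap_mono hm).trans hT.measurable.comap_le
  have hint : Integrable (μ[f | m] ∘ T) ν := hT.integrable_comp_of_integrable integrable_condExp
  refine (ae_eq_condExp_of_forall_setIntegral_eq hle (hT.integrable_comp_of_integrable hf)
    (fun s _ _ => hint.integrableOn) ?_ (stronglyMeasurable_condExp.comp_measurable
      (comap_measurable T)).aestronglyMeasurable).symm
  rintro s ⟨u, hu, rfl⟩ -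
  have setIntegral_comp (k : β → F) (hk : AEStronglyMeasurable k μ) :
      ∫ x in T ⁻¹' u, k (T x) ∂ν = ∫ x in u, k x ∂μ :=
    integral_comp_measurePreserving (hT.restrict_preimage (hm _ hu)) hk.restrict
  exact (setIntegral_comp _ integrable_condExp.1).trans
    ((setIntegral_condExp hm hf hu).trans (setIntegral_comp _ hf.1).symm)

theorem integral_sq_condExp_le [IsFiniteMeasure μ] {f : β → ℝ} (hf : MemLp f 2 μ) :
    ∫ x, (μ[f | m]) x ^ 2 ∂μ ≤ ∫ x, f x ^ 2 ∂μ := by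
  simpa using integral_norm_condExp_rpow_le (μ := μ) (m := m) (f := f) (p := 2) (by norm_num)
    (by simpa using hf.integrable_sq)

theorem integral_smul_eq_zero_of_condExp_eq_zero [CompleteSpace F] [IsFiniteMeasure μ]
    (hm : m ≤ mβ) {w : β → ℝ} {g : β → F} (hg : AEStronglyMeasurable[m] g μ) (hw : Integrable w μ)
    (hwg : Integrable (w • g) μ) (hw0 : μ[w | m] =ᵐ[μ] 0) : ∫ x, w x • g x ∂μ = 0 := by
  have h : μ[w • g | m] =ᵐ[μ] 0 := by
    filter_upwards [condExp_smul_of_aestronglyMeasurable_right hw hwg hg, hw0] with x hx hx0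
    simp [hx, hx0]
  simpa [integral_congr_ae h] using (integral_condExp (μ := μ) hm (f := w • g)).symm

theorem integral_mul_eq_zero_of_condExp_eq_zero [IsFiniteMeasure μ] (hm : m ≤ mβ) {w g : β → ℝ}
    (hg : AEStronglyMeasurable[m] g μ) (hw2 : MemLp w 2 μ) (hg2 : MemLp g 2 μ)
    (hw0 : μ[w | m] =ᵐ[μ] 0) : ∫ x, w x * g x ∂μ = 0 :=
  integral_smul_eq_zero_of_condExp_eq_zero hm hg (hw2.integrable one_le_two)
    (hw2.integrable_mul hg2) hw0

end ConditionalExpectation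

section Product

variable {ι F : Type*} {E : ι → Type*} [∀ i, MeasurableSpace (E i)] [NormedAddCommGroup F]
  [NormedSpace ℝ F] (ν : ∀ i, Measure (E i)) [∀ i, IsProbabilityMeasure (ν i)]

open scoped Classical in
theorem measurable_piecewise_cylinderEvents (S T : Set ι) :
    @Measurable _ _ (@Prod.instMeasurableSpace _ _ (cylinderEvents (S ∩ T)) MeasurableSpace.pi)
      (cylinderEvents T) fun p : (∀ i, E i) × (∀ i, E i) => S.piecewise p.1 p.2 := by
  let _ := @Prod.instMeasurableSpace (∀ i, E i) (∀ i, E i) (cylinderEvents (S ∩ T)) .pi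
  refine measurable_cylinderEvents_iff.2 fun z hz => ?_
  by_cases hzS : z ∈ S
  · simp only [Set.piecewise_eq_of_mem _ _ _ hzS]
    exact (measurable_cylinderEvent_apply (show z ∈ S ∩ T from ⟨hzS, hz⟩)).comp
      (@measurable_fst _ _ (cylinderEvents (S ∩ T)) MeasurableSpace.pi)
  · simp only [Set.piecewise_eq_of_notMem _ _ _ hzS]
    exact (measurable_pi_apply z).comp
      (@measurable_snd _ _ (cylinderEvents (S ∩ T)) MeasurableSpace.pi)

open scoped Classical in
theorem measurable_piecewise_pi (S : Set ι) :
    Measurable fun p : (∀ i, E i) × (∀ i, E i) => S.piecewise p.1 p.2 :=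
  measurable_pi_iff.2 fun z => by
    by_cases hz : z ∈ S
    · simp only [Set.piecewise_eq_of_mem _ _ _ hz]; fun_prop
    · simp only [Set.piecewise_eq_of_notMem _ _ _ hz]; fun_prop

open scoped Classical in
theorem measurePreserving_piecewise (S : Set ι) :
    MeasurePreserving (fun p : (∀ i, E i) × (∀ i, E i) => S.piecewise p.1 p.2)
      ((Measure.infinitePi ν).prod (Measure.infinitePi ν)) (Measure.infinitePi ν) := by
  refine ⟨measurable_piecewise_pi S, Measure.eq_infinitePi _ fun s t ht => ?_⟩
  have preimage_eq : (fun p : (∀ i, E i) × (∀ i, E i) => S.piecewise p.1 p.2) ⁻¹' (Set.pi s t)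
      = (Set.pi (s.filter (· ∈ S) : Finset ι) t) ×ˢ (Set.pi (s.filter (· ∉ S) : Finset ι) t) := by
    ext p
    simp only [Set.mem_preimage, Set.mem_pi, Set.mem_prod, Finset.mem_coe, Finset.mem_filter,
      and_imp, ← forall_and]
    refine forall₂_congr fun i _ => ?_
    by_cases hS : i ∈ S <;> simp [hS]
  rw [Measure.map_apply (measurable_piecewise_pi S) (.pi s.countable_toSet fun i _ => ht i),
    preimage_eq, Measure.prod_prod, Measure.infinitePi_pi _ fun i _ => ht i,
    Measure.infinitePi_pi _ fun i _ => ht i, Finset.prod_filter_mul_prod_filter_not]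

theorem dependsOn_mem_of_measurableSet_cylinderEvents {S : Set ι} {B : Set (∀ i, E i)}
    (hB : MeasurableSet[cylinderEvents S] B) : DependsOn (· ∈ B) S := by
  have hle : cylinderEvents (X := E) S ≤ MeasurableSpace.comap S.domRestrict inferInstance :=
    iSup₂_le fun i hi => by
      rintro _ ⟨u, hu, rfl⟩
      exact ⟨(fun f : ∀ j : S, E j => f ⟨i, hi⟩) ⁻¹' u, measurable_pi_apply _ hu, rfl⟩
  obtain ⟨C, -, rfl⟩ := hle _ hB
  intro x y hxy
  have : S.domRestrict x = S.domRestrict y := funext fun z => hxy z z.2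
  simp only [Set.mem_preimage, this]

open scoped Classical in
theorem stronglyMeasurable_integral_piecewise {S T : Set ι} {f : (∀ i, E i) → F}
    (hf : StronglyMeasurable[cylinderEvents T] f) :
    StronglyMeasurable[cylinderEvents (S ∩ T)]
      (fun x => ∫ x', f (S.piecewise x x') ∂Measure.infinitePi ν) :=
  @StronglyMeasurable.integral_prod_right' _ _ _ (cylinderEvents (S ∩ T)) _ _ _ _ _ _
    (hf.comp_measurable (measurable_piecewise_cylinderEvents S T))

variable [CompleteSpace F]

open scoped Classical in
theorem condExp_cylinderEvents_ae_eq_integral_piecewise (S : Set ι) {f : (∀ i, E i) → F}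
    (hf : Integrable f (Measure.infinitePi ν)) (hfm : StronglyMeasurable f) :
    (Measure.infinitePi ν)[f | cylinderEvents S] =ᵐ[Measure.infinitePi ν]
      fun x => ∫ x', f (S.piecewise x x') ∂Measure.infinitePi ν := by
  set μ := Measure.infinitePi ν
  have hpw := measurePreserving_piecewise ν S
  have hint : Integrable (fun p : (∀ i, E i) × (∀ i, E i) => f (S.piecewise p.1 p.2)) (μ.prod μ) :=
    hpw.integrable_comp_of_integrable hf
  have hmeas : StronglyMeasurable[cylinderEvents S] fun x => ∫ x', f (S.piecewise x x') ∂μ := by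
    have h := stronglyMeasurable_integral_piecewise ν (S := S) (T := Set.univ) (f := f)
      (by rwa [cylinderEvents_univ])
    rwa [Set.inter_univ] at h
  refine (ae_eq_condExp_of_forall_setIntegral_eq cylinderEvents_le_pi hf
    (fun s _ _ => hint.integral_prod_left.integrableOn) (fun s hs _ => ?_)
    hmeas.aestronglyMeasurable).symm
  have hs' : MeasurableSet s := cylinderEvents_le_pi _ hs
  have mem_iff (x x') : S.piecewise x x' ∈ s ↔ x ∈ s :=
    iff_of_eq (dependsOn_mem_of_measurableSet_cylinderEvents hs fun z hz => by simp [hz])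
  rw [← integral_indicator hs', ← integral_indicator hs',
    ← integral_comp_measurePreserving hpw (hfm.indicator hs').aestronglyMeasurable,
    integral_prod (fun p => s.indicator f (S.piecewise p.1 p.2))
      (hpw.integrable_comp_of_integrable (hf.indicator hs'))]
  refine integral_congr_ae (Eventually.of_forall fun x => ?_)
  by_cases hx : x ∈ s <;> simp [Set.indicator, hx, mem_iff, μ]

theorem condExp_cylinderEvents_ae_eq_inter (S : Set ι) {T : Set ι} {f : (∀ i, E i) → F}
    (hf : Integrable f (Measure.infinitePi ν)) (hfm : StronglyMeasurable[cylinderEvents T] f) :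
    (Measure.infinitePi ν)[f | cylinderEvents S] =ᵐ[Measure.infinitePi ν]
      (Measure.infinitePi ν)[f | cylinderEvents (S ∩ T)] := by
  have hmeas : AEStronglyMeasurable[cylinderEvents (S ∩ T)]
      ((Measure.infinitePi ν)[f | cylinderEvents S]) (Measure.infinitePi ν) :=
    ⟨_, stronglyMeasurable_integral_piecewise ν hfm,
      condExp_cylinderEvents_ae_eq_integral_piecewise ν S hf (hfm.mono cylinderEvents_le_pi)⟩
  exact (condExp_of_aestronglyMeasurable' cylinderEvents_le_pi hmeas integrable_condExp).symm.trans
    (condExp_condExp_of_le (cylinderEvents_mono Set.inter_subset_left) cylinderEvents_le_pi)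

theorem condExp_condExp_cylinderEvents (S T : Set ι) {f : (∀ i, E i) → F} :
    (Measure.infinitePi ν)[(Measure.infinitePi ν)[f | cylinderEvents S] | cylinderEvents T]
      =ᵐ[Measure.infinitePi ν] (Measure.infinitePi ν)[f | cylinderEvents (T ∩ S)] :=
  (condExp_cylinderEvents_ae_eq_inter ν T integrable_condExp stronglyMeasurable_condExp).trans
    (condExp_condExp_of_le (cylinderEvents_mono Set.inter_subset_right) cylinderEvents_le_pi)

theorem exists_finset_integral_abs_condExp_sub_le [Countable ι] {f : (∀ i, E i) → ℝ}
    (hf : Integrable f (Measure.infinitePi ν)) (hfm : StronglyMeasurable f) {ε : ℝ} (hε : 0 < ε) :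
    ∃ s : Finset ι, ∫ x, |((Measure.infinitePi ν)[f | cylinderEvents s]) x - f x|
      ∂Measure.infinitePi ν ≤ ε := by
  obtain ⟨e, he⟩ := exists_injective_nat ι
  let ℱ : Filtration ℕ (MeasurableSpace.pi (X := E)) :=
    { seq := fun n => cylinderEvents {z | e z < n}
      mono' := fun n m hnm => cylinderEvents_mono fun z hz => lt_of_lt_of_le hz hnm
      le' := fun n => cylinderEvents_le_pi }
  have hsup : ⨆ n, ℱ n = MeasurableSpace.pi :=
    (iSup_le fun n => ℱ.le n).antisymm <| iSup_le fun z => le_iSup_of_le (e z + 1) <|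
      (measurable_cylinderEvent_apply (show z ∈ {w | e w < e z + 1} by simp)).comap_le
  obtain ⟨n, hn⟩ := ((hf.tendsto_eLpNorm_condExp (ℱ := ℱ) (by rwa [hsup])).eventually
    (ge_mem_nhds (ENNReal.ofReal_pos.2 hε))).exists
  have hfin : {z | e z < n}.Finite := (Set.finite_Iio n).preimage he.injOn
  refine ⟨hfin.toFinset, ?_⟩
  rw [hfin.coe_toFinset]
  have hint : Integrable ((Measure.infinitePi ν)[f | cylinderEvents {z | e z < n}] - f)
    (Measure.infinitePi ν) := integrable_condExp.sub hf
  rw [eLpNorm_one_eq_lintegral_enorm] at hn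
  exact (integral_norm_eq_lintegral_enorm hint.1).trans_le (ENNReal.toReal_le_of_le_ofReal hε.le hn)

end Product

/-- The law of an i.i.d. family indexed by `ι` with marginal `P₀`. -/
noncomputable abbrev iidLaw (ι : Type*) {E : Type*} [MeasurableSpace E] (P₀ : Measure E) :
    Measure (ι → E) :=
  Measure.infinitePi fun _ => P₀

section Shift

variable {d : ℕ} {E : Type*}

theorem shift_shift (y y' : Fin d → ℤ) (x : (Fin d → ℤ) → E) :
    shift y (shift y' x) = shift (y + y') x := by
  funext z; simp [shift, add_assoc]

theorem shift_neg_shift (y : Fin d → ℤ) (x : (Fin d → ℤ) → E) : shift (-y) (shift y x) = x := by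
  funext z; simp [shift]

theorem shift_neg_update_shift (y : Fin d → ℤ) (x : (Fin d → ℤ) → E) (e : E) :
    shift (-y) (Function.update (shift y x) 0 e) = Function.update x y e := by
  funext z
  rcases eq_or_ne z y with rfl | hz
  · simp [shift]
  · have : z + -y ≠ 0 := by rwa [← sub_eq_add_neg, sub_ne_zero]
    simp [shift, hz, this]

variable [MeasurableSpace E]

@[fun_prop]
theorem measurable_shift (y : Fin d → ℤ) : Measurable (shift (E := E) y) :=
  measurable_pi_iff.2 fun z => measurable_pi_apply (z + y)

theorem measurePreserving_shift {P₀ : Measure E} [IsProbabilityMeasure P₀] (y : Fin d → ℤ) :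
    MeasurePreserving (shift y) (iidLaw (Fin d → ℤ) P₀) (iidLaw (Fin d → ℤ) P₀) :=
  ⟨measurable_shift y, Measure.map_infinitePi_infinitePi_of_inj
    (P := fun _ : Fin d → ℤ => P₀) (f := fun z => z + y) (add_left_injective y)⟩

theorem comap_shift_cylinderEvents (y : Fin d → ℤ) (S : Set (Fin d → ℤ)) :
    (cylinderEvents (X := fun _ : Fin d → ℤ => E) S).comap (shift y)
      = cylinderEvents ((fun z => z + y) '' S) := by
  simp only [cylinderEvents, MeasurableSpace.comap_iSup, MeasurableSpace.comap_comp, iSup_image]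
  rfl

end Shift

section MartingaleDifferences

theorem sum_sublevel_sub_strictSublevel {ι κ V : Type*} [LinearOrder κ] [AddCommGroup V] {r : ι → κ}
    (hr : Function.Injective r) (Φ : Set ι → V) (s : Finset ι) :
    ∑ y ∈ s, (Φ ({z | r z ≤ r y} ∩ s) - Φ ({z | r z < r y} ∩ s)) = Φ s - Φ ∅ := by
  classical
  induction s using Finset.induction_on_max_value r with
  | empty => simp
  | insert a s ha hmax ih =>
    have hlt (x) (hx : x ∈ s) : r x < r a :=
      (hmax x hx).lt_of_ne fun h => ha (hr h ▸ hx)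
    have hle : {z | r z ≤ r a} ∩ ((insert a s : Finset ι) : Set ι) = (insert a s : Finset ι) :=
      Set.inter_eq_right.2 fun z hz =>
        (Finset.mem_insert.1 hz).elim (fun h => h ▸ le_rfl) (hmax z)
    have hlt' : {z | r z < r a} ∩ ((insert a s : Finset ι) : Set ι) = s := by
      rw [Finset.coe_insert, Set.inter_insert_of_notMem (by simp), Set.inter_eq_right]
      exact hlt
    rw [Finset.sum_insert ha, hle, hlt',
      ← sub_add_sub_cancel (Φ ((insert a s : Finset ι) : Set ι)) (Φ s) (Φ ∅), ← ih]
    congr 1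
    refine Finset.sum_congr rfl fun y hy => ?_
    rw [Finset.coe_insert, Set.inter_insert_of_notMem (by simpa using hlt y hy),
      Set.inter_insert_of_notMem (by simpa using (hlt y hy).le)]

variable {Ω ι κ : Type*} {m mΩ : MeasurableSpace Ω} [LinearOrder κ]

/-- A martingale difference family `w`, indexed by a type ordered through an injection `r` into a
linear order: `F y` plays the role of the σ-field generated before time `y`. -/
structure IsMartingaleDifference (μ : Measure Ω) (r : ι → κ) (F : ι → MeasurableSpace Ω)
    (w : ι → Ω → ℝ) : Prop where
  injective : Function.Injective r
  le : ∀ y, F y ≤ mΩ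
  aestronglyMeasurable : ∀ y, AEStronglyMeasurable (w y) μ
  adapted : ∀ y y', r y < r y' → AEStronglyMeasurable[F y'] (w y) μ
  condExp_eq_zero : ∀ y, μ[w y | F y] =ᵐ[μ] 0

variable {μ : Measure Ω} {r : ι → κ} {F : ι → MeasurableSpace Ω} {w v : ι → Ω → ℝ} {c : ℝ}

namespace IsMartingaleDifference

theorem integral_mul_eq_zero [IsFiniteMeasure μ] (hw : IsMartingaleDifference μ r F w)
    (hv : IsMartingaleDifference μ r F v) (hw2 : ∀ y, MemLp (w y) 2 μ)
    (hv2 : ∀ y, MemLp (v y) 2 μ) {y y' : ι} (hne : y ≠ y') :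
    ∫ x, w y x * v y' x ∂μ = 0 := by
  rcases lt_or_gt_of_ne (hw.injective.ne hne) with h | h
  · simp_rw [mul_comm (w y _)]
    exact integral_mul_eq_zero_of_condExp_eq_zero (hv.le y') (hw.adapted y y' h) (hv2 y') (hw2 y)
      (hv.condExp_eq_zero y')
  · exact integral_mul_eq_zero_of_condExp_eq_zero (hw.le y) (hv.adapted y' y h) (hw2 y) (hv2 y')
      (hw.condExp_eq_zero y)

theorem integral_sum_mul_sum [IsFiniteMeasure μ] [DecidableEq ι]
    (hw : IsMartingaleDifference μ r F w)
    (hv : IsMartingaleDifference μ r F v) (hw2 : ∀ y, MemLp (w y) 2 μ)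
    (hv2 : ∀ y, MemLp (v y) 2 μ) (s t : Finset ι) :
    ∫ x, (∑ y ∈ s, w y x) * (∑ y ∈ t, v y x) ∂μ = ∑ y ∈ s ∩ t, ∫ x, w y x * v y x ∂μ := by
  have hint (y y') : Integrable (fun x => w y x * v y' x) μ := (hw2 y).integrable_mul (hv2 y')
  simp_rw [Finset.sum_mul_sum]
  rw [integral_finsetSum _ fun y _ => integrable_finsetSum _ fun y' _ => hint y y']
  simp_rw [integral_finsetSum t fun y' _ => hint _ y']
  rw [← Finset.filter_mem_eq_inter, Finset.sum_filter]
  refine Finset.sum_congr rfl fun y _ => ?_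
  split_ifs with hy
  · exact Finset.sum_eq_single_of_mem y hy fun y' _ h => integral_mul_eq_zero hw hv hw2 hv2 h.symm
  · exact Finset.sum_eq_zero fun y' hy' =>
      integral_mul_eq_zero hw hv hw2 hv2 fun h => hy (h ▸ hy')

end IsMartingaleDifference

/-- McLeish's product `∏ (1 + i w_y)`: it has mean one for martingale differences, and differs from
`exp (i ∑ w_y)` by a factor close to `exp (∑ w_y² / 2)`. -/
noncomputable def mcLeishProd (s : Finset ι) (w : ι → Ω → ℝ) (x : Ω) : ℂ :=
  ∏ y ∈ s, (1 + (w y x : ℂ) * Complex.I)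

theorem sq_norm_one_add_mul_I (a : ℝ) : ‖1 + (a : ℂ) * Complex.I‖ ^ 2 = 1 + a ^ 2 := by
  rw [← Complex.ofReal_one, Complex.norm_add_mul_I, Real.sq_sqrt (by positivity), one_pow]

theorem norm_one_add_mul_I_le_exp (a : ℝ) :
    ‖1 + (a : ℂ) * Complex.I‖ ≤ Real.exp (a ^ 2 / 2) := by
  refine (pow_le_pow_iff_left₀ (norm_nonneg _) (Real.exp_pos _).le two_ne_zero).1 ?_
  rw [sq_norm_one_add_mul_I, ← Real.exp_nat_mul, Nat.cast_ofNat, mul_div_cancel₀ _ two_ne_zero,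
    add_comm]
  exact Real.add_one_le_exp _

theorem norm_mcLeishProd_le (s : Finset ι) (w : ι → Ω → ℝ) (x : Ω) :
    ‖mcLeishProd s w x‖ ≤ Real.exp ((∑ y ∈ s, w y x ^ 2) / 2) := by
  rw [mcLeishProd, norm_prod, Finset.sum_div, Real.exp_sum]
  exact Finset.prod_le_prod (fun _ _ => norm_nonneg _) fun y _ => norm_one_add_mul_I_le_exp _

theorem sum_sq_le_card_mul {s : Finset ι} {x : Ω} (hb : ∀ y ∈ s, |w y x| ≤ c) :
    ∑ y ∈ s, w y x ^ 2 ≤ s.card * c ^ 2 := by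
  simpa using Finset.sum_le_card_nsmul s (fun y => w y x ^ 2) (c ^ 2)
    fun y hy => sq_le_sq.2 ((hb y hy).trans (le_abs_self c))

theorem aestronglyMeasurable_mcLeishProd {s : Finset ι}
    (hw : ∀ y ∈ s, AEStronglyMeasurable[m] (w y) μ) :
    AEStronglyMeasurable[m] (mcLeishProd s w) μ := by
  classical
  unfold mcLeishProd
  induction s using Finset.induction_on with
  | empty => simpa using aestronglyMeasurable_const
  | insert a s ha ih =>
    simp_rw [Finset.prod_insert ha]
    exact (((Complex.continuous_ofReal.comp_aestronglyMeasurable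
      (hw a (s.mem_insert_self a))).mul_const _).const_add _).mul
        (ih fun y hy => hw y (Finset.mem_insert_of_mem hy))

theorem integrable_mcLeishProd [IsFiniteMeasure μ] {s : Finset ι}
    (hw : ∀ y ∈ s, AEStronglyMeasurable (w y) μ) (hb : ∀ y ∈ s, ∀ᵐ x ∂μ, |w y x| ≤ c) :
    Integrable (mcLeishProd s w) μ := by
  refine .of_bound (aestronglyMeasurable_mcLeishProd hw) (Real.exp (s.card * c ^ 2 / 2)) ?_
  filter_upwards [(s.eventually_all (l := ae μ)).2 hb] with x hx
  exact (norm_mcLeishProd_le s w x).trans (Real.exp_le_exp.2 (by linarith [sum_sq_le_card_mul hx]))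

theorem IsMartingaleDifference.integral_mcLeishProd_eq_one [IsProbabilityMeasure μ]
    (hw : IsMartingaleDifference μ r F w)
    (hb : ∀ y, ∀ᵐ x ∂μ, |w y x| ≤ c) (s : Finset ι) : ∫ x, mcLeishProd s w x ∂μ = 1 := by
  classical
  induction s using Finset.induction_on_max_value r with
  | empty => simp [mcLeishProd]
  | insert a s ha hmax ih =>
    have hlt (y) (hy : y ∈ s) : r y < r a :=
      (hmax y hy).lt_of_ne fun h => ha (hw.injective h ▸ hy)
    have hint : Integrable (mcLeishProd s w) μ :=
      integrable_mcLeishProd (fun y _ => hw.aestronglyMeasurable y) fun y _ => hb y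
    have hwint : Integrable (w a • mcLeishProd s w) μ :=
      hint.bdd_smul c (hw.aestronglyMeasurable a) (hb a)
    have hzero : ∫ x, w a x • mcLeishProd s w x ∂μ = 0 :=
      integral_smul_eq_zero_of_condExp_eq_zero (hw.le a)
        (aestronglyMeasurable_mcLeishProd fun y hy => hw.adapted y a (hlt y hy))
        (.of_bound (hw.aestronglyMeasurable a) c (hb a)) hwint (hw.condExp_eq_zero a)
    have hstep (x) : mcLeishProd (insert a s) w x
        = mcLeishProd s w x + Complex.I * (w a x • mcLeishProd s w x) := by
      rw [mcLeishProd, Finset.prod_insert ha, ← mcLeishProd, Complex.real_smul]; ring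
    calc ∫ x, mcLeishProd (insert a s) w x ∂μ
        = ∫ x, (mcLeishProd s w x + Complex.I * (w a • mcLeishProd s w) x) ∂μ :=
          integral_congr_ae (Eventually.of_forall hstep)
      _ = ∫ x, mcLeishProd s w x ∂μ + Complex.I * ∫ x, w a x • mcLeishProd s w x ∂μ := by
          rw [integral_add hint (hwint.const_mul Complex.I), integral_const_mul]
          rfl
      _ = 1 := by rw [ih, hzero, mul_zero, add_zero]

theorem norm_prod_sub_prod_le_sum (s : Finset ι) {a b : ι → ℂ}
    (ha : ∀ y ∈ s, ‖a y‖ ≤ 1) (hb : ∀ y ∈ s, ‖b y‖ ≤ 1) :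
    ‖∏ y ∈ s, a y - ∏ y ∈ s, b y‖ ≤ ∑ y ∈ s, ‖a y - b y‖ := by
  classical
  induction s using Finset.induction_on with
  | empty => simp
  | insert z s hz ih =>
    rw [Finset.forall_mem_insert] at ha hb
    have hprod : ‖∏ y ∈ s, b y‖ ≤ 1 := by
      rw [norm_prod]
      exact Finset.prod_le_one (fun _ _ => norm_nonneg _) hb.2
    rw [Finset.prod_insert hz, Finset.prod_insert hz, Finset.sum_insert hz]
    calc ‖a z * ∏ y ∈ s, a y - b z * ∏ y ∈ s, b y‖
        = ‖(a z - b z) * ∏ y ∈ s, b y + a z * (∏ y ∈ s, a y - ∏ y ∈ s, b y)‖ := by ring_nf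
      _ ≤ ‖a z - b z‖ * ‖∏ y ∈ s, b y‖ + ‖a z‖ * ‖∏ y ∈ s, a y - ∏ y ∈ s, b y‖ :=
          norm_add_le_of_le (norm_mul_le _ _) (norm_mul_le _ _)
      _ ≤ ‖a z - b z‖ * 1 + 1 * ∑ y ∈ s, ‖a y - b y‖ := by
          gcongr
          exacts [ha.1, ih ha.2 hb.2]
      _ = ‖a z - b z‖ + ∑ y ∈ s, ‖a y - b y‖ := by ring

theorem norm_one_add_mul_I_mul_exp_le (a : ℝ) :
    ‖(1 + (a : ℂ) * Complex.I) * Real.exp (-a ^ 2 / 2)‖ ≤ 1 := by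
  rw [norm_mul, Complex.norm_real, Real.norm_eq_abs, Real.abs_exp]
  calc ‖1 + (a : ℂ) * Complex.I‖ * Real.exp (-a ^ 2 / 2)
      ≤ Real.exp (a ^ 2 / 2) * Real.exp (-a ^ 2 / 2) := by
        gcongr
        exact norm_one_add_mul_I_le_exp a
    _ = 1 := by rw [← Real.exp_add, neg_div, add_neg_cancel, Real.exp_zero]

theorem norm_exp_mul_I_sub_quadratic_le {a : ℝ} (ha : |a| ≤ 1) :
    ‖Complex.exp (a * Complex.I) - (1 + (a : ℂ) * Complex.I - (a : ℂ) ^ 2 / 2)‖ ≤ |a| ^ 3 := by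
  have hn : ‖(a : ℂ) * Complex.I‖ = |a| := by simp
  have h := Complex.exp_bound (hn.trans_le ha) (n := 3) (by norm_num)
  have hsum : ∑ j ∈ Finset.range 3, ((a : ℂ) * Complex.I) ^ j / (j.factorial : ℂ)
      = 1 + (a : ℂ) * Complex.I - (a : ℂ) ^ 2 / 2 := by
    simp [Finset.sum_range_succ, Nat.factorial, mul_pow]
    ring
  rw [hsum, hn] at h
  refine h.trans (mul_le_of_le_one_right (by positivity) ?_)
  norm_num [Nat.factorial]

theorem norm_one_add_mul_I_mul_exp_sub_quadratic_le {a : ℝ} (ha : |a| ≤ 1) :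
    ‖(1 + (a : ℂ) * Complex.I) * Real.exp (-a ^ 2 / 2)
      - (1 + (a : ℂ) * Complex.I - (a : ℂ) ^ 2 / 2)‖ ≤ |a| ^ 3 := by
  have hexp : |Real.exp (-a ^ 2 / 2) - 1 - (-a ^ 2 / 2)| ≤ |a| ^ 3 / 4 := by
    have ha2 : a ^ 2 ≤ 1 := (sq_le_one_iff_abs_le_one a).2 ha
    calc |Real.exp (-a ^ 2 / 2) - 1 - (-a ^ 2 / 2)| ≤ (-a ^ 2 / 2) ^ 2 :=
          Real.abs_exp_sub_one_sub_id_le (by rw [abs_le]; constructor <;> nlinarith)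
      _ = |a| ^ 3 * |a| / 4 := by rw [← pow_succ, ← sq_abs a]; ring
      _ ≤ |a| ^ 3 / 4 := by gcongr; exact mul_le_of_le_one_right (by positivity) ha
  have hnorm : ‖1 + (a : ℂ) * Complex.I‖ ≤ 2 :=
    (norm_add_le _ _).trans (by simpa using by linarith)
  have hsplit : (1 + (a : ℂ) * Complex.I) * Real.exp (-a ^ 2 / 2)
      - (1 + (a : ℂ) * Complex.I - (a : ℂ) ^ 2 / 2)
      = (1 + (a : ℂ) * Complex.I) * ((Real.exp (-a ^ 2 / 2) - 1 - (-a ^ 2 / 2) : ℝ) : ℂ)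
        - (a : ℂ) ^ 3 * Complex.I / 2 := by
    push_cast; ring
  rw [hsplit]
  calc _ ≤ ‖1 + (a : ℂ) * Complex.I‖ * |Real.exp (-a ^ 2 / 2) - 1 - (-a ^ 2 / 2)|
        + |a| ^ 3 / 2 :=
        norm_sub_le_of_le (by rw [norm_mul, Complex.norm_real, Real.norm_eq_abs]) (by simp)
    _ ≤ 2 * (|a| ^ 3 / 4) + |a| ^ 3 / 2 := by gcongr
    _ = |a| ^ 3 := by ring

theorem norm_exp_mul_I_sub_one_add_mul_I_mul_exp_le {a : ℝ} (ha : |a| ≤ 1) :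
    ‖Complex.exp (a * Complex.I) - (1 + (a : ℂ) * Complex.I) * Real.exp (-a ^ 2 / 2)‖
      ≤ 2 * |a| ^ 3 := by
  rw [two_mul]
  exact (norm_sub_le_norm_sub_add_norm_sub _ _ _).trans (add_le_add
    (norm_exp_mul_I_sub_quadratic_le ha)
    (norm_sub_rev (1 + (a : ℂ) * Complex.I - (a : ℂ) ^ 2 / 2) _ ▸
      norm_one_add_mul_I_mul_exp_sub_quadratic_le ha))

theorem abs_exp_neg_sub_exp_neg_le {a b : ℝ} (ha : 0 ≤ a) (hb : 0 ≤ b) :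
    |Real.exp (-a) - Real.exp (-b)| ≤ |a - b| := by
  wlog hab : a ≤ b generalizing a b
  · rw [abs_sub_comm, abs_sub_comm a]
    exact this hb ha (le_of_not_ge hab)
  rw [abs_of_nonneg (sub_nonneg.2 (Real.exp_le_exp.2 (neg_le_neg hab))),
    abs_of_nonpos (sub_nonpos.2 hab), neg_sub]
  calc Real.exp (-a) - Real.exp (-b) = Real.exp (-a) * (1 - Real.exp (-(b - a))) := by
        rw [mul_sub, ← Real.exp_add]; ring_nf
    _ ≤ 1 * (b - a) := mul_le_mul (Real.exp_le_one_iff.2 (neg_nonpos.2 ha))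
        (by linarith [Real.one_sub_le_exp_neg (b - a)])
        (sub_nonneg.2 (Real.exp_le_one_iff.2 (by linarith))) zero_le_one
    _ = b - a := one_mul _

theorem norm_exp_sum_sub_mcLeishProd_mul_exp_le {s : Finset ι} {x : Ω} (hc1 : c ≤ 1)
    (hb : ∀ y ∈ s, |w y x| ≤ c) :
    ‖Complex.exp ((∑ y ∈ s, w y x : ℝ) * Complex.I)
      - mcLeishProd s w x * Real.exp (-(∑ y ∈ s, w y x ^ 2) / 2)‖ ≤ 2 * c * (s.card * c ^ 2) := by
  have hexp : Complex.exp ((∑ y ∈ s, w y x : ℝ) * Complex.I)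
      = ∏ y ∈ s, Complex.exp (w y x * Complex.I) := by
    rw [← Complex.exp_sum, ← Finset.sum_mul, Complex.ofReal_sum]
  have hprod : mcLeishProd s w x * Real.exp (-(∑ y ∈ s, w y x ^ 2) / 2)
      = ∏ y ∈ s, (1 + (w y x : ℂ) * Complex.I) * Real.exp (-(w y x) ^ 2 / 2) := by
    rw [Finset.prod_mul_distrib, ← Complex.ofReal_prod, ← Real.exp_sum, ← Finset.sum_div,
      Finset.sum_neg_distrib, mcLeishProd]
  rw [hexp, hprod]
  calc _ ≤ ∑ y ∈ s, ‖Complex.exp (w y x * Complex.I)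
          - (1 + (w y x : ℂ) * Complex.I) * Real.exp (-(w y x) ^ 2 / 2)‖ :=
        norm_prod_sub_prod_le_sum s (fun y _ => (Complex.norm_exp_ofReal_mul_I _).le)
          fun y _ => norm_one_add_mul_I_mul_exp_le _
    _ ≤ s.card • (2 * c ^ 3) := Finset.sum_le_card_nsmul _ _ _ fun y hy =>
        (norm_exp_mul_I_sub_one_add_mul_I_mul_exp_le ((hb y hy).trans hc1)).trans (by
          have := hb y hy
          gcongr)
    _ = 2 * c * (s.card * c ^ 2) := by rw [nsmul_eq_mul]; ring

theorem norm_exp_sum_sub_mcLeishProd_mul_le {s : Finset ι} {x : Ω} {K σ : ℝ} (hc : 0 ≤ c)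
    (hc1 : c ≤ 1) (hσ : 0 ≤ σ) (hK : s.card * c ^ 2 ≤ K) (hb : ∀ y ∈ s, |w y x| ≤ c) :
    ‖Complex.exp ((∑ y ∈ s, w y x : ℝ) * Complex.I) - mcLeishProd s w x * Real.exp (-σ / 2)‖
      ≤ 2 * c * K + Real.exp (K / 2) * |∑ y ∈ s, w y x ^ 2 - σ| := by
  have hQ : 0 ≤ ∑ y ∈ s, w y x ^ 2 := Finset.sum_nonneg fun y _ => sq_nonneg _
  have hexp : |Real.exp (-(∑ y ∈ s, w y x ^ 2) / 2) - Real.exp (-σ / 2)|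
      ≤ |∑ y ∈ s, w y x ^ 2 - σ| := by
    rw [neg_div, neg_div]
    refine (abs_exp_neg_sub_exp_neg_le (div_nonneg hQ zero_le_two) (by positivity)).trans ?_
    rw [← sub_div, abs_div, abs_two]
    exact half_le_self (abs_nonneg _)
  refine (norm_sub_le_norm_sub_add_norm_sub _
    (mcLeishProd s w x * Real.exp (-(∑ y ∈ s, w y x ^ 2) / 2)) _).trans (add_le_add ?_ ?_)
  · exact (norm_exp_sum_sub_mcLeishProd_mul_exp_le hc1 hb).trans (by gcongr)
  · rw [← mul_sub, ← Complex.ofReal_sub, norm_mul, Complex.norm_real]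
    refine mul_le_mul ((norm_mcLeishProd_le s w x).trans ?_) hexp (abs_nonneg _)
      (Real.exp_pos _).le
    exact Real.exp_le_exp.2 (by linarith [sum_sq_le_card_mul hb])

theorem integrable_exp_mul_I [IsFiniteMeasure μ] {f : Ω → ℝ} (hf : AEStronglyMeasurable f μ) :
    Integrable (fun x => Complex.exp (f x * Complex.I)) μ :=
  .of_bound (Complex.continuous_exp.comp_aestronglyMeasurable
    ((Complex.continuous_ofReal.comp_aestronglyMeasurable hf).mul_const _)) 1
    (Eventually.of_forall fun _ => (Complex.norm_exp_ofReal_mul_I _).le)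

theorem IsMartingaleDifference.norm_integral_exp_sum_sub_le [IsProbabilityMeasure μ]
    (hw : IsMartingaleDifference μ r F w)
    {K σ : ℝ} (hc : 0 ≤ c) (hc1 : c ≤ 1) (hσ : 0 ≤ σ) (hb : ∀ y, ∀ᵐ x ∂μ, |w y x| ≤ c)
    {s : Finset ι} (hK : s.card * c ^ 2 ≤ K) :
    ‖∫ x, Complex.exp ((∑ y ∈ s, w y x : ℝ) * Complex.I) ∂μ - (Real.exp (-σ / 2) : ℂ)‖
      ≤ 2 * c * K + Real.exp (K / 2) * ∫ x, |∑ y ∈ s, w y x ^ 2 - σ| ∂μ := by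
  have hbs : ∀ᵐ x ∂μ, ∀ y ∈ s, |w y x| ≤ c := (s.eventually_all (l := ae μ)).2 fun y _ => hb y
  have hprod : Integrable (mcLeishProd s w) μ :=
    integrable_mcLeishProd (fun y _ => hw.aestronglyMeasurable y) fun y _ => hb y
  have hsum : Integrable (fun x => |∑ y ∈ s, w y x ^ 2 - σ|) μ :=
    ((integrable_finsetSum s fun y _ => (MemLp.of_bound (hw.aestronglyMeasurable y) c
      (hb y)).integrable_sq).sub (integrable_const σ)).abs
  have hexp : Integrable (fun x => Complex.exp ((∑ y ∈ s, w y x : ℝ) * Complex.I)) μ :=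
    integrable_exp_mul_I (Finset.aestronglyMeasurable_fun_sum s fun y _ =>
      hw.aestronglyMeasurable y)
  calc _ = ‖∫ x, (Complex.exp ((∑ y ∈ s, w y x : ℝ) * Complex.I)
          - mcLeishProd s w x * Real.exp (-σ / 2)) ∂μ‖ := by
        rw [integral_sub hexp (hprod.mul_const _), integral_mul_const,
          hw.integral_mcLeishProd_eq_one hb, one_mul]
    _ ≤ ∫ x, (2 * c * K + Real.exp (K / 2) * |∑ y ∈ s, w y x ^ 2 - σ|) ∂μ :=
        norm_integral_le_of_norm_le ((integrable_const _).add (hsum.const_mul _))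
          (hbs.mono fun x hx => norm_exp_sum_sub_mcLeishProd_mul_le hc hc1 hσ hK hx)
    _ = _ := by
        rw [integral_add (integrable_const _) (hsum.const_mul _),
          integral_const_mul (Real.exp (K / 2))]
        simp

end MartingaleDifferences

section SecondMoments

variable {Ω : Type*} {mΩ : MeasurableSpace Ω} {μ : Measure Ω} {f g f' g' : Ω → ℝ}

theorem integral_abs_mul_abs_le_sqrt (hf : MemLp f 2 μ) (hg : MemLp g 2 μ) :
    ∫ x, |f x| * |g x| ∂μ ≤ √(∫ x, f x ^ 2 ∂μ) * √(∫ x, g x ^ 2 ∂μ) := by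
  have h := integral_mul_norm_le_Lp_mul_Lq (μ := μ) (f := f) (g := g) (p := 2) (q := 2)
    Real.HolderConjugate.two_two (by simpa using hf) (by simpa using hg)
  simpa [Real.sqrt_eq_rpow] using h

theorem abs_integral_mul_le_sqrt (hf : MemLp f 2 μ) (hg : MemLp g 2 μ) :
    |∫ x, f x * g x ∂μ| ≤ √(∫ x, f x ^ 2 ∂μ) * √(∫ x, g x ^ 2 ∂μ) := by
  refine abs_integral_le_integral_abs.trans ?_
  simp_rw [abs_mul]
  exact integral_abs_mul_abs_le_sqrt hf hg

theorem integral_abs_le_sqrt [IsProbabilityMeasure μ] (hf : MemLp f 2 μ) :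
    ∫ x, |f x| ∂μ ≤ √(∫ x, f x ^ 2 ∂μ) := by
  simpa using integral_abs_mul_abs_le_sqrt hf (memLp_const (1 : ℝ))

theorem integral_sq_add_le (hf : MemLp f 2 μ) (hg : MemLp g 2 μ) :
    ∫ x, (f x + g x) ^ 2 ∂μ ≤ 2 * ∫ x, f x ^ 2 ∂μ + 2 * ∫ x, g x ^ 2 ∂μ := by
  rw [← mul_add, ← integral_add hf.integrable_sq hg.integrable_sq, ← integral_const_mul]
  exact integral_mono (hf.add hg).integrable_sq
    ((hf.integrable_sq.add hg.integrable_sq).const_mul 2) fun x => add_sq_le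

theorem abs_integral_mul_sub_le (hf : MemLp f 2 μ) (hg : MemLp g 2 μ)
    (hf' : MemLp f' 2 μ) (hg' : MemLp g' 2 μ) :
    |∫ x, f' x * g' x ∂μ - ∫ x, f x * g x ∂μ|
      ≤ √(∫ x, (f x - f' x) ^ 2 ∂μ) * √(∫ x, g x ^ 2 ∂μ)
        + √(∫ x, f' x ^ 2 ∂μ) * √(∫ x, (g x - g' x) ^ 2 ∂μ) := by
  have hdf : MemLp (fun x => f x - f' x) 2 μ := hf.sub hf'
  have hdg : MemLp (fun x => g x - g' x) 2 μ := hg.sub hg'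
  have hsplit : ∫ x, f' x * g' x ∂μ - ∫ x, f x * g x ∂μ
      = -(∫ x, (f x - f' x) * g x ∂μ + ∫ x, f' x * (g x - g' x) ∂μ) := by
    have hdfg : Integrable (fun x => (f x - f' x) * g x) μ := hdf.integrable_mul hg
    have hf'dg : Integrable (fun x => f' x * (g x - g' x)) μ := hf'.integrable_mul hdg
    have hfg : Integrable (fun x => f x * g x) μ := hf.integrable_mul hg
    have hfg' : Integrable (fun x => f' x * g' x) μ := hf'.integrable_mul hg'
    rw [← integral_add hdfg hf'dg, ← integral_sub hfg' hfg, ← integral_neg]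
    congr 1 with x
    ring
  rw [hsplit, abs_neg]
  exact (abs_add_le _ _).trans
    (add_le_add (abs_integral_mul_le_sqrt hdf hg) (abs_integral_mul_le_sqrt hf' hdg))

theorem tendsto_integral_mul_of_approx {ι : Type*} {l : Filter ι} {f g f' g' : ι → Ω → ℝ}
    {a b c : ℝ} (hf : ∀ n, MemLp (f n) 2 μ) (hg : ∀ n, MemLp (g n) 2 μ)
    (hf' : ∀ n, MemLp (f' n) 2 μ) (hg' : ∀ n, MemLp (g' n) 2 μ)
    (hff' : Tendsto (fun n => ∫ x, (f n x - f' n x) ^ 2 ∂μ) l (𝓝 0))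
    (hgg' : Tendsto (fun n => ∫ x, (g n x - g' n x) ^ 2 ∂μ) l (𝓝 0))
    (hf2 : Tendsto (fun n => ∫ x, f n x ^ 2 ∂μ) l (𝓝 a))
    (hg2 : Tendsto (fun n => ∫ x, g n x ^ 2 ∂μ) l (𝓝 b))
    (hfg : Tendsto (fun n => ∫ x, f n x * g n x ∂μ) l (𝓝 c)) :
    Tendsto (fun n => ∫ x, f' n x * g' n x ∂μ) l (𝓝 c) := by
  have hbound : Tendsto (fun n => √(∫ x, (f n x - f' n x) ^ 2 ∂μ) * √(∫ x, g n x ^ 2 ∂μ)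
      + √(2 * ∫ x, f n x ^ 2 ∂μ + 2 * ∫ x, (f n x - f' n x) ^ 2 ∂μ)
        * √(∫ x, (g n x - g' n x) ^ 2 ∂μ)) l (𝓝 0) := by
    simpa using (hff'.sqrt.mul hg2.sqrt).add
      (((hf2.const_mul 2).add (hff'.const_mul 2)).sqrt.mul hgg'.sqrt)
  refine tendsto_of_tendsto_of_dist hfg (squeeze_zero (fun n => dist_nonneg) (fun n => ?_) hbound)
  have hf'2 : ∫ x, f' n x ^ 2 ∂μ ≤ 2 * ∫ x, f n x ^ 2 ∂μ + 2 * ∫ x, (f n x - f' n x) ^ 2 ∂μ := by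
    have h := integral_sq_add_le (hf n) ((hf' n).sub (hf n))
    simpa only [Pi.sub_apply, add_sub_cancel, sub_sq_comm (f' n _)] using h
  rw [dist_comm, Real.dist_eq]
  refine (abs_integral_mul_sub_le (hf n) (hg n) (hf' n) (hg' n)).trans ?_
  gcongr

end SecondMoments

section LawOfLargeNumbers

variable {d : ℕ} {E : Type*} [MeasurableSpace E] {P₀ : Measure E} [IsProbabilityMeasure P₀]
  {g : ((Fin d → ℤ) → E) → ℝ}

theorem integral_mul_shift_shift_eq {h : ((Fin d → ℤ) → E) → ℝ}
    (hg : AEStronglyMeasurable g (iidLaw _ P₀)) (hh : AEStronglyMeasurable h (iidLaw _ P₀))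
    (y y' : Fin d → ℤ) :
    ∫ x, g (shift y x) * h (shift y' x) ∂iidLaw _ P₀
      = ∫ x, g x * h (shift (y' - y) x) ∂iidLaw _ P₀ := by
  rw [← integral_comp_measurePreserving (measurePreserving_shift (P₀ := P₀) y)
    (f := fun x => g x * h (shift (y' - y) x)) 
    (hg.mul (hh.comp_measurePreserving (measurePreserving_shift (y' - y))))]
  simp [shift_shift]

theorem integral_shift_mul_eq_zero_of_disjoint {S : Set (Fin d → ℤ)} {z : Fin d → ℤ}
    (hgm : StronglyMeasurable[cylinderEvents S] g) (hg : MemLp g 2 (iidLaw _ P₀))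
    (hg0 : ∫ x, g x ∂iidLaw _ P₀ = 0) (hz : Disjoint S ((· + z) '' S)) :
    ∫ x, g (shift z x) * g x ∂iidLaw _ P₀ = 0 := by
  have hgz : MemLp (fun x => g (shift z x)) 2 (iidLaw _ P₀) :=
    hg.comp_measurePreserving (measurePreserving_shift z)
  have hgzm : StronglyMeasurable[cylinderEvents ((· + z) '' S)] fun x => g (shift z x) := by
    rw [← comap_shift_cylinderEvents]
    exact hgm.comp_measurable (comap_measurable _)
  refine integral_mul_eq_zero_of_condExp_eq_zero (m := cylinderEvents S) cylinderEvents_le_pi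
    hgm.aestronglyMeasurable hgz hg ?_
  have hbot : cylinderEvents (X := fun _ : Fin d → ℤ => E) ∅ = ⊥ := by simp [cylinderEvents]
  have hcond := condExp_cylinderEvents_ae_eq_inter _ S (hgz.integrable one_le_two) hgzm
  rw [hz.inter_eq, hbot, condExp_bot, integral_comp_measurePreserving (measurePreserving_shift z)
    hg.aestronglyMeasurable, hg0] at hcond
  exact hcond

theorem integral_sq_sum_shift_le {s : Finset (Fin d → ℤ)}
    (hgm : StronglyMeasurable[cylinderEvents (s : Set (Fin d → ℤ))] g)
    (hg : MemLp g 2 (iidLaw _ P₀)) (hg0 : ∫ x, g x ∂iidLaw _ P₀ = 0) (Λ : Finset (Fin d → ℤ)) :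
    ∫ x, (∑ y ∈ Λ, g (shift y x)) ^ 2 ∂iidLaw _ P₀
      ≤ Λ.card * ((s - s).card * ∫ x, g x ^ 2 ∂iidLaw _ P₀) := by
  classical
  have hgy (y) : MemLp (fun x => g (shift y x)) 2 (iidLaw _ P₀) :=
    hg.comp_measurePreserving (measurePreserving_shift y)
  have hint (y y') : Integrable (fun x => g (shift y x) * g (shift y' x)) (iidLaw _ P₀) :=
    (hgy y).integrable_mul (hgy y')
  have hsq (y) : ∫ x, g (shift y x) ^ 2 ∂iidLaw _ P₀ = ∫ x, g x ^ 2 ∂iidLaw _ P₀ :=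
    integral_comp_measurePreserving (measurePreserving_shift y) (hg.aestronglyMeasurable.pow 2)
  have hcov (y y') : ∫ x, g (shift y x) * g (shift y' x) ∂iidLaw _ P₀
      ≤ if y' - y ∈ s - s then ∫ x, g x ^ 2 ∂iidLaw _ P₀ else 0 := by
    split_ifs with hmem
    · refine (le_abs_self _).trans ((abs_integral_mul_le_sqrt (hgy y) (hgy y')).trans_eq ?_)
      rw [hsq, hsq, Real.mul_self_sqrt (integral_nonneg fun _ => sq_nonneg _)]
    · rw [integral_mul_shift_shift_eq hg.1 hg.1]
      refine (integral_congr_ae (Eventually.of_forall fun x => mul_comm _ _)).trans_le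
        (integral_shift_mul_eq_zero_of_disjoint hgm hg hg0 ?_).le
      rw [Set.disjoint_right]
      rintro _ ⟨z, hz, rfl⟩ hz'
      exact hmem (Finset.mem_sub.2 ⟨_, hz', _, hz, add_sub_cancel_left _ _⟩)
  have hcard (y) : (Λ.filter fun y' => y' - y ∈ s - s).card ≤ (s - s).card :=
    Finset.card_le_card_of_injOn (· - y) (fun y' hy' => (Finset.mem_filter.1 hy').2)
      (sub_left_injective.injOn)
  simp_rw [sq (∑ _ ∈ Λ, _), Finset.sum_mul_sum]
  rw [integral_finsetSum _ fun _ _ => integrable_finsetSum _ fun _ _ => hint _ _, ← nsmul_eq_mul]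
  refine Finset.sum_le_card_nsmul _ _ _ fun y _ => ?_
  rw [integral_finsetSum _ fun _ _ => hint y _]
  refine (Finset.sum_le_sum fun y' _ => hcov y y').trans ?_
  rw [← Finset.sum_filter, Finset.sum_const, nsmul_eq_mul]
  exact mul_le_mul_of_nonneg_right (Nat.cast_le.2 (hcard y))
    (integral_nonneg fun _ => sq_nonneg _)

theorem integral_abs_sum_shift_le (hg : Integrable g (iidLaw _ P₀)) (Λ : Finset (Fin d → ℤ)) :
    ∫ x, |∑ y ∈ Λ, g (shift y x)| ∂iidLaw _ P₀ ≤ Λ.card * ∫ x, |g x| ∂iidLaw _ P₀ := by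
  have hgy (y) : Integrable (fun x => |g (shift y x)|) (iidLaw _ P₀) :=
    ((measurePreserving_shift y).integrable_comp_of_integrable hg).abs
  calc _ ≤ ∫ x, ∑ y ∈ Λ, |g (shift y x)| ∂iidLaw _ P₀ :=
        integral_mono_of_nonneg (Eventually.of_forall fun _ => abs_nonneg _)
          (integrable_finsetSum _ fun y _ => hgy y)
          (Eventually.of_forall fun _ => Finset.abs_sum_le_sum_abs _ _)
    _ = ∑ _ ∈ Λ, ∫ x, |g x| ∂iidLaw _ P₀ := by
        rw [integral_finsetSum _ fun y _ => hgy y]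
        exact Finset.sum_congr rfl fun y _ =>
          integral_comp_measurePreserving (measurePreserving_shift y) hg.abs.1
    _ = Λ.card * ∫ x, |g x| ∂iidLaw _ P₀ := by rw [Finset.sum_const, nsmul_eq_mul]

theorem exists_integral_abs_sum_shift_le (hgm : StronglyMeasurable g)
    (hg : MemLp g 2 (iidLaw _ P₀)) (hg0 : ∫ x, g x ∂iidLaw _ P₀ = 0) {ε : ℝ} (hε : 0 < ε) :
    ∃ C, ∀ Λ : Finset (Fin d → ℤ),
      ∫ x, |∑ y ∈ Λ, g (shift y x)| ∂iidLaw _ P₀ ≤ Λ.card * ε + √(Λ.card * C) := by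
  have hgi : Integrable g (iidLaw _ P₀) := hg.integrable one_le_two
  -- The approximation by a function `g'` of finitely many coordinates makes distant translates
  -- independent, so that the second moment of their sum is linear in `Λ.card`.
  obtain ⟨s, hs⟩ := exists_finset_integral_abs_condExp_sub_le _ hgi hgm hε
  set g' := (iidLaw _ P₀)[g | cylinderEvents (s : Set (Fin d → ℤ))]
  have hg' : MemLp g' 2 (iidLaw _ P₀) := hg.condExp (by norm_num)
  have hg'0 : ∫ x, g' x ∂iidLaw _ P₀ = 0 := (integral_condExp cylinderEvents_le_pi).trans hg0
  have hdiff : Integrable (g' - g) (iidLaw _ P₀) := integrable_condExp.sub hgi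
  refine ⟨(s - s).card * ∫ x, g' x ^ 2 ∂iidLaw _ P₀, fun Λ => ?_⟩
  have hsum : MemLp (fun x => ∑ y ∈ Λ, g' (shift y x)) 2 (iidLaw _ P₀) :=
    memLp_finsetSum _ fun y _ => hg'.comp_measurePreserving (measurePreserving_shift y)
  have hsumd : Integrable (fun x => ∑ y ∈ Λ, (g' - g) (shift y x)) (iidLaw _ P₀) :=
    integrable_finsetSum _ fun y _ =>
      (measurePreserving_shift y).integrable_comp_of_integrable hdiff
  calc _ ≤ ∫ x, (|∑ y ∈ Λ, (g' - g) (shift y x)| + |∑ y ∈ Λ, g' (shift y x)|) ∂iidLaw _ P₀ := by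
        refine integral_mono_of_nonneg (Eventually.of_forall fun _ => abs_nonneg _)
          (hsumd.abs.add (hsum.integrable one_le_two).abs) (Eventually.of_forall fun x => ?_)
        simpa [add_comm] using
          abs_sub (∑ y ∈ Λ, g' (shift y x)) (∑ y ∈ Λ, (g' - g) (shift y x))
    _ ≤ Λ.card * ∫ x, |(g' - g) x| ∂iidLaw _ P₀
        + √(∫ x, (∑ y ∈ Λ, g' (shift y x)) ^ 2 ∂iidLaw _ P₀) := by
        rw [integral_add hsumd.abs (hsum.integrable one_le_two).abs]
        exact add_le_add (integral_abs_sum_shift_le hdiff Λ) (integral_abs_le_sqrt hsum)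
    _ ≤ _ := add_le_add (mul_le_mul_of_nonneg_left hs (Nat.cast_nonneg _))
        (Real.sqrt_le_sqrt (integral_sq_sum_shift_le stronglyMeasurable_condExp hg' hg'0 Λ))

variable {Λ : ℕ → Finset (Fin d → ℤ)} {N : ℕ → ℝ} {v : ℝ}

theorem tendsto_integral_abs_sum_shift_of_integral_eq_zero (hgm : StronglyMeasurable g)
    (hg : MemLp g 2 (iidLaw _ P₀)) (hg0 : ∫ x, g x ∂iidLaw _ P₀ = 0)
    (hN0 : ∀ n, 0 < N n) (hN : Tendsto N atTop atTop)
    (hv : Tendsto (fun n => (Λ n).card / N n) atTop (𝓝 v)) :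
    Tendsto (fun n => ∫ x, |(N n)⁻¹ * ∑ y ∈ Λ n, g (shift y x)| ∂iidLaw _ P₀) atTop (𝓝 0) := by
  have hv0 : 0 ≤ v := ge_of_tendsto' hv fun n => div_nonneg (Nat.cast_nonneg _) (hN0 n).le
  refine tendsto_order.2 ⟨fun a ha => Eventually.of_forall fun n =>
    ha.trans_le (integral_nonneg fun _ => abs_nonneg _), fun ε hε => ?_⟩
  obtain ⟨C, hC⟩ := exists_integral_abs_sum_shift_le hgm hg hg0 (ε := ε / (v + 1)) (by positivity)
  have hlim : Tendsto (fun n => (Λ n).card / N n * (ε / (v + 1))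
      + √((Λ n).card / N n * C * (N n)⁻¹)) atTop (𝓝 (v * (ε / (v + 1)) + √(v * C * 0))) :=
    (hv.mul_const _).add ((hv.mul_const C).mul hN.inv_tendsto_atTop).sqrt
  have hlt : v * (ε / (v + 1)) + √(v * C * 0) < ε := by
    rw [mul_zero, Real.sqrt_zero, add_zero, mul_div_left_comm]
    exact mul_lt_of_lt_one_right hε ((div_lt_one (by positivity)).2 (lt_add_one v))
  filter_upwards [hlim.eventually (gt_mem_nhds hlt)] with n hn
  refine lt_of_le_of_lt ?_ hn
  have hinv : 0 ≤ (N n)⁻¹ := inv_nonneg.2 (hN0 n).le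
  simp_rw [abs_mul, integral_const_mul, abs_of_nonneg hinv]
  refine (mul_le_mul_of_nonneg_left (hC (Λ n)) hinv).trans_eq ?_
  have hsqrt : √((Λ n).card / N n * C * (N n)⁻¹) = (N n)⁻¹ * √((Λ n).card * C) := by
    rw [← Real.sqrt_sq hinv, ← Real.sqrt_mul (sq_nonneg _), Real.sqrt_sq hinv]
    congr 1; ring
  rw [hsqrt]
  ring

theorem tendsto_integral_abs_sum_shift_sub (hgm : StronglyMeasurable g)
    (hg : MemLp g 2 (iidLaw _ P₀)) (hN0 : ∀ n, 0 < N n) (hN : Tendsto N atTop atTop)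
    (hv : Tendsto (fun n => (Λ n).card / N n) atTop (𝓝 v)) :
    Tendsto (fun n => ∫ x, |(N n)⁻¹ * ∑ y ∈ Λ n, g (shift y x) - v * ∫ x', g x' ∂iidLaw _ P₀|
      ∂iidLaw _ P₀) atTop (𝓝 0) := by
  set e := ∫ x', g x' ∂iidLaw _ P₀
  have hc : MemLp (fun x => g x - e) 2 (iidLaw _ P₀) := hg.sub (memLp_const e)
  have hc0 : ∫ x, (g x - e) ∂iidLaw _ P₀ = 0 := by
    simp [integral_sub (hg.integrable one_le_two) (integrable_const e), e]
  have hcm : StronglyMeasurable fun x => g x - e := hgm.sub stronglyMeasurable_const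
  have hlim := (tendsto_integral_abs_sum_shift_of_integral_eq_zero hcm hc hc0 hN0 hN hv).add
    ((hv.sub_const v).abs.mul_const |e|)
  rw [sub_self, abs_zero, zero_mul, add_zero] at hlim
  refine squeeze_zero (fun n => integral_nonneg fun x => abs_nonneg _) (fun n => ?_) hlim
  have hint : Integrable (fun x => |(N n)⁻¹ * ∑ y ∈ Λ n, (g (shift y x) - e)|) (iidLaw _ P₀) :=
    (((integrable_finsetSum _ fun y _ => (measurePreserving_shift y).integrable_comp_of_integrable
      (hc.integrable one_le_two))).const_mul _).abs
  calc _ ≤ ∫ x, (|(N n)⁻¹ * ∑ y ∈ Λ n, (g (shift y x) - e)| + |(Λ n).card / N n - v| * |e|)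
        ∂iidLaw _ P₀ := by
        refine integral_mono_of_nonneg (Eventually.of_forall fun x => abs_nonneg _)
          (hint.add (integrable_const _)) (Eventually.of_forall fun x => ?_)
        simp only
        rw [← abs_mul, Finset.sum_sub_distrib, Finset.sum_const, nsmul_eq_mul]
        refine le_trans (le_of_eq ?_) (abs_add_le _ _)
        ring_nf
    _ = _ := by rw [integral_add hint (integrable_const _)]; simp

end LawOfLargeNumbers

section Truncation

variable {Ω : Type*} {m mΩ : MeasurableSpace Ω} {μ : Measure Ω} {f : Ω → ℝ}

theorem tendsto_integral_sub_truncation_sq (hf : MemLp f 2 μ) :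
    Tendsto (fun M : ℕ => ∫ x, (f x - truncation f M x) ^ 2 ∂μ) atTop (𝓝 0) := by
  have hle (M : ℕ) (x) : |f x - truncation f M x| ≤ |f x| := by
    simp only [truncation, Set.indicator, id, Function.comp_apply]
    split_ifs <;> simp
  have hlim := tendsto_integral_of_dominated_convergence (μ := μ)
    (F := fun (M : ℕ) x => (f x - truncation f M x) ^ 2) (f := fun _ => 0) (fun x => f x ^ 2)
    (fun M => (hf.1.sub hf.1.truncation).pow 2) hf.integrable_sq
    (fun M => Eventually.of_forall fun x => by
      simpa using sq_le_sq.2 (hle M x))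
    (Eventually.of_forall fun x => by
      obtain ⟨M₀, hM₀⟩ := exists_nat_gt |f x|
      refine tendsto_const_nhds.congr' ?_
      filter_upwards [eventually_ge_atTop M₀] with M hM
      rw [truncation_eq_self (hM₀.trans_le (Nat.cast_le.2 hM)), sub_self, zero_pow two_ne_zero])
  simpa using hlim

theorem integral_sq_sub_condExp_le [IsFiniteMeasure μ] (hm : m ≤ mΩ) (hf : MemLp f 2 μ) :
    ∫ x, (f x - (μ[f | m]) x) ^ 2 ∂μ ≤ ∫ x, f x ^ 2 ∂μ :=
  calc ∫ x, (f x - (μ[f | m]) x) ^ 2 ∂μ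
    _ = ∫ x, (Var[f; μ | m]) x ∂μ := (integral_condExp hm).symm
    _ ≤ ∫ x, (μ[f ^ 2 | m]) x ∂μ :=
        integral_mono_ae integrable_condVar integrable_condExp (condVar_ae_le_condExp_sq hm hf)
    _ = ∫ x, f x ^ 2 ∂μ := integral_condExp hm

theorem integral_sq_sub_sub_condExp_le [IsFiniteMeasure μ] {g : Ω → ℝ} (hm : m ≤ mΩ)
    (hg : MemLp g 2 μ) (hg0 : μ[g | m] =ᵐ[μ] 0) (hf : MemLp f 2 μ) :
    ∫ x, (g x - (f x - (μ[f | m]) x)) ^ 2 ∂μ ≤ ∫ x, (g x - f x) ^ 2 ∂μ := by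
  refine le_trans (le_of_eq (integral_congr_ae ?_)) (integral_sq_sub_condExp_le hm (hg.sub hf))
  have hsub : μ[fun x => g x - f x | m] =ᵐ[μ] μ[g | m] - μ[f | m] :=
    condExp_sub (hg.integrable one_le_two) (hf.integrable one_le_two) m
  filter_upwards [hsub, hg0] with x hx hx0
  simp only [Pi.sub_apply, hx, hx0, Pi.zero_apply]
  ring

end Truncation

section LexicographicPast

variable {d : ℕ} {E : Type*} [MeasurableSpace E]

theorem image_add_lexIic (y : Fin d → ℤ) :
    (· + y) '' {z : Fin d → ℤ | toLex z ≤ toLex 0} = {z | toLex z ≤ toLex y} := by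
  ext z
  rw [Set.image_add_right]
  simp [← sub_eq_add_neg]

theorem image_add_lexIio (y : Fin d → ℤ) :
    (· + y) '' {z : Fin d → ℤ | toLex z < toLex 0} = {z | toLex z < toLex y} := by
  ext z
  rw [Set.image_add_right]
  simp [← sub_eq_add_neg]

/-- The σ-field of the coordinates strictly before `y` in the lexicographic order. -/
abbrev strictPast (d : ℕ) (E : Type*) [MeasurableSpace E] (y : Fin d → ℤ) :
    MeasurableSpace ((Fin d → ℤ) → E) :=
  cylinderEvents (X := fun _ : Fin d → ℤ => E) {z | toLex z < toLex y}

/-- The σ-field of the coordinates at or before `y` in the lexicographic order. -/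
abbrev weakPast (d : ℕ) (E : Type*) [MeasurableSpace E] (y : Fin d → ℤ) :
    MeasurableSpace ((Fin d → ℤ) → E) :=
  cylinderEvents (X := fun _ : Fin d → ℤ => E) {z | toLex z ≤ toLex y}

theorem weakPast_le_strictPast {y y' : Fin d → ℤ} (h : toLex y < toLex y') :
    weakPast d E y ≤ strictPast d E y' :=
  cylinderEvents_mono fun _ hz => lt_of_le_of_lt hz h

theorem strictPast_le_weakPast (y : Fin d → ℤ) : strictPast d E y ≤ weakPast d E y :=
  cylinderEvents_mono fun _ hz => le_of_lt (α := Lex (Fin d → ℤ)) hz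

theorem comap_shift_weakPast (y : Fin d → ℤ) :
    (weakPast d E 0).comap (shift y) = weakPast d E y := by
  rw [comap_shift_cylinderEvents, image_add_lexIic]

theorem comap_shift_strictPast (y : Fin d → ℤ) :
    (strictPast d E 0).comap (shift y) = strictPast d E y := by
  rw [comap_shift_cylinderEvents, image_add_lexIio]

end LexicographicPast

section StationaryMartingaleDifference

variable {d : ℕ} {E : Type*} [MeasurableSpace E] {P₀ : Measure E} [IsProbabilityMeasure P₀]

/-- A square integrable function `g` of an i.i.d. field on `ℤ^d` that depends on the lexicographic
past of the origin only and is centred given its strict past, so that the translates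
`x ↦ g (shift y x)` form a stationary family of martingale differences. -/
structure IsStationaryMartingaleDifference (P₀ : Measure E) (g : ((Fin d → ℤ) → E) → ℝ) :
    Prop where
  stronglyMeasurable : StronglyMeasurable[weakPast d E 0] g
  memLp : MemLp g 2 (iidLaw _ P₀)
  condExp_eq_zero : (iidLaw _ P₀)[g | strictPast d E 0] =ᵐ[iidLaw _ P₀] 0

variable {g g' : ((Fin d → ℤ) → E) → ℝ}

namespace IsStationaryMartingaleDifference

theorem memLp_shift (hg : IsStationaryMartingaleDifference P₀ g) (y : Fin d → ℤ) :
    MemLp (fun x => g (shift y x)) 2 (iidLaw _ P₀) :=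
  hg.memLp.comp_measurePreserving (measurePreserving_shift y)

omit [IsProbabilityMeasure P₀] in
theorem stronglyMeasurable_shift (hg : IsStationaryMartingaleDifference P₀ g) {y y' : Fin d → ℤ}
    (h : toLex y < toLex y') : StronglyMeasurable[strictPast d E y'] fun x => g (shift y x) := by
  refine StronglyMeasurable.mono ?_ (weakPast_le_strictPast h)
  rw [← comap_shift_weakPast]
  exact hg.stronglyMeasurable.comp_measurable (comap_measurable _)

theorem condExp_shift_eq_zero (hg : IsStationaryMartingaleDifference P₀ g) (y : Fin d → ℤ) :
    (iidLaw _ P₀)[fun x => g (shift y x) | strictPast d E y] =ᵐ[iidLaw _ P₀] 0 := by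
  have hτ := measurePreserving_shift (P₀ := P₀) y
  have hcomp := condExp_comp_measurePreserving hτ
    (cylinderEvents_le_pi (X := fun _ : Fin d → ℤ => E) (Δ := {z | toLex z < toLex 0}))
    (hg.memLp.integrable one_le_two)
  rw [comap_shift_strictPast] at hcomp
  filter_upwards [hcomp, hτ.quasiMeasurePreserving.ae hg.condExp_eq_zero] with x h1 h2
  exact h1.trans h2

theorem isMartingaleDifference_shift {G : (Fin d → ℤ) → ((Fin d → ℤ) → E) → ℝ}
    (hG : ∀ y, IsStationaryMartingaleDifference P₀ (G y)) :
    IsMartingaleDifference (iidLaw _ P₀) toLex (strictPast d E) fun y x => G y (shift y x) where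
  injective := toLex.injective
  le _ := cylinderEvents_le_pi
  aestronglyMeasurable y := ((hG y).memLp_shift y).1
  adapted y _ h := ((hG y).stronglyMeasurable_shift h).aestronglyMeasurable
  condExp_eq_zero y := (hG y).condExp_shift_eq_zero y

theorem sub (hg : IsStationaryMartingaleDifference P₀ g)
    (hg' : IsStationaryMartingaleDifference P₀ g') :
    IsStationaryMartingaleDifference P₀ fun x => g x - g' x where
  stronglyMeasurable := hg.stronglyMeasurable.sub hg'.stronglyMeasurable
  memLp := hg.memLp.sub hg'.memLp
  condExp_eq_zero := by
    refine (condExp_sub (hg.memLp.integrable one_le_two) (hg'.memLp.integrable one_le_two) _).trans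
      ?_
    filter_upwards [hg.condExp_eq_zero, hg'.condExp_eq_zero] with x h1 h2
    simp [h1, h2]

end IsStationaryMartingaleDifference

theorem isStationaryMartingaleDifference_sub_condExp (hgm : StronglyMeasurable[weakPast d E 0] g)
    (hg : MemLp g 2 (iidLaw _ P₀)) :
    IsStationaryMartingaleDifference P₀
      fun x => g x - ((iidLaw _ P₀)[g | strictPast d E 0]) x where
  stronglyMeasurable := hgm.sub (stronglyMeasurable_condExp.mono (strictPast_le_weakPast 0))
  memLp := hg.sub (hg.condExp (by norm_num))
  condExp_eq_zero := by
    refine (condExp_sub (hg.integrable one_le_two) integrable_condExp _).trans ?_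
    rw [condExp_of_stronglyMeasurable cylinderEvents_le_pi stronglyMeasurable_condExp
      integrable_condExp, sub_self]

theorem IsStationaryMartingaleDifference.of_tendsto {M : ℕ → ((Fin d → ℤ) → E) → ℝ}
    (hM : ∀ n, IsStationaryMartingaleDifference P₀ (M n))
    (hgm : StronglyMeasurable[weakPast d E 0] g) (hg : MemLp g 2 (iidLaw _ P₀))
    (hlim : Tendsto (fun n => ∫ x, (M n x - g x) ^ 2 ∂iidLaw _ P₀) atTop (𝓝 0)) :
    IsStationaryMartingaleDifference P₀ g where
  stronglyMeasurable := hgm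
  memLp := hg
  condExp_eq_zero := by
    set c := (iidLaw _ P₀)[g | strictPast d E 0]
    have hc : MemLp c 2 (iidLaw _ P₀) := hg.condExp (by norm_num)
    have hle (n) : ∫ x, c x ^ 2 ∂iidLaw _ P₀ ≤ ∫ x, (M n x - g x) ^ 2 ∂iidLaw _ P₀ := by
      refine (integral_congr_ae ?_).trans_le
        (integral_sq_condExp_le (m := strictPast d E 0) ((hM n).memLp.sub hg))
      filter_upwards [(hM n).condExp_eq_zero, condExp_sub ((hM n).memLp.integrable one_le_two)
        (hg.integrable one_le_two) (strictPast d E 0)] with x h1 h2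
      have hneg : ((iidLaw _ P₀)[fun x => M n x - g x | strictPast d E 0]) x = -c x :=
        h2.trans (by simp [h1, c])
      rw [hneg, neg_sq]
    have h0 : ∫ x, c x ^ 2 ∂iidLaw _ P₀ = 0 :=
      le_antisymm (ge_of_tendsto' hlim hle) (integral_nonneg fun x => sq_nonneg _)
    filter_upwards [(integral_eq_zero_iff_of_nonneg (fun x => sq_nonneg _) hc.integrable_sq).1 h0]
      with x hx
    simpa using hx

theorem IsStationaryMartingaleDifference.exists_bounded_approx
    (hg : IsStationaryMartingaleDifference P₀ g) {ε : ℝ} (hε : 0 < ε) :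
    ∃ g', IsStationaryMartingaleDifference P₀ g' ∧ (∃ K, ∀ᵐ x ∂iidLaw _ P₀, |g' x| ≤ K) ∧
      ∫ x, (g x - g' x) ^ 2 ∂iidLaw _ P₀ ≤ ε := by
  obtain ⟨M, hM⟩ :=
    ((tendsto_integral_sub_truncation_sq hg.memLp).eventually (ge_mem_nhds hε)).exists
  have hφm : StronglyMeasurable[weakPast d E 0] (truncation g M) :=
    (stronglyMeasurable_id.indicator measurableSet_Ioc).comp_measurable
      hg.stronglyMeasurable.measurable
  have hφ2 : MemLp (truncation g M) 2 (iidLaw _ P₀) := hg.memLp.1.memLp_truncation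
  have hφb (x) : |truncation g M x| ≤ M := by simpa using abs_truncation_le_bound g M x
  refine ⟨_, isStationaryMartingaleDifference_sub_condExp hφm hφ2, ⟨M + M, ?_⟩,
    (integral_sq_sub_sub_condExp_le cylinderEvents_le_pi hg.memLp hg.condExp_eq_zero hφ2).trans hM⟩
  filter_upwards [ae_bdd_abs_condExp_of_ae_bdd_abs (m := strictPast d E 0)
    (Eventually.of_forall hφb)] with x hx
  exact (abs_sub _ _).trans (add_le_add (hφb x) hx)

/-- The sum of the translates of `g` over `Λ`, normalized for a central limit theorem in which the
number of summands is of order `N`. -/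
noncomputable def normalizedSum (N : ℝ) (Λ : Finset (Fin d → ℤ)) (g : ((Fin d → ℤ) → E) → ℝ)
    (x : (Fin d → ℤ) → E) : ℝ :=
  (√N)⁻¹ * ∑ y ∈ Λ, g (shift y x)

omit [MeasurableSpace E] in
theorem normalizedSum_sub (N : ℝ) (Λ : Finset (Fin d → ℤ)) (x : (Fin d → ℤ) → E) :
    normalizedSum N Λ (fun x => g x - g' x) x = normalizedSum N Λ g x - normalizedSum N Λ g' x := by
  simp only [normalizedSum, Finset.sum_sub_distrib, mul_sub]

namespace IsStationaryMartingaleDifference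

theorem memLp_normalizedSum (hg : IsStationaryMartingaleDifference P₀ g) (N : ℝ)
    (Λ : Finset (Fin d → ℤ)) : MemLp (normalizedSum N Λ g) 2 (iidLaw _ P₀) :=
  (memLp_finsetSum Λ fun y _ => hg.memLp_shift y).const_mul _

theorem integral_normalizedSum_mul (hg : IsStationaryMartingaleDifference P₀ g)
    (hg' : IsStationaryMartingaleDifference P₀ g') {N : ℝ} (hN : 0 ≤ N)
    (Λ Λ' : Finset (Fin d → ℤ)) :
    ∫ x, normalizedSum N Λ g x * normalizedSum N Λ' g' x ∂iidLaw _ P₀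
      = (Λ ∩ Λ').card / N * ∫ x, g x * g' x ∂iidLaw _ P₀ := by
  have hshift (y) : ∫ x, g (shift y x) * g' (shift y x) ∂iidLaw _ P₀
      = ∫ x, g x * g' x ∂iidLaw _ P₀ :=
    integral_comp_measurePreserving (measurePreserving_shift y)
      (f := fun x => g x * g' x) (hg.memLp.1.mul hg'.memLp.1)
  simp_rw [normalizedSum, mul_mul_mul_comm]
  rw [integral_const_mul, (isMartingaleDifference_shift fun _ => hg).integral_sum_mul_sum
    (isMartingaleDifference_shift fun _ => hg') hg.memLp_shift hg'.memLp_shift,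
    Finset.sum_congr rfl fun y _ => hshift y, Finset.sum_const, nsmul_eq_mul, ← mul_inv,
    Real.mul_self_sqrt hN]
  ring

theorem integral_sq_normalizedSum_sub (hg : IsStationaryMartingaleDifference P₀ g)
    (hg' : IsStationaryMartingaleDifference P₀ g') {N : ℝ} (hN : 0 ≤ N) (Λ : Finset (Fin d → ℤ)) :
    ∫ x, (normalizedSum N Λ g x - normalizedSum N Λ g' x) ^ 2 ∂iidLaw _ P₀
      = Λ.card / N * ∫ x, (g x - g' x) ^ 2 ∂iidLaw _ P₀ := by
  simp_rw [← normalizedSum_sub, sq]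
  rw [(hg.sub hg').integral_normalizedSum_mul (hg.sub hg') hN, Finset.inter_self]

end IsStationaryMartingaleDifference

end StationaryMartingaleDifference

section SiteTerm

variable {ι κ : Type*} [DecidableEq ι] [Fintype κ] (Λ : κ → Finset ι) (b : κ → ℝ) (f : κ → ι → ℝ)

/-- The contribution of the site `y` to the linear combination `∑ i, b i * ∑ y ∈ Λ i, f i y`. -/
def siteTerm (y : ι) : ℝ :=
  ∑ i, (if y ∈ Λ i then b i else 0) * f i y

theorem sum_ite_mem_mul {s t : Finset ι} (hst : s ⊆ t) (c : ℝ) (h : ι → ℝ) :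
    ∑ y ∈ t, (if y ∈ s then c else 0) * h y = c * ∑ y ∈ s, h y := by
  simp_rw [ite_mul, zero_mul]
  rw [← Finset.sum_filter, Finset.filter_mem_eq_inter, Finset.inter_eq_right.2 hst, Finset.mul_sum]

theorem sum_siteTerm :
    ∑ y ∈ Finset.univ.biUnion Λ, siteTerm Λ b f y = ∑ i, b i * ∑ y ∈ Λ i, f i y := by
  simp only [siteTerm]
  rw [Finset.sum_comm]
  exact Finset.sum_congr rfl fun i hi => sum_ite_mem_mul (Finset.subset_biUnion_of_mem Λ hi) _ _

theorem sum_siteTerm_sq :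
    ∑ y ∈ Finset.univ.biUnion Λ, siteTerm Λ b f y ^ 2
      = ∑ i, ∑ j, b i * b j * ∑ y ∈ Λ i ∩ Λ j, f i y * f j y := by
  have hsq (y) : siteTerm Λ b f y ^ 2
      = ∑ i, ∑ j, (if y ∈ Λ i ∩ Λ j then b i * b j else 0) * (f i y * f j y) := by
    rw [siteTerm, sq, Finset.sum_mul_sum]
    refine Finset.sum_congr rfl fun i _ => Finset.sum_congr rfl fun j _ => ?_
    by_cases hi : y ∈ Λ i <;> by_cases hj : y ∈ Λ j <;> simp [hi, hj, mul_mul_mul_comm]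
  simp_rw [hsq]
  rw [Finset.sum_comm]
  refine Finset.sum_congr rfl fun i hi => ?_
  rw [Finset.sum_comm]
  exact Finset.sum_congr rfl fun j _ => sum_ite_mem_mul
    (Finset.inter_subset_left.trans (Finset.subset_biUnion_of_mem Λ hi)) _ _

variable {Λ b f}

theorem abs_siteTerm_le {y : ι} {K : ℝ} (hf : ∀ i, |f i y| ≤ K) :
    |siteTerm Λ b f y| ≤ (∑ i, |b i|) * K := by
  rw [Finset.sum_mul]
  refine (Finset.abs_sum_le_sum_abs _ _).trans (Finset.sum_le_sum fun i _ => ?_)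
  rw [abs_mul]
  exact mul_le_mul (by split_ifs <;> simp) (hf i) (abs_nonneg _) (abs_nonneg _)

variable {κ' Ω : Type*} [LinearOrder κ'] {mΩ : MeasurableSpace Ω} {μ : Measure Ω} {r : ι → κ'}
  {F : ι → MeasurableSpace Ω} {w : κ → ι → Ω → ℝ}

omit mΩ in
theorem siteTerm_eq_sum_smul (w : κ → ι → Ω → ℝ) (y : ι) :
    (fun x => siteTerm Λ b (fun i y => w i y x) y)
      = ∑ i, (if y ∈ Λ i then b i else 0) • w i y := by
  ext x
  simp only [siteTerm, Finset.sum_apply, Pi.smul_apply, smul_eq_mul]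

theorem isMartingaleDifference_siteTerm [Nonempty κ]
    (hw : ∀ i, IsMartingaleDifference μ r F (w i)) (hint : ∀ i y, Integrable (w i y) μ) :
    IsMartingaleDifference μ r F fun y x => siteTerm Λ b (fun i y => w i y x) y where
  injective := (hw (Classical.arbitrary κ)).injective
  le := (hw (Classical.arbitrary κ)).le
  aestronglyMeasurable y := by
    rw [siteTerm_eq_sum_smul]
    exact Finset.sum_induction _ (AEStronglyMeasurable · μ) (fun _ _ => .add)
      aestronglyMeasurable_const fun i _ => ((hw i).aestronglyMeasurable y).const_smul _
  adapted y y' h := by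
    rw [siteTerm_eq_sum_smul]
    exact Finset.sum_induction _ (AEStronglyMeasurable[F y'] · μ) (fun _ _ => .add)
      aestronglyMeasurable_const fun i _ => ((hw i).adapted y y' h).const_smul _
  condExp_eq_zero y := by
    have hsum := condExp_finsetSum (s := Finset.univ)
      (f := fun i => (if y ∈ Λ i then b i else 0) • w i y) (fun i _ => (hint i y).smul _) (F y)
    have hterm (i) : μ[(if y ∈ Λ i then b i else 0) • w i y | F y] =ᵐ[μ] 0 := by
      filter_upwards [condExp_smul (μ := μ) (if y ∈ Λ i then b i else 0) (w i y) (F y),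
        (hw i).condExp_eq_zero y] with x h1 h2
      rw [h1, Pi.smul_apply, h2, Pi.zero_apply, smul_zero]
    rw [siteTerm_eq_sum_smul]
    filter_upwards [hsum, ae_all_iff.2 hterm] with x h1 h2
    rw [h1, Finset.sum_apply]
    exact Finset.sum_eq_zero fun i _ => h2 i

end SiteTerm

section LinearCombinations

variable {κ Ω : Type*} [Fintype κ] {mΩ : MeasurableSpace Ω} {μ : Measure Ω}

theorem tendsto_integral_abs_sum_mul_sub {Z : κ → ℕ → Ω → ℝ} {c b : κ → ℝ}
    (hZ : ∀ i, Tendsto (fun n => ∫ x, |Z i n x - c i| ∂μ) atTop (𝓝 0))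
    (hint : ∀ i n, Integrable (fun x => Z i n x - c i) μ) :
    Tendsto (fun n => ∫ x, |∑ i, b i * Z i n x - ∑ i, b i * c i| ∂μ) atTop (𝓝 0) := by
  have hint' (i n) : Integrable (fun x => |b i| * |Z i n x - c i|) μ := (hint i n).abs.const_mul _
  have hlim : Tendsto (fun n => ∑ i, |b i| * ∫ x, |Z i n x - c i| ∂μ) atTop
      (𝓝 (∑ i, |b i| * 0)) := tendsto_finsetSum _ fun i _ => (hZ i).const_mul _
  simp only [mul_zero, Finset.sum_const_zero] at hlim
  refine squeeze_zero (fun n => integral_nonneg fun x => abs_nonneg _) (fun n => ?_) hlim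
  simp_rw [← integral_const_mul]
  rw [← integral_finsetSum _ fun i _ => hint' i n]
  refine integral_mono_of_nonneg (Eventually.of_forall fun x => abs_nonneg _)
    (integrable_finsetSum _ fun i _ => hint' i n) (Eventually.of_forall fun x => ?_)
  simp only [← Finset.sum_sub_distrib, ← mul_sub]
  exact (Finset.abs_sum_le_sum_abs _ _).trans_eq (Finset.sum_congr rfl fun i _ => abs_mul _ _)

variable [IsProbabilityMeasure μ]

theorem norm_integral_exp_sub_le {U V : Ω → ℝ} (hU : Integrable U μ) (hV : Integrable V μ) :
    ‖∫ x, Complex.exp (U x * Complex.I) ∂μ - ∫ x, Complex.exp (V x * Complex.I) ∂μ‖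
      ≤ ∫ x, |U x - V x| ∂μ := by
  rw [← integral_sub (integrable_exp_mul_I hU.1) (integrable_exp_mul_I hV.1)]
  refine norm_integral_le_of_norm_le (hU.sub hV).abs (Eventually.of_forall fun x => ?_)
  have hfactor : Complex.exp (U x * Complex.I) - Complex.exp (V x * Complex.I)
      = Complex.exp (V x * Complex.I) * (Complex.exp (Complex.I * ((U x - V x : ℝ) : ℂ)) - 1) := by
    rw [mul_sub, ← Complex.exp_add, mul_one]
    congr 2
    push_cast
    ring
  rw [hfactor, norm_mul, Complex.norm_exp_ofReal_mul_I, one_mul]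
  exact Real.norm_exp_I_mul_ofReal_sub_one_le

theorem norm_integral_exp_sum_mul_sub_le (a : κ → ℝ) {U V : κ → Ω → ℝ}
    (hU : ∀ i, MemLp (U i) 2 μ) (hV : ∀ i, MemLp (V i) 2 μ) :
    ‖∫ x, Complex.exp ((∑ i, a i * U i x : ℝ) * Complex.I) ∂μ
        - ∫ x, Complex.exp ((∑ i, a i * V i x : ℝ) * Complex.I) ∂μ‖
      ≤ ∑ i, |a i| * √(∫ x, (U i x - V i x) ^ 2 ∂μ) := by
  have hsum {W : κ → Ω → ℝ} (hW : ∀ i, MemLp (W i) 2 μ) :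
      Integrable (fun x => ∑ i, a i * W i x) μ :=
    integrable_finsetSum _ fun i _ => ((hW i).integrable one_le_two).const_mul _
  have hdiff (i) : MemLp (fun x => U i x - V i x) 2 μ := (hU i).sub (hV i)
  have hint (i) : Integrable (fun x => |a i| * |U i x - V i x|) μ :=
    ((hdiff i).integrable one_le_two).abs.const_mul _
  calc _ ≤ ∫ x, |∑ i, a i * U i x - ∑ i, a i * V i x| ∂μ :=
        norm_integral_exp_sub_le (hsum hU) (hsum hV)
    _ ≤ ∫ x, ∑ i, |a i| * |U i x - V i x| ∂μ := by
        refine integral_mono_of_nonneg (Eventually.of_forall fun x => abs_nonneg _)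
          (integrable_finsetSum _ fun i _ => hint i) (Eventually.of_forall fun x => ?_)
        simp only [← Finset.sum_sub_distrib, ← mul_sub]
        exact (Finset.abs_sum_le_sum_abs _ _).trans_eq
          (Finset.sum_congr rfl fun i _ => abs_mul _ _)
    _ = ∑ i, |a i| * ∫ x, |U i x - V i x| ∂μ := by
        rw [integral_finsetSum _ fun i _ => hint i]
        simp_rw [integral_const_mul]
    _ ≤ _ := Finset.sum_le_sum fun i _ =>
        mul_le_mul_of_nonneg_left (integral_abs_le_sqrt (hdiff i)) (abs_nonneg _)

theorem tendsto_of_forall_tendsto_of_eventually_dist_le {X : Type*} [PseudoMetricSpace X]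
    {u : ℕ → X} {U : ℕ → ℕ → X} {L : ℕ → X} {l : X} {e : ℕ → ℝ}
    (hU : ∀ m, Tendsto (U m) atTop (𝓝 (L m))) (hL : Tendsto L atTop (𝓝 l))
    (he : Tendsto e atTop (𝓝 0)) (hdist : ∀ m, ∀ᶠ n in atTop, dist (u n) (U m n) ≤ e m) :
    Tendsto u atTop (𝓝 l) := by
  refine Metric.tendsto_nhds.2 fun ε hε => ?_
  have hε3 : 0 < ε / 3 := by positivity
  obtain ⟨m, hLm, hem⟩ :=
    ((Metric.tendsto_nhds.1 hL _ hε3).and (he.eventually (gt_mem_nhds hε3))).exists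
  filter_upwards [hdist m, Metric.tendsto_nhds.1 (hU m) _ hε3] with n hn hUn
  linarith [dist_triangle4 (u n) (U m n) (L m) l]

end LinearCombinations

section CentralLimit

variable {d : ℕ} {E κ : Type*} [MeasurableSpace E] {P₀ : Measure E} [IsProbabilityMeasure P₀]
  [Fintype κ] {g : κ → ((Fin d → ℤ) → E) → ℝ} {Λ : κ → ℕ → Finset (Fin d → ℤ)} {N : ℕ → ℝ}
  {V : κ → κ → ℝ}

/-- The limiting variance of `∑ i, a i * normalizedSum (N n) (Λ i n) (g i)` for stationary
martingale differences `g i`, when `V i j` is the limit of `|Λ i n ∩ Λ j n| / N n`. -/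
noncomputable def limitVariance (P₀ : Measure E) [IsProbabilityMeasure P₀]
    (g : κ → ((Fin d → ℤ) → E) → ℝ) (V : κ → κ → ℝ) (a : κ → ℝ) : ℝ :=
  ∑ i, ∑ j, a i * a j * (V i j * ∫ x, g i x * g j x ∂iidLaw _ P₀)

theorem limitVariance_nonneg (hg : ∀ i, IsStationaryMartingaleDifference P₀ (g i))
    (hN0 : ∀ n, 0 < N n)
    (hV : ∀ i j, Tendsto (fun n => (Λ i n ∩ Λ j n).card / N n) atTop (𝓝 (V i j))) (a : κ → ℝ) :
    0 ≤ limitVariance P₀ g V a := by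
  have hsq (n) : ∫ x, (∑ i, a i * normalizedSum (N n) (Λ i n) (g i) x) ^ 2 ∂iidLaw _ P₀
      = ∑ i, ∑ j, a i * a j * ((Λ i n ∩ Λ j n).card / N n * ∫ x, g i x * g j x ∂iidLaw _ P₀) := by
    have hint (i j) : Integrable (fun x => a i * a j * (normalizedSum (N n) (Λ i n) (g i) x
        * normalizedSum (N n) (Λ j n) (g j) x)) (iidLaw _ P₀) :=
      (((hg i).memLp_normalizedSum _ _).integrable_mul ((hg j).memLp_normalizedSum _ _)).const_mul _
    simp_rw [sq, Finset.sum_mul_sum, mul_mul_mul_comm (a _)]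
    rw [integral_finsetSum _ fun i _ => integrable_finsetSum _ fun j _ => hint i j]
    refine Finset.sum_congr rfl fun i _ => ?_
    rw [integral_finsetSum _ fun j _ => hint i j]
    refine Finset.sum_congr rfl fun j _ => ?_
    rw [integral_const_mul, (hg i).integral_normalizedSum_mul (hg j) (hN0 n).le]
  refine ge_of_tendsto' (f := fun n => ∑ i, ∑ j, a i * a j * ((Λ i n ∩ Λ j n).card / N n
    * ∫ x, g i x * g j x ∂iidLaw _ P₀)) (tendsto_finsetSum _ fun i _ => tendsto_finsetSum _
      fun j _ => ((hV i j).mul_const _).const_mul _) fun n => ?_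
  rw [← hsq]
  exact integral_nonneg fun _ => sq_nonneg _

omit [MeasurableSpace E] in
theorem sum_siteTerm_shift (N : ℝ) (Λ : κ → Finset (Fin d → ℤ)) (a : κ → ℝ)
    (x : (Fin d → ℤ) → E) :
    ∑ y ∈ Finset.univ.biUnion Λ, siteTerm Λ (fun i => (√N)⁻¹ * a i) (fun i y => g i (shift y x)) y
      = ∑ i, a i * normalizedSum N (Λ i) (g i) x := by
  rw [sum_siteTerm]
  exact Finset.sum_congr rfl fun i _ => by rw [normalizedSum]; ring

omit [MeasurableSpace E] in
theorem sum_siteTerm_shift_sq {N : ℝ} (hN : 0 ≤ N) (Λ : κ → Finset (Fin d → ℤ)) (a : κ → ℝ)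
    (x : (Fin d → ℤ) → E) :
    ∑ y ∈ Finset.univ.biUnion Λ,
        siteTerm Λ (fun i => (√N)⁻¹ * a i) (fun i y => g i (shift y x)) y ^ 2
      = ∑ p : κ × κ, a p.1 * a p.2
        * (N⁻¹ * ∑ y ∈ Λ p.1 ∩ Λ p.2, g p.1 (shift y x) * g p.2 (shift y x)) := by
  rw [sum_siteTerm_sq, Fintype.sum_prod_type]
  refine Finset.sum_congr rfl fun i _ => Finset.sum_congr rfl fun j _ => ?_
  rw [mul_mul_mul_comm, ← mul_inv, Real.mul_self_sqrt hN]
  ring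

theorem tendsto_integral_abs_sum_siteTerm_sq_sub
    (hg : ∀ i, IsStationaryMartingaleDifference P₀ (g i)) {K : ℝ}
    (hb : ∀ i, ∀ᵐ x ∂iidLaw _ P₀, |g i x| ≤ K) (hN0 : ∀ n, 0 < N n) (hN : Tendsto N atTop atTop)
    (hV : ∀ i j, Tendsto (fun n => (Λ i n ∩ Λ j n).card / N n) atTop (𝓝 (V i j))) (a : κ → ℝ) :
    Tendsto (fun n => ∫ x, |∑ y ∈ Finset.univ.biUnion fun i => Λ i n,
        siteTerm (fun i => Λ i n) (fun i => (√(N n))⁻¹ * a i) (fun i y => g i (shift y x)) y ^ 2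
        - limitVariance P₀ g V a| ∂iidLaw _ P₀) atTop (𝓝 0) := by
  have hgm (i) : StronglyMeasurable (g i) := (hg i).stronglyMeasurable.mono cylinderEvents_le_pi
  have hprod (i j) : MemLp (fun x => g i x * g j x) 2 (iidLaw _ P₀) := by
    refine .of_bound ((hgm i).mul (hgm j)).aestronglyMeasurable (K * K) ?_
    filter_upwards [hb i, hb j] with x hi hj
    rw [norm_mul]
    exact mul_le_mul hi hj (norm_nonneg _) ((abs_nonneg _).trans hi)
  let Z (p : κ × κ) (n : ℕ) (x : (Fin d → ℤ) → E) : ℝ :=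
    (N n)⁻¹ * ∑ y ∈ Λ p.1 n ∩ Λ p.2 n, g p.1 (shift y x) * g p.2 (shift y x)
  let c (p : κ × κ) : ℝ := V p.1 p.2 * ∫ x, g p.1 x * g p.2 x ∂iidLaw _ P₀
  have hZ (p) : Tendsto (fun n => ∫ x, |Z p n x - c p| ∂iidLaw _ P₀) atTop (𝓝 0) :=
    tendsto_integral_abs_sum_shift_sub (g := fun x => g p.1 x * g p.2 x)
      ((hgm p.1).mul (hgm p.2)) (hprod p.1 p.2) hN0 hN (hV p.1 p.2)
  have hprod_shift (p : κ × κ) (y) :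
      Integrable (fun x => g p.1 (shift y x) * g p.2 (shift y x)) (iidLaw _ P₀) :=
    ((hg p.1).memLp_shift y).integrable_mul ((hg p.2).memLp_shift y)
  have hint (p n) : Integrable (fun x => Z p n x - c p) (iidLaw _ P₀) :=
    ((integrable_finsetSum _ fun y _ => hprod_shift p y).const_mul _).sub (integrable_const _)
  have hlim := tendsto_integral_abs_sum_mul_sub (b := fun p => a p.1 * a p.2) hZ hint
  have hσ : limitVariance P₀ g V a = ∑ p : κ × κ, a p.1 * a p.2
      * (V p.1 p.2 * ∫ x, g p.1 x * g p.2 x ∂iidLaw _ P₀) := by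
    rw [limitVariance, Fintype.sum_prod_type]
  simpa only [sum_siteTerm_shift_sq (hN0 _).le, hσ] using hlim

theorem eventually_card_biUnion_div_le {ι : Type*} [DecidableEq ι] {Λ : κ → ℕ → Finset ι}
    {v : κ → ℝ} (hN0 : ∀ n, 0 < N n)
    (hv : ∀ i, Tendsto (fun n => (Λ i n).card / N n) atTop (𝓝 (v i))) :
    ∀ᶠ n in atTop, (Finset.univ.biUnion fun i => Λ i n).card / N n ≤ ∑ i, v i + 1 := by
  have hsum : Tendsto (fun n => ∑ i, ((Λ i n).card / N n : ℝ)) atTop (𝓝 (∑ i, v i)) :=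
    tendsto_finsetSum _ fun i _ => hv i
  filter_upwards [hsum.eventually (ge_mem_nhds (lt_add_one _))] with n hn
  refine le_trans ?_ hn
  rw [← Finset.sum_div]
  exact div_le_div_of_nonneg_right (mod_cast Finset.card_biUnion_le) (hN0 n).le

theorem ae_abs_siteTerm_shift_le {K : ℝ} (hb : ∀ i, ∀ᵐ x ∂iidLaw _ P₀, |g i x| ≤ K)
    (Λ : κ → Finset (Fin d → ℤ)) (b : κ → ℝ) (y : Fin d → ℤ) :
    ∀ᵐ x ∂iidLaw _ P₀, |siteTerm Λ b (fun i y => g i (shift y x)) y| ≤ (∑ i, |b i|) * K := by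
  filter_upwards [ae_all_iff.2 fun i =>
    (measurePreserving_shift y).quasiMeasurePreserving.ae (hb i)] with x hx
  exact abs_siteTerm_le hx

theorem tendsto_integral_exp_normalizedSum_of_bounded
    (hg : ∀ i, IsStationaryMartingaleDifference P₀ (g i)) {K : ℝ}
    (hb : ∀ i, ∀ᵐ x ∂iidLaw _ P₀, |g i x| ≤ K) (hN0 : ∀ n, 0 < N n) (hN : Tendsto N atTop atTop)
    (hV : ∀ i j, Tendsto (fun n => (Λ i n ∩ Λ j n).card / N n) atTop (𝓝 (V i j))) (a : κ → ℝ) :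
    Tendsto (fun n => ∫ x, Complex.exp
        ((∑ i, a i * normalizedSum (N n) (Λ i n) (g i) x : ℝ) * Complex.I) ∂iidLaw _ P₀) atTop
      (𝓝 (Real.exp (-limitVariance P₀ g V a / 2) : ℂ)) := by
  rcases isEmpty_or_nonempty κ with hκ | hκ
  · simp [limitVariance]
  let s n := Finset.univ.biUnion fun i => Λ i n
  let c n := (∑ i, |(√(N n))⁻¹ * a i|) * K
  let w n y x := siteTerm (fun i => Λ i n) (fun i => (√(N n))⁻¹ * a i)
    (fun i y => g i (shift y x)) y
  let M := (∑ i, V i i + 1) * ((∑ i, |a i|) * K) ^ 2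
  have hK : 0 ≤ K := by
    obtain ⟨x, hx⟩ := (hb (Classical.arbitrary κ)).exists
    exact (abs_nonneg _).trans hx
  have hw (n) : IsMartingaleDifference (iidLaw _ P₀) toLex (strictPast d E) (w n) :=
    isMartingaleDifference_siteTerm
      (fun i => IsStationaryMartingaleDifference.isMartingaleDifference_shift fun _ => hg i)
      fun i y => ((hg i).memLp_shift y).integrable one_le_two
  have hc_eq (n) : c n = (√(N n))⁻¹ * ((∑ i, |a i|) * K) := by
    simp_rw [c, abs_mul, ← Finset.mul_sum, abs_of_nonneg (inv_nonneg.2 (Real.sqrt_nonneg (N n)))]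
    ring
  have hc0 (n) : 0 ≤ c n := by positivity
  have hc : Tendsto c atTop (𝓝 0) := by
    simpa [funext hc_eq] using (Real.tendsto_sqrt_atTop.comp hN).inv_tendsto_atTop.mul_const _
  have hM : ∀ᶠ n in atTop, (s n).card * c n ^ 2 ≤ M := by
    have hcard := eventually_card_biUnion_div_le hN0 fun i => by
      simpa only [Finset.inter_self] using hV i i
    filter_upwards [hcard] with n hn
    rw [hc_eq, mul_pow, inv_pow, Real.sq_sqrt (hN0 n).le, ← mul_assoc, ← div_eq_mul_inv]
    exact mul_le_mul_of_nonneg_right hn (sq_nonneg _)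
  have hlim : Tendsto (fun n => 2 * c n * M + Real.exp (M / 2) * ∫ x, |∑ y ∈ s n, w n y x ^ 2
      - limitVariance P₀ g V a| ∂iidLaw _ P₀) atTop (𝓝 0) := by
    simpa using ((hc.const_mul 2).mul_const M).add
      ((tendsto_integral_abs_sum_siteTerm_sq_sub hg hb hN0 hN hV a).const_mul (Real.exp (M / 2)))
  refine tendsto_iff_norm_sub_tendsto_zero.2
    (squeeze_zero' (Eventually.of_forall fun n => norm_nonneg _) ?_ hlim)
  filter_upwards [hM, hc.eventually (ge_mem_nhds zero_lt_one)] with n hMn hcn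
  have hle := (hw n).norm_integral_exp_sum_sub_le (hc0 n) hcn (limitVariance_nonneg hg hN0 hV a)
    (ae_abs_siteTerm_shift_le hb _ _) hMn
  simpa only [w, s, sum_siteTerm_shift] using hle

theorem tendsto_limitVariance {g' : ℕ → κ → ((Fin d → ℤ) → E) → ℝ}
    (hg : ∀ i, MemLp (g i) 2 (iidLaw _ P₀)) (hg' : ∀ m i, MemLp (g' m i) 2 (iidLaw _ P₀))
    (happ : ∀ i, Tendsto (fun m => ∫ x, (g i x - g' m i x) ^ 2 ∂iidLaw _ P₀) atTop (𝓝 0))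
    (a : κ → ℝ) :
    Tendsto (fun m => limitVariance P₀ (g' m) V a) atTop (𝓝 (limitVariance P₀ g V a)) :=
  tendsto_finsetSum _ fun i _ => tendsto_finsetSum _ fun j _ => ((tendsto_integral_mul_of_approx
    (fun _ => hg i) (fun _ => hg j) (hg' · i) (hg' · j) (happ i) (happ j) tendsto_const_nhds
    tendsto_const_nhds tendsto_const_nhds).const_mul (V i j)).const_mul (a i * a j)

theorem tendsto_integral_exp_normalizedSum
    (hg : ∀ i, IsStationaryMartingaleDifference P₀ (g i)) (hN0 : ∀ n, 0 < N n)
    (hN : Tendsto N atTop atTop)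
    (hV : ∀ i j, Tendsto (fun n => (Λ i n ∩ Λ j n).card / N n) atTop (𝓝 (V i j))) (a : κ → ℝ) :
    Tendsto (fun n => ∫ x, Complex.exp
        ((∑ i, a i * normalizedSum (N n) (Λ i n) (g i) x : ℝ) * Complex.I) ∂iidLaw _ P₀) atTop
      (𝓝 (Real.exp (-limitVariance P₀ g V a / 2) : ℂ)) := by
  choose g' hg' hbdd happ using fun (m : ℕ) i =>
    (hg i).exists_bounded_approx (ε := 1 / ((m : ℝ) + 1)) Nat.one_div_pos_of_nat
  choose K hK using hbdd
  have hK' (m i) : ∀ᵐ x ∂iidLaw _ P₀, |g' m i x| ≤ ∑ j, |K m j| :=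
    (hK m i).mono fun x hx => hx.trans ((le_abs_self _).trans
      (Finset.single_le_sum (f := fun j => |K m j|) (fun j _ => abs_nonneg _) (Finset.mem_univ i)))
  have happ0 (i) : Tendsto (fun m => ∫ x, (g i x - g' m i x) ^ 2 ∂iidLaw _ P₀) atTop (𝓝 0) :=
    squeeze_zero (fun m => integral_nonneg fun x => sq_nonneg _) (happ · i)
      tendsto_one_div_add_atTop_nhds_zero_nat
  have hσ : Tendsto (fun m => (Real.exp (-limitVariance P₀ (g' m) V a / 2) : ℂ)) atTop
      (𝓝 (Real.exp (-limitVariance P₀ g V a / 2) : ℂ)) :=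
    (Complex.continuous_ofReal.tendsto _).comp ((Real.continuous_exp.tendsto _).comp
      ((tendsto_limitVariance (fun i => (hg i).memLp) (fun m i => (hg' m i).memLp) happ0
        a).neg.div_const 2))
  have herr : Tendsto (fun m => ∑ i, |a i| *
      √((V i i + 1) * ∫ x, (g i x - g' m i x) ^ 2 ∂iidLaw _ P₀)) atTop (𝓝 0) := by
    simpa using tendsto_finsetSum Finset.univ fun i _ =>
      ((happ0 i).const_mul (V i i + 1)).sqrt.const_mul |a i|
  refine tendsto_of_forall_tendsto_of_eventually_dist_le
    (fun m => tendsto_integral_exp_normalizedSum_of_bounded (hg' m) (hK' m) hN0 hN hV a) hσ herr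
    fun m => ?_
  have hcard : ∀ᶠ n in atTop, ∀ i, (Λ i n).card / N n ≤ V i i + 1 := eventually_all.2 fun i => by
    simpa only [Finset.inter_self] using (hV i i).eventually (ge_mem_nhds (lt_add_one _))
  filter_upwards [hcard] with n hn
  rw [dist_eq_norm]
  refine (norm_integral_exp_sum_mul_sub_le a (fun i => (hg i).memLp_normalizedSum _ _)
    fun i => (hg' m i).memLp_normalizedSum _ _).trans (Finset.sum_le_sum fun i _ => ?_)
  rw [(hg i).integral_sq_normalizedSum_sub (hg' m i) (hN0 n).le]
  gcongr
  exact hn i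

variable {U : κ → ℕ → ((Fin d → ℤ) → E) → ℝ}

theorem tendsto_integral_exp_of_approx (hg : ∀ i, IsStationaryMartingaleDifference P₀ (g i))
    (hN0 : ∀ n, 0 < N n) (hN : Tendsto N atTop atTop)
    (hV : ∀ i j, Tendsto (fun n => (Λ i n ∩ Λ j n).card / N n) atTop (𝓝 (V i j)))
    (hU : ∀ i n, MemLp (U i n) 2 (iidLaw _ P₀))
    (happ : ∀ i, Tendsto (fun n => ∫ x, (normalizedSum (N n) (Λ i n) (g i) x - U i n x) ^ 2
      ∂iidLaw _ P₀) atTop (𝓝 0)) (a : κ → ℝ) :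
    Tendsto (fun n => ∫ x, Complex.exp ((∑ i, a i * U i n x : ℝ) * Complex.I) ∂iidLaw _ P₀) atTop
      (𝓝 (Real.exp (-limitVariance P₀ g V a / 2) : ℂ)) := by
  have herr : Tendsto (fun n => ∑ i, |a i| * √(∫ x, (normalizedSum (N n) (Λ i n) (g i) x
      - U i n x) ^ 2 ∂iidLaw _ P₀)) atTop (𝓝 0) := by
    simpa using tendsto_finsetSum Finset.univ fun i _ => (happ i).sqrt.const_mul |a i|
  refine tendsto_of_tendsto_of_dist (tendsto_integral_exp_normalizedSum hg hN0 hN hV a)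
    (squeeze_zero (fun n => dist_nonneg) (fun n => ?_) herr)
  rw [dist_eq_norm]
  exact norm_integral_exp_sum_mul_sub_le a (fun i => (hg i).memLp_normalizedSum _ _)
    fun i => hU i n

omit [Fintype κ] in
theorem tendsto_integral_mul_of_approx_normalizedSum
    (hg : ∀ i, IsStationaryMartingaleDifference P₀ (g i)) (hN0 : ∀ n, 0 < N n)
    (hV : ∀ i j, Tendsto (fun n => (Λ i n ∩ Λ j n).card / N n) atTop (𝓝 (V i j)))
    (hU : ∀ i n, MemLp (U i n) 2 (iidLaw _ P₀))
    (happ : ∀ i, Tendsto (fun n => ∫ x, (normalizedSum (N n) (Λ i n) (g i) x - U i n x) ^ 2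
      ∂iidLaw _ P₀) atTop (𝓝 0)) (i j : κ) :
    Tendsto (fun n => ∫ x, U i n x * U j n x ∂iidLaw _ P₀) atTop
      (𝓝 (V i j * ∫ x, g i x * g j x ∂iidLaw _ P₀)) := by
  have hlim (i j) : Tendsto (fun n => ∫ x, normalizedSum (N n) (Λ i n) (g i) x
      * normalizedSum (N n) (Λ j n) (g j) x ∂iidLaw _ P₀) atTop
      (𝓝 (V i j * ∫ x, g i x * g j x ∂iidLaw _ P₀)) :=
    ((hV i j).mul_const _).congr fun n =>
      ((hg i).integral_normalizedSum_mul (hg j) (hN0 n).le _ _).symm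
  have hlim_sq (i) : Tendsto (fun n => ∫ x, normalizedSum (N n) (Λ i n) (g i) x ^ 2
      ∂iidLaw _ P₀) atTop (𝓝 (V i i * ∫ x, g i x * g i x ∂iidLaw _ P₀)) := by
    simpa only [sq] using hlim i i
  exact tendsto_integral_mul_of_approx (fun n => (hg i).memLp_normalizedSum _ _)
    (fun n => (hg j).memLp_normalizedSum _ _) (hU i) (hU j) (happ i) (happ j) (hlim_sq i)
    (hlim_sq j) (hlim i j)

end CentralLimit

section Lattice

variable {d : ℕ} {A : Set (EuclideanSpace ℝ (Fin d))} {x : EuclideanSpace ℝ (Fin d)} {ρ : ℝ}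

theorem IsRiemannMeasurable.inter {B : Set (EuclideanSpace ℝ (Fin d))}
    (hA : IsRiemannMeasurable A) (hB : IsRiemannMeasurable B) : IsRiemannMeasurable (A ∩ B) :=
  ⟨hA.1.subset Set.inter_subset_left, measure_mono_null (frontier_inter_subset A B)
    (measure_union_null (measure_mono_null Set.inter_subset_left hA.2)
      (measure_mono_null Set.inter_subset_right hB.2))⟩

theorem latticePoint_neg (y : Fin d → ℤ) : latticePoint (-y) = -latticePoint y := by
  ext i
  simp [latticePoint]

theorem mem_discretization_of_latticePoint_mem (hρ : 0 ≤ ρ) {y : Fin d → ℤ}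
    (hy : latticePoint y ∈ A) : y ∈ discretization ρ A :=
  ⟨latticePoint y, Metric.mem_closedBall_self hρ, hy⟩

theorem finite_discretization (hA : Bornology.IsBounded A) (ρ : ℝ) :
    (discretization ρ A).Finite := by
  obtain ⟨R, hR⟩ := hA.exists_norm_le
  refine (Set.Finite.pi' fun _ : Fin d => Set.finite_Icc (-⌈ρ + R⌉) ⌈ρ + R⌉).subset ?_
  rintro y ⟨q, hyq, hq⟩ i
  have hnorm : ‖latticePoint y‖ ≤ ρ + R :=
    calc ‖latticePoint y‖ ≤ ‖latticePoint y - q‖ + ‖q‖ := by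
          simpa using norm_add_le (latticePoint y - q) q
      _ ≤ ρ + R := add_le_add (by rwa [← dist_eq_norm, dist_comm]) (hR q hq)
  have hcoord : |(y i : ℝ)| ≤ ρ + R := (PiLp.norm_apply_le (latticePoint y) i).trans hnorm
  obtain ⟨hlower, hupper⟩ := abs_le.1 (hcoord.trans (Int.le_ceil _))
  exact ⟨mod_cast hlower, mod_cast hupper⟩

/-- The lattice point `⌊t x⌋`, the floor being taken coordinate by coordinate. Its fibres are cubes
of side `1 / t`, so that rescaled lattice sums become integrals over `ℝ^d`. -/
noncomputable def latticeFloor (t : ℝ) (x : EuclideanSpace ℝ (Fin d)) : Fin d → ℤ :=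
  fun i => ⌊t * x i⌋

theorem measurable_latticeFloor (t : ℝ) :
    Measurable (latticeFloor t : EuclideanSpace ℝ (Fin d) → Fin d → ℤ) :=
  measurable_pi_iff.2 fun i => Int.measurable_floor.comp (by fun_prop)

theorem volume_preimage_latticeFloor {t : ℝ} (ht : 0 < t) (y : Fin d → ℤ) :
    volume (latticeFloor t ⁻¹' {y} : Set (EuclideanSpace ℝ (Fin d)))
      = ENNReal.ofReal (t ^ d)⁻¹ := by
  have hcube : (latticeFloor t ⁻¹' {y} : Set (EuclideanSpace ℝ (Fin d)))
      = WithLp.ofLp ⁻¹' Set.univ.pi fun i => Set.Ico ((y i : ℝ) / t) ((y i + 1) / t) := by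
    ext x
    simp only [Set.mem_preimage, Set.mem_singleton_iff, Set.mem_pi, Set.mem_univ, forall_true_left,
      Set.mem_Ico, funext_iff, latticeFloor, Int.floor_eq_iff, div_le_iff₀ ht, lt_div_iff₀ ht,
      mul_comm t]
  have hside (i) : (y i + 1 : ℝ) / t - y i / t = t⁻¹ := by field_simp; ring
  rw [hcube, (PiLp.volume_preserving_ofLp (Fin d)).measure_preimage
    (MeasurableSet.univ_pi fun i => measurableSet_Ico).nullMeasurableSet, Real.volume_pi_Ico]
  simp [hside, ENNReal.ofReal_pow ht.le, ENNReal.ofReal_inv_of_pos, ht, ENNReal.inv_pow]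

theorem map_latticeFloor_volume {t : ℝ} (ht : 0 < t) :
    Measure.map (latticeFloor t) (volume : Measure (EuclideanSpace ℝ (Fin d)))
      = ENNReal.ofReal (t ^ d)⁻¹ • Measure.count :=
  Measure.ext_of_singleton fun y => by
    rw [Measure.map_apply (measurable_latticeFloor t) (measurableSet_singleton y),
      volume_preimage_latticeFloor ht, Measure.smul_apply, Measure.count_singleton, smul_eq_mul,
      mul_one]

theorem integral_comp_latticeFloor {t : ℝ} (ht : 0 < t) {s : Finset (Fin d → ℤ)}
    {F : (Fin d → ℤ) → ℝ} (hF : ∀ y ∉ s, F y = 0) :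
    ∫ x : EuclideanSpace ℝ (Fin d), F (latticeFloor t x) = (t ^ d)⁻¹ * ∑ y ∈ s, F y := by
  have hcount : ∫ y, F y ∂Measure.count = ∑ y ∈ s, F y := by
    rw [integral_countable (integrable_count_iff.2 (summable_of_ne_finset_zero (s := s)
      fun y hy => by rw [hF y hy, norm_zero])), tsum_eq_sum (s := s) fun y hy => by simp [hF y hy]]
    simp [Measure.real]
  rw [← integral_map (measurable_latticeFloor t).aemeasurable
    (measurable_of_countable F).aestronglyMeasurable, map_latticeFloor_volume ht,
    integral_smul_measure, hcount, ENNReal.toReal_ofReal (by positivity), smul_eq_mul]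

theorem norm_latticePoint_latticeFloor_sub_le (t : ℝ) (x : EuclideanSpace ℝ (Fin d)) :
    ‖latticePoint (latticeFloor t x) - t • x‖ ≤ √d := by
  rw [EuclideanSpace.norm_eq]
  refine Real.sqrt_le_sqrt ?_
  calc _ ≤ ∑ _i : Fin d, (1 : ℝ) := Finset.sum_le_sum fun i _ => by
        have hcoord : (latticePoint (latticeFloor t x) - t • x) i = -Int.fract (t * x i) := by
          change (⌊t * x i⌋ : ℝ) - t * x i = -(t * x i - ⌊t * x i⌋)
          ring
        rw [hcoord, norm_neg, Real.norm_of_nonneg (Int.fract_nonneg _)]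
        exact pow_le_one₀ (Int.fract_nonneg _) (Int.fract_lt_one _).le
    _ = d := by simp

theorem eventually_closedBall_subset_smul {V ι : Type*} [NormedAddCommGroup V] [NormedSpace ℝ V]
    {S : Set V} {x : V} (hx : x ∈ interior S) {l : Filter ι} {t : ι → ℝ} (ht : Tendsto t l atTop)
    (R : ℝ) : ∀ᶠ n in l, Metric.closedBall (t n • x) R ⊆ t n • S := by
  obtain ⟨r, hr, hball⟩ := Metric.isOpen_iff.1 isOpen_interior x hx
  filter_upwards [ht.eventually_gt_atTop 0, ht.eventually_gt_atTop (R / r)] with n h0 hn q hq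
  rw [Set.mem_smul_set_iff_inv_smul_mem₀ h0.ne']
  refine interior_subset (hball ?_)
  have hscale : (t n)⁻¹ • q - x = (t n)⁻¹ • (q - t n • x) := by
    rw [smul_sub, inv_smul_smul₀ h0.ne']
  rw [Metric.mem_ball, dist_eq_norm, hscale, norm_smul, norm_inv, Real.norm_of_nonneg h0.le,
    inv_mul_lt_iff₀ h0]
  exact (mem_closedBall_iff_norm.1 hq).trans_lt ((div_lt_iff₀ hr).1 hn)

variable {t : ℕ → ℝ}

theorem setLiminf_vadd_smul_eq_univ (hx : x ∈ interior A) (ht : Tendsto t atTop atTop) :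
    setLiminf (fun n => latticePoint (-latticeFloor (t n) x) +ᵥ (t n • A)) = Set.univ := by
  refine Set.eq_univ_of_forall fun p => ?_
  obtain ⟨n, hn⟩ := eventually_atTop.1 (eventually_closedBall_subset_smul hx ht (‖p‖ + √d))
  refine Set.mem_iUnion.2 ⟨n, Set.mem_iInter₂.2 fun m hm => ?_⟩
  rw [Set.mem_vadd_set_iff_neg_vadd_mem, latticePoint_neg, neg_neg, vadd_eq_add, add_comm]
  refine hn m hm (mem_closedBall_iff_norm.2 ?_)
  rw [add_sub_assoc]
  exact (norm_add_le _ _).trans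
    (add_le_add_right (norm_latticePoint_latticeFloor_sub_le _ _) _)

theorem eventually_latticePoint_mem_of_setLiminf {y : ℕ → Fin d → ℤ}
    (h : setLiminf (fun n => latticePoint (-y n) +ᵥ (t n • A)) = Set.univ) :
    ∀ᶠ n in atTop, latticePoint (y n) ∈ t n • A := by
  obtain ⟨n, hn⟩ := Set.mem_iUnion.1 (h.symm ▸ Set.mem_univ (0 : EuclideanSpace ℝ (Fin d)))
  filter_upwards [eventually_ge_atTop n] with m hm
  simpa [Set.mem_vadd_set_iff_neg_vadd_mem, latticePoint_neg] using Set.mem_iInter₂.1 hn m hm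

theorem IsRiemannMeasurable.exists_setLiminf_eq_univ
    (hA : IsRiemannMeasurable A) (hApos : 0 < volume A) :
    ∃ (t : ℕ → Set.Ici (1 : ℝ)) (y : ℕ → Fin d → ℤ),
      setLiminf (fun n => latticePoint (-y n) +ᵥ ((t n : ℝ) • A)) = Set.univ := by
  obtain ⟨x, hx⟩ : (interior A).Nonempty := by
    rw [Set.nonempty_iff_ne_empty]
    intro hempty
    rw [← measure_interior_of_null_frontier hA.2, hempty, measure_empty] at hApos
    exact hApos.false
  exact ⟨fun n => ⟨n + 1, by simp⟩, _, setLiminf_vadd_smul_eq_univ hx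
    (tendsto_atTop_add_const_right _ _ tendsto_natCast_atTop_atTop)⟩

theorem eventually_latticePoint_mem (hx : x ∈ interior A) (ht : Tendsto t atTop atTop) :
    ∀ᶠ n in atTop, latticePoint (latticeFloor (t n) x) ∈ t n • A := by
  filter_upwards [eventually_closedBall_subset_smul hx ht √d] with n hn
  exact hn (mem_closedBall_iff_norm.2 (norm_latticePoint_latticeFloor_sub_le _ _))

theorem norm_sub_smul_le_of_mem_closedBall {t : ℝ} {q : EuclideanSpace ℝ (Fin d)}
    (hq : q ∈ Metric.closedBall (latticePoint (latticeFloor t x)) ρ) : ‖q - t • x‖ ≤ ρ + √d := by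
  rw [← sub_add_sub_cancel q (latticePoint (latticeFloor t x))]
  exact (norm_add_le _ _).trans
    (add_le_add (mem_closedBall_iff_norm.1 hq) (norm_latticePoint_latticeFloor_sub_le t x))

theorem eventually_notMem_discretization (hx : x ∉ closure A) (ht : Tendsto t atTop atTop)
    (ρ : ℝ) : ∀ᶠ n in atTop, latticeFloor (t n) x ∉ discretization ρ (t n • A) := by
  have hx' : x ∈ interior Aᶜ := by rwa [interior_compl]
  filter_upwards [eventually_closedBall_subset_smul hx' ht (ρ + √d), ht.eventually_ne_atTop 0]
    with n hn h0 ⟨q, hq, hqA⟩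
  have hqA' := hn (mem_closedBall_iff_norm.2 (norm_sub_smul_le_of_mem_closedBall hq))
  rw [Set.mem_smul_set_iff_inv_smul_mem₀ h0] at hqA hqA'
  exact hqA' hqA

theorem norm_le_of_latticeFloor_mem_discretization {R t : ℝ} (hR : ∀ x ∈ A, ‖x‖ ≤ R) (ht : 1 ≤ t)
    (hx : latticeFloor t x ∈ discretization ρ (t • A)) : ‖x‖ ≤ R + (ρ + √d) := by
  obtain ⟨_, hq, a, ha, rfl⟩ := hx
  have hdist : ‖a - x‖ ≤ ρ + √d :=
    calc ‖a - x‖ ≤ t * ‖a - x‖ := le_mul_of_one_le_left (norm_nonneg _) ht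
      _ = ‖t • a - t • x‖ := by
        rw [← smul_sub, norm_smul, Real.norm_of_nonneg (zero_le_one.trans ht)]
      _ ≤ ρ + √d := norm_sub_smul_le_of_mem_closedBall hq
  calc ‖x‖ ≤ ‖a‖ + ‖a - x‖ := norm_le_insert a x
    _ ≤ R + (ρ + √d) := add_le_add (hR a ha) hdist

theorem tendsto_sum_discretization (hA : Bornology.IsBounded A) (ht : ∀ n, 1 ≤ t n)
    {Λ : ℕ → Finset (Fin d → ℤ)} (hΛ : ∀ n, ∀ y ∈ Λ n, y ∈ discretization ρ (t n • A))
    {F : ℕ → (Fin d → ℤ) → ℝ} (hF : ∀ n, ∀ y ∉ Λ n, F n y = 0) {C : ℝ}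
    (hC : ∀ n y, |F n y| ≤ C) {φ : EuclideanSpace ℝ (Fin d) → ℝ}
    (hφ : ∀ᵐ x, Tendsto (fun n => F n (latticeFloor (t n) x)) atTop (𝓝 (φ x))) :
    Tendsto (fun n => (t n ^ d)⁻¹ * ∑ y ∈ Λ n, F n y) atTop (𝓝 (∫ x, φ x)) := by
  obtain ⟨R, hR⟩ := hA.exists_norm_le
  simp_rw [← integral_comp_latticeFloor (zero_lt_one.trans_le (ht _)) (hF _)]
  refine tendsto_integral_of_dominated_convergence
    ((Metric.closedBall 0 (R + (ρ + √d))).indicator fun _ => C) (fun n =>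
      ((measurable_of_countable (F n)).comp (measurable_latticeFloor (t n))).aestronglyMeasurable)
    ((integrable_indicator_iff Metric.isClosed_closedBall.measurableSet).2
      (integrableOn_const measure_closedBall_lt_top.ne))
    (fun n => Eventually.of_forall fun x => ?_) hφ
  by_cases hx : latticeFloor (t n) x ∈ Λ n
  · rw [Set.indicator_of_mem (by
      simpa using norm_le_of_latticeFloor_mem_discretization hR (ht n) (hΛ n _ hx))]
    exact hC n _
  · rw [hF n _ hx, norm_zero]
    exact Set.indicator_nonneg (fun _ _ => (abs_nonneg _).trans (hC n 0)) _

theorem tendsto_card_div_pow (hA : IsRiemannMeasurable A) (ht1 : ∀ n, 1 ≤ t n)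
    (ht : Tendsto t atTop atTop) {Λ : ℕ → Finset (Fin d → ℤ)}
    (hΛ : ∀ n y, y ∈ Λ n ↔ latticePoint y ∈ t n • A) :
    Tendsto (fun n => (Λ n).card / t n ^ d) atTop (𝓝 (volume.real A)) := by
  have hΛA (n y) (hy : y ∈ Λ n) : y ∈ discretization 0 (t n • A) :=
    mem_discretization_of_latticePoint_mem le_rfl ((hΛ n y).1 hy)
  have hfloor : ∀ᵐ x, Tendsto (fun n => if latticeFloor (t n) x ∈ Λ n then (1 : ℝ) else 0) atTop
      (𝓝 ((interior A).indicator (fun _ => 1) x)) := by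
    filter_upwards [measure_eq_zero_iff_ae_notMem.1 hA.2] with x hx
    refine tendsto_const_nhds.congr' ?_
    by_cases hxi : x ∈ interior A
    · filter_upwards [eventually_latticePoint_mem hxi ht] with n hn
      rw [Set.indicator_of_mem hxi, if_pos ((hΛ n _).2 hn)]
    · filter_upwards [eventually_notMem_discretization (fun hc => hx ⟨hc, hxi⟩) ht 0] with n hn
      rw [Set.indicator_of_notMem hxi, if_neg fun h => hn (hΛA n _ h)]
  have hlim := tendsto_sum_discretization hA.1 ht1 hΛA (F := fun n y => if y ∈ Λ n then 1 else 0)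
    (C := 1) (fun n y hy => if_neg hy) (fun n y => by split_ifs <;> simp) hfloor
  rw [integral_indicator isOpen_interior.measurableSet, setIntegral_const, smul_eq_mul, mul_one,
    measureReal_congr (interior_ae_eq_of_null_frontier hA.2)] at hlim
  refine hlim.congr fun n => ?_
  rw [Finset.sum_ite_mem, Finset.inter_self]
  simp [div_eq_inv_mul]

end Lattice

section UniformIntegrability

variable {Ω β ι : Type*} {mΩ : MeasurableSpace Ω} {P : Measure Ω}

theorem unifIntegrable_of_eLpNorm_le [NormedAddCommGroup β] {f : ι → Ω → β} {p q : ℝ≥0∞}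
    (hp : p ≠ 0) (hpq : p < q) (hf : ∀ n, AEStronglyMeasurable (f n) P) {K : ℝ≥0}
    (hK : ∀ n, eLpNorm (f n) q P ≤ K) : UnifIntegrable f p P := by
  intro ε hε
  set θ : ℝ := 1 / p.toReal - 1 / q.toReal with hθ
  have hp0 : 0 < p.toReal := ENNReal.toReal_pos hp hpq.ne_top
  have hθ0 : 0 < θ := by
    rcases eq_or_ne q ∞ with rfl | hq
    · simpa [hθ] using hp0
    · exact sub_pos.2
        (one_div_lt_one_div_of_lt hp0 ((ENNReal.toReal_lt_toReal hpq.ne_top hq).2 hpq))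
  refine ⟨(ε / (K + 1)) ^ (1 / θ), by positivity, fun n s hs hsδ => ?_⟩
  calc eLpNorm (s.indicator (f n)) p P = eLpNorm (f n) p (P.restrict s) :=
        eLpNorm_indicator_eq_eLpNorm_restrict hs
    _ ≤ eLpNorm (f n) q (P.restrict s) * P s ^ θ := by
        simpa [hθ] using eLpNorm_le_eLpNorm_mul_rpow_measure_univ hpq.le (hf n).restrict
    _ ≤ K * (ENNReal.ofReal ((ε / (K + 1)) ^ (1 / θ))) ^ θ := by
        gcongr
        exact (eLpNorm_mono_measure _ Measure.restrict_le_self).trans (hK n)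
    _ = ENNReal.ofReal (K * (ε / (K + 1))) := by
        rw [ENNReal.ofReal_rpow_of_nonneg (by positivity) hθ0.le, ← Real.rpow_mul (by positivity),
          one_div_mul_cancel hθ0.ne', Real.rpow_one, ENNReal.ofReal_mul (by positivity),
          ENNReal.ofReal_coe_nnreal]
    _ ≤ ENNReal.ofReal ε := by
        refine ENNReal.ofReal_le_ofReal ?_
        rw [← mul_div_assoc, div_le_iff₀ (by positivity)]
        nlinarith [K.coe_nonneg]

theorem uniformIntegrable_of_eLpNorm_le [IsProbabilityMeasure P] [NormedAddCommGroup β]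
    {f : ι → Ω → β} {p q : ℝ≥0∞} (hp : p ≠ 0) (hpq : p < q)
    (hf : ∀ n, AEStronglyMeasurable (f n) P) {K : ℝ≥0} (hK : ∀ n, eLpNorm (f n) q P ≤ K) :
    UniformIntegrable f p P :=
  ⟨hf, unifIntegrable_of_eLpNorm_le hp hpq hf hK, K, fun n =>
    (eLpNorm_le_eLpNorm_of_exponent_le hpq.le (hf n)).trans (hK n)⟩

theorem eLpNorm_le_of_lintegral_rpow_le {f : Ω → ℝ} {γ : ℝ} (hγ : 0 < γ) {C : ℝ≥0}
    (h : ∫⁻ ω, ‖f ω‖ₑ ^ γ ∂P ≤ C) :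
    eLpNorm f (ENNReal.ofReal γ) P ≤ ((C ^ (1 / γ) : ℝ≥0) : ℝ≥0∞) := by
  rw [eLpNorm_eq_lintegral_rpow_enorm_toReal (by simpa using hγ) ENNReal.ofReal_ne_top,
    ENNReal.toReal_ofReal hγ.le, ENNReal.coe_rpow_of_nonneg _ (by positivity)]
  exact ENNReal.rpow_le_rpow h (by positivity)

theorem integral_sq_eq_toReal_eLpNorm_sq {f : Ω → ℝ} (hf : MemLp f 2 P) :
    ∫ ω, f ω ^ 2 ∂P = (eLpNorm f 2 P).toReal ^ 2 := by
  rw [hf.eLpNorm_eq_integral_rpow_norm two_ne_zero ENNReal.ofNat_ne_top]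
  have h0 : 0 ≤ ∫ ω, f ω ^ 2 ∂P := integral_nonneg fun _ => sq_nonneg _
  simp only [ENNReal.toReal_ofNat, Real.norm_eq_abs, Real.rpow_ofNat, sq_abs]
  rw [ENNReal.toReal_ofReal (by positivity), ← one_div, ← Real.sqrt_eq_rpow, Real.sq_sqrt h0]

theorem memLp_and_integral_sq_le_of_lintegral_rpow_le [IsProbabilityMeasure P] {f : Ω → ℝ}
    (hf : AEStronglyMeasurable f P) {γ : ℝ} (hγ : 2 ≤ γ) {C : ℝ≥0}
    (hC : ∫⁻ ω, ‖f ω‖ₑ ^ γ ∂P ≤ C) :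
    MemLp f 2 P ∧ ∫ ω, f ω ^ 2 ∂P ≤ ((C ^ (1 / γ) : ℝ≥0) : ℝ) ^ 2 := by
  have h2γ : (2 : ℝ≥0∞) ≤ ENNReal.ofReal γ := by
    rw [← ENNReal.ofReal_ofNat 2]
    exact ENNReal.ofReal_le_ofReal hγ
  have hle := (eLpNorm_le_eLpNorm_of_exponent_le h2γ hf).trans
    (eLpNorm_le_of_lintegral_rpow_le (by linarith) hC)
  have hmem : MemLp f 2 P := ⟨hf, hle.trans_lt ENNReal.coe_lt_top⟩
  refine ⟨hmem, ?_⟩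
  rw [integral_sq_eq_toReal_eLpNorm_sq hmem]
  gcongr
  exact ENNReal.toReal_le_coe_of_le_coe hle

theorem memLp_and_tendsto_integral_sq_sub_of_tendstoInMeasure [IsProbabilityMeasure P]
    {f : ℕ → Ω → ℝ} {D : Ω → ℝ} {γ : ℝ} (hγ : 2 < γ) (hf : ∀ n, AEStronglyMeasurable (f n) P)
    {C : ℝ≥0} (hC : ∀ᶠ n in atTop, ∫⁻ ω, ‖f n ω‖ₑ ^ γ ∂P ≤ C)
    (hfD : TendstoInMeasure P f atTop D) :
    MemLp D 2 P ∧ Tendsto (fun n => ∫ ω, (f n ω - D ω) ^ 2 ∂P) atTop (𝓝 0) := by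
  obtain ⟨n₀, hn₀⟩ := eventually_atTop.1 hC
  have hui : UniformIntegrable (fun n => f (n + n₀)) 2 P :=
    uniformIntegrable_of_eLpNorm_le two_ne_zero
      (by simpa using (ENNReal.ofReal_lt_ofReal_iff (by linarith)).2 hγ) (fun n => hf _) fun n =>
      eLpNorm_le_of_lintegral_rpow_le (by linarith) (hn₀ (n + n₀) (Nat.le_add_left _ _))
  have hfD' : TendstoInMeasure P (fun n => f (n + n₀)) atTop D := fun ε hε =>
    (hfD ε hε).comp (tendsto_add_atTop_nat n₀)
  have hD : MemLp D 2 P := hui.memLp_of_tendstoInMeasure hfD'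
  refine ⟨hD, (tendsto_add_atTop_iff_nat n₀).1 ?_⟩
  have hLp : Tendsto (fun n => (eLpNorm (f (n + n₀) - D) 2 P).toReal ^ 2) atTop (𝓝 0) := by
    simpa using ((ENNReal.tendsto_toReal ENNReal.zero_ne_top).comp
      (tendsto_Lp_finite_of_tendstoInMeasure one_le_two ENNReal.ofNat_ne_top (fun n => hf _) hD
        hui.2.1 hfD')).pow 2
  exact hLp.congr fun n => (integral_sq_eq_toReal_eLpNorm_sq ((hui.memLp n).sub hD)).symm

end UniformIntegrability

section Resampling

variable {ι : Type*} [DecidableEq ι] {E : ι → Type*} [∀ i, MeasurableSpace (E i)]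
  (ν : ∀ i, Measure (E i)) [∀ i, IsProbabilityMeasure (ν i)]

omit [∀ i, MeasurableSpace (E i)] in
theorem piecewise_compl_singleton (y : ι) [∀ z, Decidable (z ∈ ({y}ᶜ : Set ι))] (x x' : ∀ i, E i) :
    ({y}ᶜ : Set ι).piecewise x x' = Function.update x y (x' y) := by
  ext z
  rcases eq_or_ne z y with rfl | hz <;> simp [*]

theorem measurePreserving_update (y : ι) :
    MeasurePreserving (fun p : (∀ i, E i) × E y => Function.update p.1 y p.2)
      ((Measure.infinitePi ν).prod (ν y)) (Measure.infinitePi ν) := by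
  refine ⟨measurable_update', ?_⟩
  rw [← ((MeasurePreserving.id _).prod (measurePreserving_eval_infinitePi ν y)).map_eq,
    Measure.map_map measurable_update' (by fun_prop)]
  have hpw := (measurePreserving_piecewise ν {y}ᶜ).map_eq
  simp only [piecewise_compl_singleton] at hpw
  exact hpw

variable {F : Type*} [NormedAddCommGroup F] [NormedSpace ℝ F] [CompleteSpace F]

theorem condExp_cylinderEvents_compl_singleton_ae_eq (y : ι) {h : (∀ i, E i) → F}
    (hh : Integrable h (Measure.infinitePi ν)) (hm : StronglyMeasurable h) :
    (Measure.infinitePi ν)[h | cylinderEvents {y}ᶜ] =ᵐ[Measure.infinitePi ν]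
      fun x => ∫ e, h (Function.update x y e) ∂ν y := by
  refine (condExp_cylinderEvents_ae_eq_integral_piecewise ν _ hh hm).trans (.of_forall fun x => ?_)
  simp only [piecewise_compl_singleton]
  exact integral_comp_measurePreserving (measurePreserving_eval_infinitePi ν y)
    (hm.comp_measurable (measurable_update x)).aestronglyMeasurable

theorem condExp_comp_update (T : Set ι) (y : ι) {h : (∀ i, E i) → F}
    (hh : Integrable h (Measure.infinitePi ν)) (hm : StronglyMeasurable h) :
    ((Measure.infinitePi ν).prod (ν y))[
        fun p => h (Function.update p.1 y p.2) | (cylinderEvents T).comap Prod.fst]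
      =ᵐ[(Measure.infinitePi ν).prod (ν y)]
    fun p => ((Measure.infinitePi ν)[h | cylinderEvents (T ∩ {y}ᶜ)]) p.1 := by
  set μ := Measure.infinitePi ν
  have hupdate : Integrable (fun p : (∀ i, E i) × E y => h (Function.update p.1 y p.2))
      (μ.prod (ν y)) := (measurePreserving_update ν y).integrable_comp_of_integrable hh
  have hfst : Integrable (fun p : (∀ i, E i) × E y => (μ[h | cylinderEvents (T ∩ {y}ᶜ)]) p.1)
      (μ.prod (ν y)) := measurePreserving_fst.integrable_comp_of_integrable integrable_condExp
  refine (ae_eq_condExp_of_forall_setIntegral_eq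
    ((MeasurableSpace.comap_mono cylinderEvents_le_pi).trans measurable_fst.comap_le) hupdate
    (fun s _ _ => hfst.integrableOn) ?_ ?_).symm
  · rintro _ ⟨B, hB, rfl⟩ -
    have hB' : MeasurableSet B := cylinderEvents_le_pi _ hB
    rw [← Set.prod_univ, setIntegral_prod _ hfst.integrableOn,
      setIntegral_prod _ hupdate.integrableOn]
    simp only [Measure.restrict_univ, integral_const, probReal_univ, one_smul]
    calc ∫ x in B, (μ[h | cylinderEvents (T ∩ {y}ᶜ)]) x ∂μ
        = ∫ x in B, (μ[μ[h | cylinderEvents {y}ᶜ] | cylinderEvents T]) x ∂μ :=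
          setIntegral_congr_ae hB'
            ((condExp_condExp_cylinderEvents ν {y}ᶜ T).mono fun x hx _ => hx.symm)
      _ = ∫ x in B, (μ[h | cylinderEvents {y}ᶜ]) x ∂μ :=
          setIntegral_condExp cylinderEvents_le_pi integrable_condExp hB
      _ = ∫ x in B, ∫ e, h (Function.update x y e) ∂ν y ∂μ :=
          setIntegral_congr_ae hB'
            ((condExp_cylinderEvents_compl_singleton_ae_eq ν y hh hm).mono fun x hx _ => hx)
  · exact ((stronglyMeasurable_condExp.mono
      (cylinderEvents_mono Set.inter_subset_left)).comp_measurable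
      (comap_measurable _)).aestronglyMeasurable

theorem ae_memLp_two_prodMk_right {α β : Type*} [MeasurableSpace α] [MeasurableSpace β]
    {μ : Measure α} {η : Measure β} [SFinite μ] [SFinite η] {f : α × β → ℝ}
    (hf : MemLp f 2 (μ.prod η)) (hfm : Measurable f) :
    ∀ᵐ b ∂η, MemLp (fun a => f (a, b)) 2 μ :=
  hf.integrable_sq.prod_left_ae.mono fun _ hb => (memLp_two_iff_integrable_sq
    (hfm.comp measurable_prodMk_right).aestronglyMeasurable).2 hb

theorem memLp_two_update_sub_update {h : (∀ i, E i) → ℝ} {y z : ι} (hyz : y ≠ z)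
    (hz : MemLp (fun p : (∀ i, E i) × E z => h p.1 - h (Function.update p.1 z p.2)) 2
      ((Measure.infinitePi ν).prod (ν z))) :
    MemLp (fun q : ((∀ i, E i) × E z) × E y => h (Function.update q.1.1 y q.2)
      - h (Function.update (Function.update q.1.1 z q.1.2) y q.2)) 2
      (((Measure.infinitePi ν).prod (ν z)).prod (ν y)) := by
  have hswap : MeasurePreserving
      (fun q : ((∀ i, E i) × E z) × E y => (Function.update q.1.1 y q.2, q.1.2))
      (((Measure.infinitePi ν).prod (ν z)).prod (ν y)) ((Measure.infinitePi ν).prod (ν z)) :=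
    (((measurePreserving_update ν y).prod (.id _)).comp
      (measurePreserving_prodAssoc _ _ _).symm).comp
      (((MeasurePreserving.id _).prod Measure.measurePreserving_swap).comp
        (measurePreserving_prodAssoc _ _ _))
  simpa only [Function.comp_def, Function.update_comm hyz] using hz.comp_measurePreserving hswap

theorem memLp_two_of_forall_update_sub (Λ : Finset ι) {h : (∀ i, E i) → ℝ} (hm : Measurable h)
    (hdep : DependsOn h Λ)
    (hΛ : ∀ y ∈ Λ, MemLp (fun p : (∀ i, E i) × E y => h p.1 - h (Function.update p.1 y p.2)) 2
      ((Measure.infinitePi ν).prod (ν y))) :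
    MemLp h 2 (Measure.infinitePi ν) := by
  induction Λ using Finset.induction_on generalizing h with
  | empty =>
    obtain ⟨x₀⟩ := (inferInstance : (ae (Measure.infinitePi ν)).NeBot).nonempty
    exact (memLp_const (h x₀)).congr_norm hm.aestronglyMeasurable
      (.of_forall fun x => by rw [hdep (y := x) (by simp)])
  | insert y s hys ih =>
    have hz (z) (hzs : z ∈ s) : ∀ᵐ e ∂ν y, MemLp (fun p : (∀ i, E i) × E z =>
        h (Function.update p.1 y e) - h (Function.update (Function.update p.1 z p.2) y e)) 2
        ((Measure.infinitePi ν).prod (ν z)) :=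
      ae_memLp_two_prodMk_right (memLp_two_update_sub_update ν (ne_of_mem_of_not_mem hzs hys).symm
        (hΛ z (Finset.mem_insert_of_mem hzs))) (by fun_prop)
    -- Freeze the coordinate `y` at a value that is generic for all the increments at once.
    obtain ⟨e, he, hze⟩ := ((ae_memLp_two_prodMk_right (hΛ y (Finset.mem_insert_self y s))
      (by fun_prop)).and ((ae_ball_iff s.countable_toSet).2 hz)).exists
    have hupdate : MemLp (fun x => h (Function.update x y e)) 2 (Measure.infinitePi ν) :=
      ih (by fun_prop) (fun x x' hxx => hdep fun z hzs => by
        rcases eq_or_ne z y with rfl | hzy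
        · simp
        · simpa [hzy] using hxx z (Finset.mem_of_mem_insert_of_ne hzs hzy)) hze
    simpa only [Pi.add_def, sub_add_cancel] using he.add hupdate

end Resampling

section PastDifference

variable {d : ℕ} {E : Type*} [MeasurableSpace E] {P₀ : Measure E} [IsProbabilityMeasure P₀]

/-- The conditional expectation of a function of the i.i.d. field given the lexicographic past of
the origin, minus the one given the strict past: the contribution of the origin to the
lexicographic martingale of `h`. -/
noncomputable def pastDifference (P₀ : Measure E) [IsProbabilityMeasure P₀]
    (h : ((Fin d → ℤ) → E) → ℝ) (x : (Fin d → ℤ) → E) : ℝ :=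
  ((iidLaw _ P₀)[h | weakPast d E 0]) x - ((iidLaw _ P₀)[h | strictPast d E 0]) x

theorem isStationaryMartingaleDifference_pastDifference {h : ((Fin d → ℤ) → E) → ℝ}
    (hh : MemLp h 2 (iidLaw _ P₀)) :
    IsStationaryMartingaleDifference P₀ (pastDifference P₀ h) where
  stronglyMeasurable := stronglyMeasurable_condExp.sub
    (stronglyMeasurable_condExp.mono (strictPast_le_weakPast 0))
  memLp := (hh.condExp (by norm_num)).sub (hh.condExp (by norm_num))
  condExp_eq_zero := by
    refine (condExp_sub integrable_condExp integrable_condExp _).trans ?_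
    filter_upwards [condExp_condExp_of_le (μ := iidLaw _ P₀) (f := h) (strictPast_le_weakPast 0)
        cylinderEvents_le_pi,
      condExp_condExp_of_le (μ := iidLaw _ P₀) (f := h) (le_refl (strictPast d E 0))
        cylinderEvents_le_pi] with x h1 h2
    simp [h1, h2]

theorem lexIic_inter_compl_singleton (y : Fin d → ℤ) :
    {z | toLex z ≤ toLex y} ∩ {y}ᶜ = {z | toLex z < toLex y} := by
  ext z
  exact (lt_iff_le_and_ne (α := Lex (Fin d → ℤ))).symm

variable {Ω : Type*} {X : (Fin d → ℤ) → Ω → E}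

omit [IsProbabilityMeasure P₀] in
theorem lexPast_eq_comap (y : Fin d → ℤ) :
    lexPast X y = (weakPast d E y).comap (fun ω z => X z ω) := by
  simp only [lexPast, weakPast, cylinderEvents, MeasurableSpace.comap_iSup,
    MeasurableSpace.comap_comp]
  rfl

theorem exists_condExp_lexPast_eq_comp [MeasurableSpace Ω] {P : Measure Ω} (D : Ω → ℝ)
    (y : Fin d → ℤ) :
    ∃ g : ((Fin d → ℤ) → E) → ℝ, StronglyMeasurable[weakPast d E y] g ∧
      P[D | lexPast X y] = fun ω => g fun z => X z ω := by
  have hm : StronglyMeasurable[(weakPast d E y).comap (fun ω z => X z ω)] (P[D | lexPast X y]) :=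
    lexPast_eq_comap (X := X) y ▸ stronglyMeasurable_condExp
  exact hm.exists_eq_measurable_comp (mY := weakPast d E y)

variable [MeasurableSpace Ω] {P : Measure Ω} [IsProbabilityMeasure P] {Xs : Ω → E}
  {h : ((Fin d → ℤ) → E) → ℝ}

theorem condExp_resampling_increment
    (hpair : MeasurePreserving (fun ω => ((fun z => X z ω), Xs ω)) P ((iidLaw _ P₀).prod P₀))
    (hh : Integrable h (iidLaw _ P₀)) (hm : StronglyMeasurable h) :
    P[fun ω => h (fun z => X z ω) - h (Function.update (fun z => X z ω) 0 (Xs ω)) | lexPast X 0]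
      =ᵐ[P] fun ω => pastDifference P₀ h (fun z => X z ω) := by
  have hX := measurePreserving_fst.comp hpair
  have hupdate := (measurePreserving_update (fun _ => P₀) 0).integrable_comp_of_integrable hh
  have hweak := condExp_comp_measurePreserving hX
    (cylinderEvents_le_pi (X := fun _ : Fin d → ℤ => E) (Δ := {z | toLex z ≤ toLex 0})) hh
  have hstrict := condExp_comp_measurePreserving hpair
    (m := (weakPast d E 0).comap (Prod.fst : ((Fin d → ℤ) → E) × E → _))
    ((MeasurableSpace.comap_mono cylinderEvents_le_pi).trans measurable_fst.comap_le) hupdate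
  rw [MeasurableSpace.comap_comp] at hstrict
  have hfst := hpair.quasiMeasurePreserving.ae
    (condExp_comp_update (fun _ => P₀) {z | toLex z ≤ toLex 0} 0 hh hm)
  rw [lexIic_inter_compl_singleton] at hfst
  rw [lexPast_eq_comap]
  refine (condExp_sub (hX.integrable_comp_of_integrable hh)
    (hpair.integrable_comp_of_integrable hupdate) _).trans ?_
  filter_upwards [hweak, hstrict, hfst] with ω e1 e2 e3
  exact congrArg₂ (· - ·) e1 (e2.trans e3)

theorem integral_sq_pastDifference_sub_le
    (hpair : MeasurePreserving (fun ω => ((fun z => X z ω), Xs ω)) P ((iidLaw _ P₀).prod P₀))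
    (hh : MemLp h 2 (iidLaw _ P₀)) (hm : StronglyMeasurable h) {D : Ω → ℝ} (hD : MemLp D 2 P)
    {g : ((Fin d → ℤ) → E) → ℝ} (hg : StronglyMeasurable g)
    (hgD : P[D | lexPast X 0] =ᵐ[P] fun ω => g fun z => X z ω) :
    ∫ x, (pastDifference P₀ h x - g x) ^ 2 ∂iidLaw _ P₀
      ≤ ∫ ω, (h (fun z => X z ω) - h (Function.update (fun z => X z ω) 0 (Xs ω)) - D ω) ^ 2 ∂P := by
  have hX := measurePreserving_fst.comp hpair
  have hinc : MemLp
      (fun ω => h (fun z => X z ω) - h (Function.update (fun z => X z ω) 0 (Xs ω))) 2 P :=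
    (hh.comp_measurePreserving hX).sub
      (hh.comp_measurePreserving ((measurePreserving_update (fun _ => P₀) 0).comp hpair))
  have hmeas : AEStronglyMeasurable (fun x => (pastDifference P₀ h x - g x) ^ 2) (iidLaw _ P₀) :=
    ((isStationaryMartingaleDifference_pastDifference hh).memLp.1.sub hg.aestronglyMeasurable).pow 2
  rw [← integral_comp_measurePreserving hX hmeas]
  refine (integral_congr_ae ?_).trans_le
    (integral_sq_condExp_le (m := lexPast X 0) (hinc.sub hD))
  filter_upwards [condExp_resampling_increment hpair (hh.integrable one_le_two) hm, hgD,
    condExp_sub (hinc.integrable one_le_two) (hD.integrable one_le_two) (lexPast X 0)]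
    with ω h1 h2 h3
  exact congrArg (· ^ 2) (h3.trans (congrArg₂ (· - ·) h1 h2)).symm

end PastDifference

namespace RandomSetFunction

variable {d : ℕ} {E : Type*} [MeasurableSpace E] {P₀ : Measure E} [IsProbabilityMeasure P₀]
  {ρ : ℝ} {B₀ : Set (EuclideanSpace ℝ (Fin d))} {H : RandomSetFunction E ρ B₀}

/-- The martingale difference of `H_t(A)` at the site `y`, as a function of the field seen
from `y`. -/
noncomputable def siteDifference (P₀ : Measure E) [IsProbabilityMeasure P₀]
    (H : RandomSetFunction E ρ B₀) (t : Set.Ici (1 : ℝ)) (A : RiemannSubset B₀) (y : Fin d → ℤ) :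
    ((Fin d → ℤ) → E) → ℝ :=
  pastDifference P₀ fun x => H.eval t (shift (-y) x) A

/-- The consequences, for the i.i.d. field alone, of stabilization and bounded moments: `g` is the
mean square limit of the martingale differences of `H` at sites deep inside `t A`, and those at
sites deep inside `t (B₀ \ A)` are negligible. -/
structure HasLimitDifference (P₀ : Measure E) [IsProbabilityMeasure P₀]
    (H : RandomSetFunction E ρ B₀) (g : ((Fin d → ℤ) → E) → ℝ) : Prop where
  isStationaryMartingaleDifference : IsStationaryMartingaleDifference P₀ g
  memLp_eval (t : Set.Ici (1 : ℝ)) (A : RiemannSubset B₀) :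
    MemLp (fun x => H.eval t x A) 2 (iidLaw _ P₀)
  exists_integral_sq_le : ∃ C : ℝ, ∀ (A : RiemannSubset B₀) (t : Set.Ici (1 : ℝ)),
    ∀ y ∈ discretization ρ ((t : ℝ) • B₀),
      ∫ x, H.siteDifference P₀ t A y x ^ 2 ∂iidLaw _ P₀ ≤ C
  tendsto_of_setLiminf (A : RiemannSubset B₀) {t : ℕ → Set.Ici (1 : ℝ)} {y : ℕ → Fin d → ℤ}
    (h : setLiminf (fun n => latticePoint (-y n) +ᵥ
      ((t n : ℝ) • (A : Set (EuclideanSpace ℝ (Fin d))))) = Set.univ) :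
    Tendsto (fun n => ∫ x, (H.siteDifference P₀ (t n) A (y n) x - g x) ^ 2 ∂iidLaw _ P₀) atTop
      (𝓝 0)
  tendsto_zero_of_setLiminf_sdiff (A : RiemannSubset B₀) {t : ℕ → Set.Ici (1 : ℝ)}
    {y : ℕ → Fin d → ℤ}
    (h : setLiminf (fun n => latticePoint (-y n) +ᵥ
      ((t n : ℝ) • (B₀ \ (A : Set (EuclideanSpace ℝ (Fin d)))))) = Set.univ) :
    Tendsto (fun n => ∫ x, H.siteDifference P₀ (t n) A (y n) x ^ 2 ∂iidLaw _ P₀) atTop (𝓝 0)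

theorem stronglyMeasurable_eval_cylinderEvents (t : Set.Ici (1 : ℝ)) (A : RiemannSubset B₀) :
    StronglyMeasurable[cylinderEvents (discretization ρ ((t : ℝ) • B₀))]
      (fun x : (Fin d → ℤ) → E => H.eval t x A) :=
  ((H.measurable_toFun t A).comp (measurable_restrict_cylinderEvents _)).stronglyMeasurable

theorem stronglyMeasurable_eval (t : Set.Ici (1 : ℝ)) (A : RiemannSubset B₀) :
    StronglyMeasurable (fun x : (Fin d → ℤ) → E => H.eval t x A) :=
  (stronglyMeasurable_eval_cylinderEvents t A).mono cylinderEvents_le_pi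

theorem stronglyMeasurable_eval_shift (t : Set.Ici (1 : ℝ)) (A : RiemannSubset B₀)
    (y : Fin d → ℤ) : StronglyMeasurable (fun x : (Fin d → ℤ) → E => H.eval t (shift y x) A) :=
  (stronglyMeasurable_eval t A).comp_measurable (measurable_shift _)

variable {Ω : Type*} [MeasurableSpace Ω] {P : Measure Ω} [IsProbabilityMeasure P]
  {X : (Fin d → ℤ) → Ω → E} {Xs : Ω → E}

theorem measurable_resampling_increment (t : Set.Ici (1 : ℝ)) (A : RiemannSubset B₀)
    (y : Fin d → ℤ) : Measurable (fun p : ((Fin d → ℤ) → E) × E =>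
      H.eval t (shift y p.1) A - H.eval t (shift y (Function.update p.1 0 p.2)) A) :=
  ((stronglyMeasurable_eval_shift t A y).measurable.comp measurable_fst).sub
    ((stronglyMeasurable_eval_shift t A y).measurable.comp measurable_update')

theorem measurable_increment (hpair : Measurable (fun ω => ((fun z => X z ω), Xs ω)))
    (t : Set.Ici (1 : ℝ)) (A : RiemannSubset B₀) (y : Fin d → ℤ) :
    Measurable (H.increment X Xs t y A) :=
  (measurable_resampling_increment t A y).comp hpair

section

variable (hpair : MeasurePreserving (fun ω => ((fun z => X z ω), Xs ω)) P ((iidLaw _ P₀).prod P₀))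
include hpair

omit [IsProbabilityMeasure P] in
theorem memLp_eval_sub_update {t : Set.Ici (1 : ℝ)} {A : RiemannSubset B₀} {y : Fin d → ℤ}
    (hinc : MemLp (H.increment X Xs t (-y) A) 2 P) :
    MemLp (fun p : ((Fin d → ℤ) → E) × E =>
      H.eval t p.1 A - H.eval t (Function.update p.1 y p.2) A) 2 ((iidLaw _ P₀).prod P₀) := by
  have hprod := ((memLp_comp_iff hpair
    (measurable_resampling_increment t A (-y)).aestronglyMeasurable).1 hinc)
  have hshift := hprod.comp_measurePreserving
    ((measurePreserving_shift (P₀ := P₀) y).prod (MeasurePreserving.id P₀))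
  refine hshift.congr_norm ?_ (Eventually.of_forall fun p => ?_)
  · exact (((stronglyMeasurable_eval t A).measurable.comp measurable_fst).sub
      ((stronglyMeasurable_eval t A).measurable.comp measurable_update')).aestronglyMeasurable
  · simp only [Function.comp_apply, Prod.map_fst, Prod.map_snd, id_eq, shift_neg_shift,
      shift_neg_update_shift]

theorem BoundedMoments.memLp_eval (hmom : H.BoundedMoments P X Xs) (hB₀ : Bornology.IsBounded B₀)
    (t : Set.Ici (1 : ℝ)) (A : RiemannSubset B₀) :
    MemLp (fun x => H.eval t x A) 2 (iidLaw _ P₀) := by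
  obtain ⟨γ, hγ, C, hC⟩ := hmom
  have hfin : (discretization ρ ((t : ℝ) • B₀)).Finite := finite_discretization (hB₀.smul₀ _) ρ
  refine memLp_two_of_forall_update_sub (fun _ => P₀) hfin.toFinset
    (stronglyMeasurable_eval t A).measurable ?_ fun y hy => ?_
  · intro x x' hxx'
    exact congrArg (H.toFun t A) (funext fun z => hxx' z (hfin.mem_toFinset.2 z.2))
  · exact memLp_eval_sub_update hpair (memLp_and_integral_sq_le_of_lintegral_rpow_le
      (measurable_increment hpair.measurable t A (-y)).aestronglyMeasurable hγ.le
      (hC A t y (hfin.mem_toFinset.1 hy))).1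

theorem integral_sq_siteDifference_sub_le {t : Set.Ici (1 : ℝ)} {A : RiemannSubset B₀}
    (hmem : MemLp (fun x => H.eval t x A) 2 (iidLaw _ P₀)) {D : Ω → ℝ} (hD : MemLp D 2 P)
    {g : ((Fin d → ℤ) → E) → ℝ} (hg : StronglyMeasurable g)
    (hgD : P[D | lexPast X 0] =ᵐ[P] fun ω => g fun z => X z ω) (y : Fin d → ℤ) :
    ∫ x, (H.siteDifference P₀ t A y x - g x) ^ 2 ∂iidLaw _ P₀
      ≤ ∫ ω, (H.increment X Xs t (-y) A ω - D ω) ^ 2 ∂P :=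
  integral_sq_pastDifference_sub_le hpair (hmem.comp_measurePreserving (measurePreserving_shift _))
    (stronglyMeasurable_eval_shift t A (-y)) hD hg hgD

theorem BoundedMoments.exists_integral_sq_siteDifference_le (hmom : H.BoundedMoments P X Xs)
    (hB₀ : Bornology.IsBounded B₀) :
    ∃ C : ℝ, ∀ (A : RiemannSubset B₀) (t : Set.Ici (1 : ℝ)),
      ∀ y ∈ discretization ρ ((t : ℝ) • B₀),
        ∫ x, H.siteDifference P₀ t A y x ^ 2 ∂iidLaw _ P₀ ≤ C := by
  obtain ⟨γ, hγ, C, hC⟩ := id hmom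
  refine ⟨((C ^ (1 / γ) : ℝ≥0) : ℝ) ^ 2, fun A t y hy => ?_⟩
  have hinc := (memLp_and_integral_sq_le_of_lintegral_rpow_le
    (measurable_increment hpair.measurable t A (-y)).aestronglyMeasurable hγ.le (hC A t y hy)).2
  have hle := integral_sq_siteDifference_sub_le hpair (hmom.memLp_eval hpair hB₀ t A)
    (MemLp.zero (p := 2)) stronglyMeasurable_zero (by rw [condExp_zero]; rfl) y
  simp only [Pi.zero_apply, sub_zero] at hle
  exact hle.trans hinc

end

theorem BoundedMoments.tendsto_integral_sq_increment_sub (hmom : H.BoundedMoments P X Xs)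
    (hρ : 0 ≤ ρ) (hpair : Measurable (fun ω => ((fun z => X z ω), Xs ω))) {D : Ω → ℝ}
    (A : RiemannSubset B₀) {t : ℕ → Set.Ici (1 : ℝ)} {y : ℕ → Fin d → ℤ}
    {S : Set (EuclideanSpace ℝ (Fin d))} (hS : S ⊆ B₀)
    (hlim : setLiminf (fun n => latticePoint (-y n) +ᵥ ((t n : ℝ) • S)) = Set.univ)
    (hconv : TendstoInMeasure P (fun n => H.increment X Xs (t n) (-y n) A) atTop D) :
    MemLp D 2 P ∧
      Tendsto (fun n => ∫ ω, (H.increment X Xs (t n) (-y n) A ω - D ω) ^ 2 ∂P) atTop (𝓝 0) := by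
  obtain ⟨γ, hγ, C, hC⟩ := hmom
  refine memLp_and_tendsto_integral_sq_sub_of_tendstoInMeasure hγ (C := C) (fun n =>
    (measurable_increment hpair (t n) A (-y n)).aestronglyMeasurable) ?_ hconv
  filter_upwards [eventually_latticePoint_mem_of_setLiminf hlim] with n hn
  exact hC A (t n) (y n) (mem_discretization_of_latticePoint_mem hρ (Set.smul_set_mono hS hn))

theorem Stabilizes.memLp {D : Ω → ℝ} (hstab : H.Stabilizes P X Xs D)
    (hmom : H.BoundedMoments P X Xs) (hB₀ : IsRiemannMeasurable B₀) (hB₀pos : 0 < volume B₀)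
    (hρ : 0 ≤ ρ) (hpair : Measurable (fun ω => ((fun z => X z ω), Xs ω))) : MemLp D 2 P := by
  obtain ⟨t, y, hlim⟩ := hB₀.exists_setLiminf_eq_univ hB₀pos
  let A : RiemannSubset B₀ := ⟨B₀, hB₀, subset_rfl⟩
  exact (hmom.tendsto_integral_sq_increment_sub hρ hpair A subset_rfl hlim
    ((hstab.2 A t fun n => -y n).1 hlim)).1

theorem BoundedMoments.tendsto_integral_sq_siteDifference_sub (hmom : H.BoundedMoments P X Xs)
    (hB₀ : Bornology.IsBounded B₀) (hρ : 0 ≤ ρ)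
    (hpair : MeasurePreserving (fun ω => ((fun z => X z ω), Xs ω)) P ((iidLaw _ P₀).prod P₀))
    {D : Ω → ℝ} {g : ((Fin d → ℤ) → E) → ℝ} (hg : StronglyMeasurable g)
    (hgD : P[D | lexPast X 0] =ᵐ[P] fun ω => g fun z => X z ω) (A : RiemannSubset B₀)
    {t : ℕ → Set.Ici (1 : ℝ)} {y : ℕ → Fin d → ℤ} {S : Set (EuclideanSpace ℝ (Fin d))}
    (hS : S ⊆ B₀)
    (hlim : setLiminf (fun n => latticePoint (-y n) +ᵥ ((t n : ℝ) • S)) = Set.univ)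
    (hconv : TendstoInMeasure P (fun n => H.increment X Xs (t n) (-y n) A) atTop D) :
    Tendsto (fun n => ∫ x, (H.siteDifference P₀ (t n) A (y n) x - g x) ^ 2 ∂iidLaw _ P₀) atTop
      (𝓝 0) := by
  obtain ⟨hD, ht⟩ :=
    hmom.tendsto_integral_sq_increment_sub hρ hpair.measurable A hS hlim hconv
  exact squeeze_zero (fun n => integral_nonneg fun x => sq_nonneg _) (fun n =>
    integral_sq_siteDifference_sub_le hpair (hmom.memLp_eval hpair hB₀ _ _) hD hg hgD _) ht

theorem Stabilizes.exists_hasLimitDifference {D : Ω → ℝ} (hstab : H.Stabilizes P X Xs D)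
    (hmom : H.BoundedMoments P X Xs) (hB₀ : IsRiemannMeasurable B₀) (hB₀pos : 0 < volume B₀)
    (hρ : 0 ≤ ρ)
    (hpair : MeasurePreserving (fun ω => ((fun z => X z ω), Xs ω)) P ((iidLaw _ P₀).prod P₀)) :
    ∃ g, H.HasLimitDifference P₀ g ∧ P[D | lexPast X 0] =ᵐ[P] fun ω => g fun z => X z ω := by
  have hX := measurePreserving_fst.comp hpair
  obtain ⟨g, hgm, hgD⟩ := exists_condExp_lexPast_eq_comp (X := X) (P := P) D 0
  have hgm' : StronglyMeasurable g := hgm.mono cylinderEvents_le_pi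
  have hg : MemLp g 2 (iidLaw _ P₀) := by
    have hcomp : MemLp (fun ω => g fun z => X z ω) 2 P := hgD ▸
      (hstab.memLp hmom hB₀ hB₀pos hρ hpair.measurable).condExp (by norm_num)
    exact (memLp_comp_iff hX hgm'.aestronglyMeasurable).1 hcomp
  have hinside (A : RiemannSubset B₀) {t : ℕ → Set.Ici (1 : ℝ)} {y : ℕ → Fin d → ℤ} (hlim) :=
    hmom.tendsto_integral_sq_siteDifference_sub hB₀.1 hρ hpair hgm' hgD.eventuallyEq A A.2.2 hlim
      ((hstab.2 A t fun n => -y n).1 hlim)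
  refine ⟨g, ?_, hgD.eventuallyEq⟩
  refine ⟨?_, hmom.memLp_eval hpair hB₀.1, hmom.exists_integral_sq_siteDifference_le hpair hB₀.1,
    hinside, fun A t y hlim => ?_⟩
  · obtain ⟨t, y, hlim⟩ := hB₀.exists_setLiminf_eq_univ hB₀pos
    exact .of_tendsto (fun n => isStationaryMartingaleDifference_pastDifference
      ((hmom.memLp_eval hpair hB₀.1 _ _).comp_measurePreserving (measurePreserving_shift _)))
      hgm hg (hinside ⟨B₀, hB₀, subset_rfl⟩ hlim)
  · have hzero := hmom.tendsto_integral_sq_siteDifference_sub hB₀.1 hρ hpair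
      stronglyMeasurable_zero (D := 0) (by rw [condExp_zero]; rfl) A Set.sdiff_subset hlim
      ((hstab.2 A t fun n => -y n).2 hlim)
    simpa only [Pi.zero_apply, sub_zero] using hzero

end RandomSetFunction

section MartingaleDecomposition

variable {d : ℕ} {E : Type*} [MeasurableSpace E] {P₀ : Measure E} [IsProbabilityMeasure P₀]

theorem cylinderEvents_empty {ι : Type*} {X : ι → Type*} [∀ i, MeasurableSpace (X i)] :
    cylinderEvents (X := X) ∅ = ⊥ := by
  simp [cylinderEvents]

theorem condExp_comp_shift_neg_ae_eq {h : ((Fin d → ℤ) → E) → ℝ}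
    (hh : Integrable h (iidLaw _ P₀)) {Λ : Set (Fin d → ℤ)}
    (hm : StronglyMeasurable[cylinderEvents Λ] h) (S : Set (Fin d → ℤ)) (y : Fin d → ℤ) :
    ((iidLaw _ P₀)[fun x => h (shift (-y) x) | cylinderEvents S]) ∘ shift y
      =ᵐ[iidLaw _ P₀] (iidLaw _ P₀)[h | cylinderEvents ((· + y) '' S ∩ Λ)] := by
  have hshift := condExp_comp_measurePreserving (measurePreserving_shift (P₀ := P₀) y)
    (m := cylinderEvents S) cylinderEvents_le_pi
    ((measurePreserving_shift (P₀ := P₀) (-y)).integrable_comp_of_integrable hh)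
  have hcomp : (h ∘ shift (-y)) ∘ shift y = h :=
    funext fun x => congrArg h (shift_neg_shift y x)
  rw [hcomp, comap_shift_cylinderEvents] at hshift
  exact hshift.symm.trans (condExp_cylinderEvents_ae_eq_inter (fun _ => P₀) _ hh hm)

theorem pastDifference_comp_shift_neg_ae_eq {h : ((Fin d → ℤ) → E) → ℝ}
    (hh : Integrable h (iidLaw _ P₀)) {Λ : Set (Fin d → ℤ)}
    (hm : StronglyMeasurable[cylinderEvents Λ] h) (y : Fin d → ℤ) :
    (fun x => pastDifference P₀ (fun x => h (shift (-y) x)) (shift y x)) =ᵐ[iidLaw _ P₀]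
      fun x => ((iidLaw _ P₀)[h | cylinderEvents ({z | toLex z ≤ toLex y} ∩ Λ)]) x
        - ((iidLaw _ P₀)[h | cylinderEvents ({z | toLex z < toLex y} ∩ Λ)]) x := by
  have hweak := condExp_comp_shift_neg_ae_eq hh hm {z | toLex z ≤ toLex 0} y
  have hstrict := condExp_comp_shift_neg_ae_eq hh hm {z | toLex z < toLex 0} y
  rw [image_add_lexIic] at hweak
  rw [image_add_lexIio] at hstrict
  filter_upwards [hweak, hstrict] with x e1 e2
  exact congrArg₂ (· - ·) e1 e2

theorem sub_integral_ae_eq_sum_pastDifference {h : ((Fin d → ℤ) → E) → ℝ}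
    (hh : Integrable h (iidLaw _ P₀)) (Λ : Finset (Fin d → ℤ))
    (hm : StronglyMeasurable[cylinderEvents (Λ : Set (Fin d → ℤ))] h) :
    (fun x => h x - ∫ x, h x ∂iidLaw _ P₀) =ᵐ[iidLaw _ P₀]
      fun x => ∑ y ∈ Λ, pastDifference P₀ (fun x => h (shift (-y) x)) (shift y x) := by
  have hdiff := (Finset.eventually_all Λ).2 fun y _ => pastDifference_comp_shift_neg_ae_eq hh hm y
  filter_upwards [hdiff] with x hx
  have htelescope := sum_sublevel_sub_strictSublevel (r := fun z : Fin d → ℤ => toLex z)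
    toLex.injective (fun S => ((iidLaw _ P₀)[h | cylinderEvents S]) x) Λ
  rw [condExp_of_stronglyMeasurable cylinderEvents_le_pi hm hh, cylinderEvents_empty,
    condExp_bot] at htelescope
  exact htelescope.symm.trans (Finset.sum_congr rfl fun y hy => (hx y hy).symm)

theorem integral_sq_sum_shift {G : (Fin d → ℤ) → ((Fin d → ℤ) → E) → ℝ}
    (hG : ∀ y, IsStationaryMartingaleDifference P₀ (G y)) (s : Finset (Fin d → ℤ)) :
    ∫ x, (∑ y ∈ s, G y (shift y x)) ^ 2 ∂iidLaw _ P₀ = ∑ y ∈ s, ∫ x, G y x ^ 2 ∂iidLaw _ P₀ := by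
  have hmart := IsStationaryMartingaleDifference.isMartingaleDifference_shift hG
  have hmem (y) := (hG y).memLp_shift y
  have horth := hmart.integral_sum_mul_sum hmart hmem hmem s s
  rw [Finset.inter_self] at horth
  simp only [sq]
  exact horth.trans (Finset.sum_congr rfl fun y _ =>
    integral_comp_measurePreserving (measurePreserving_shift y)
      (f := fun x => G y x * G y x) ((hG y).memLp.1.mul (hG y).memLp.1))

end MartingaleDecomposition

section LatticeFinset

variable {d : ℕ} {A B : Set (EuclideanSpace ℝ (Fin d))}

/-- The lattice points of the dilate `t A`. They are the discretization of `t A` at radius `0`,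
which is how finiteness is obtained. -/
noncomputable def latticeFinset (hA : Bornology.IsBounded A) (t : ℝ) : Finset (Fin d → ℤ) :=
  (finite_discretization (hA.smul₀ t) 0).toFinset

theorem mem_latticeFinset {hA : Bornology.IsBounded A} {t : ℝ} {y : Fin d → ℤ} :
    y ∈ latticeFinset hA t ↔ latticePoint y ∈ t • A := by
  simp [latticeFinset, discretization, Metric.closedBall_zero]

theorem latticeFinset_inter {t : ℝ} (ht : t ≠ 0) (hA : Bornology.IsBounded A)
    (hB : Bornology.IsBounded B) (hAB : Bornology.IsBounded (A ∩ B)) :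
    latticeFinset hA t ∩ latticeFinset hB t = latticeFinset hAB t := by
  ext y
  simp only [Finset.mem_inter, mem_latticeFinset, Set.smul_set_inter₀ ht, Set.mem_inter_iff]

end LatticeFinset

namespace RandomSetFunction

variable {d : ℕ} {E : Type*} [MeasurableSpace E] {P₀ : Measure E} [IsProbabilityMeasure P₀]
  {ρ : ℝ} {B₀ : Set (EuclideanSpace ℝ (Fin d))} {H : RandomSetFunction E ρ B₀}
  {g : ((Fin d → ℤ) → E) → ℝ}

/-- `H_t(A)` centred at its mean, as a function of the i.i.d. field. -/
noncomputable def centred (P₀ : Measure E) [IsProbabilityMeasure P₀]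
    (H : RandomSetFunction E ρ B₀) (t : Set.Ici (1 : ℝ)) (A : RiemannSubset B₀)
    (x : (Fin d → ℤ) → E) : ℝ :=
  H.eval t x A - ∫ x, H.eval t x A ∂iidLaw _ P₀

open Classical in
/-- The error made at the site `y` when the martingale difference of `H_t(A)` there is replaced by
the one of the sum of the translates of `g` over the lattice points of `t A`. -/
noncomputable def siteError (P₀ : Measure E) [IsProbabilityMeasure P₀]
    (H : RandomSetFunction E ρ B₀) (g : ((Fin d → ℤ) → E) → ℝ) (t : Set.Ici (1 : ℝ))
    (A : RiemannSubset B₀) (y : Fin d → ℤ) (x : (Fin d → ℤ) → E) : ℝ :=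
  H.siteDifference P₀ t A y x - if y ∈ latticeFinset A.2.1.1 t then g x else 0

theorem siteError_of_mem {t : Set.Ici (1 : ℝ)} {A : RiemannSubset B₀} {y : Fin d → ℤ}
    (hy : y ∈ latticeFinset A.2.1.1 t) :
    H.siteError P₀ g t A y = fun x => H.siteDifference P₀ t A y x - g x :=
  funext fun _ => congrArg _ (if_pos hy)

theorem siteError_of_notMem {t : Set.Ici (1 : ℝ)} {A : RiemannSubset B₀} {y : Fin d → ℤ}
    (hy : y ∉ latticeFinset A.2.1.1 t) :
    H.siteError P₀ g t A y = H.siteDifference P₀ t A y :=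
  funext fun _ => (congrArg _ (if_neg hy)).trans (sub_zero _)

theorem latticeFinset_subset_discretization (hρ : 0 ≤ ρ) (t : ℝ) (A : RiemannSubset B₀) :
    (latticeFinset A.2.1.1 t : Set (Fin d → ℤ)) ⊆ discretization ρ (t • B₀) := fun _ hy =>
  mem_discretization_of_latticePoint_mem hρ (Set.smul_set_mono A.2.2 (mem_latticeFinset.1 hy))

theorem centred_ae_eq_sum_siteDifference {t : Set.Ici (1 : ℝ)} {A : RiemannSubset B₀}
    (hint : Integrable (fun x => H.eval t x A) (iidLaw _ P₀)) {Λ : Finset (Fin d → ℤ)}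
    (hΛ : (Λ : Set (Fin d → ℤ)) = discretization ρ ((t : ℝ) • B₀)) :
    H.centred P₀ t A =ᵐ[iidLaw _ P₀] fun x => ∑ y ∈ Λ, H.siteDifference P₀ t A y (shift y x) :=
  sub_integral_ae_eq_sum_pastDifference hint Λ (hΛ ▸ stronglyMeasurable_eval_cylinderEvents t A)

namespace HasLimitDifference

variable (hH : H.HasLimitDifference P₀ g)
include hH

theorem isStationaryMartingaleDifference_siteDifference (t : Set.Ici (1 : ℝ))
    (A : RiemannSubset B₀) (y : Fin d → ℤ) :
    IsStationaryMartingaleDifference P₀ (H.siteDifference P₀ t A y) :=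
  isStationaryMartingaleDifference_pastDifference
    ((hH.memLp_eval t A).comp_measurePreserving (measurePreserving_shift (-y)))

theorem isStationaryMartingaleDifference_siteError (t : Set.Ici (1 : ℝ))
    (A : RiemannSubset B₀) (y : Fin d → ℤ) :
    IsStationaryMartingaleDifference P₀ (H.siteError P₀ g t A y) := by
  have hsite := hH.isStationaryMartingaleDifference_siteDifference t A y
  by_cases hy : y ∈ latticeFinset A.2.1.1 t
  · rw [siteError_of_mem hy]
    exact hsite.sub hH.isStationaryMartingaleDifference
  · rwa [siteError_of_notMem hy]

theorem integral_sq_centred_sub_sum_shift (hρ : 0 ≤ ρ) {t : Set.Ici (1 : ℝ)}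
    {A : RiemannSubset B₀} {Λ : Finset (Fin d → ℤ)}
    (hΛ : (Λ : Set (Fin d → ℤ)) = discretization ρ ((t : ℝ) • B₀)) :
    ∫ x, (H.centred P₀ t A x - ∑ y ∈ latticeFinset A.2.1.1 t, g (shift y x)) ^ 2 ∂iidLaw _ P₀
      = ∑ y ∈ Λ, ∫ x, H.siteError P₀ g t A y x ^ 2 ∂iidLaw _ P₀ := by
  classical
  have hsubset : latticeFinset A.2.1.1 t ⊆ Λ := by
    rw [← Finset.coe_subset, hΛ]
    exact latticeFinset_subset_discretization hρ t A
  rw [← integral_sq_sum_shift (hH.isStationaryMartingaleDifference_siteError t A)]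
  refine integral_congr_ae ?_
  have hcentred := centred_ae_eq_sum_siteDifference
    ((hH.memLp_eval t A).integrable one_le_two) hΛ
  filter_upwards [hcentred] with x hx
  simp only [siteError, Finset.sum_sub_distrib, hx]
  rw [Finset.sum_ite_mem, Finset.inter_eq_right.2 hsubset]

theorem exists_integral_sq_siteError_le :
    ∃ C : ℝ, ∀ (A : RiemannSubset B₀) (t : Set.Ici (1 : ℝ)),
      ∀ y ∈ discretization ρ ((t : ℝ) • B₀),
        ∫ x, H.siteError P₀ g t A y x ^ 2 ∂iidLaw _ P₀ ≤ C := by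
  obtain ⟨C, hC⟩ := hH.exists_integral_sq_le
  refine ⟨2 * C + 2 * ∫ x, g x ^ 2 ∂iidLaw _ P₀, fun A t y hy => ?_⟩
  have hsite := hH.isStationaryMartingaleDifference_siteDifference t A y
  have hg2 : 0 ≤ ∫ x, g x ^ 2 ∂iidLaw _ P₀ := integral_nonneg fun x => sq_nonneg _
  by_cases hmem : y ∈ latticeFinset A.2.1.1 t
  · have hadd := integral_sq_add_le hsite.memLp hH.isStationaryMartingaleDifference.memLp.neg
    simp only [Pi.neg_apply, neg_sq, ← sub_eq_add_neg] at hadd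
    simp only [siteError_of_mem hmem]
    linarith [hC A t y hy]
  · have hsite2 : 0 ≤ ∫ x, H.siteDifference P₀ t A y x ^ 2 ∂iidLaw _ P₀ :=
      integral_nonneg fun x => sq_nonneg _
    rw [siteError_of_notMem hmem]
    linarith [hC A t y hy]

theorem tendsto_integral_sq_siteError {x : EuclideanSpace ℝ (Fin d)} (hxB : x ∈ interior B₀)
    {A : RiemannSubset B₀} (hxA : x ∉ frontier (A : Set (EuclideanSpace ℝ (Fin d))))
    {t : ℕ → Set.Ici (1 : ℝ)} (ht : Tendsto (fun n => (t n : ℝ)) atTop atTop) :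
    Tendsto (fun n => ∫ z, H.siteError P₀ g (t n) A (latticeFloor (t n) x) z ^ 2 ∂iidLaw _ P₀)
      atTop (𝓝 0) := by
  by_cases hxi : x ∈ interior (A : Set (EuclideanSpace ℝ (Fin d)))
  · refine (hH.tendsto_of_setLiminf A (setLiminf_vadd_smul_eq_univ hxi ht)).congr' ?_
    filter_upwards [eventually_latticePoint_mem hxi ht] with n hn
    rw [siteError_of_mem (mem_latticeFinset.2 hn)]
  · have hxc : x ∉ closure (A : Set (EuclideanSpace ℝ (Fin d))) := fun h => hxA ⟨h, hxi⟩
    have hxd : x ∈ interior (B₀ \ (A : Set (EuclideanSpace ℝ (Fin d)))) := by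
      rw [Set.sdiff_eq, interior_inter, interior_compl]
      exact ⟨hxB, hxc⟩
    refine (hH.tendsto_zero_of_setLiminf_sdiff A (setLiminf_vadd_smul_eq_univ hxd ht)).congr' ?_
    filter_upwards [eventually_notMem_discretization hxc ht 0] with n hn
    rw [siteError_of_notMem fun h => hn
      (mem_discretization_of_latticePoint_mem le_rfl (mem_latticeFinset.1 h))]

theorem tendsto_integral_sq_centred_sub_sum_shift (hB₀ : IsRiemannMeasurable B₀) (hρ : 0 ≤ ρ)
    (A : RiemannSubset B₀) {t : ℕ → Set.Ici (1 : ℝ)}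
    (ht : Tendsto (fun n => (t n : ℝ)) atTop atTop) :
    Tendsto (fun n => ((t n : ℝ) ^ d)⁻¹ * ∫ x, (H.centred P₀ (t n) A x
      - ∑ y ∈ latticeFinset A.2.1.1 (t n), g (shift y x)) ^ 2 ∂iidLaw _ P₀) atTop (𝓝 0) := by
  have hfin (n) := finite_discretization (hB₀.1.smul₀ (t n : ℝ)) ρ
  let error (n : ℕ) : (Fin d → ℤ) → ℝ := (discretization ρ ((t n : ℝ) • B₀)).indicator
    fun y => ∫ x, H.siteError P₀ g (t n) A y x ^ 2 ∂iidLaw _ P₀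
  have hnonneg (n y) : 0 ≤ error n y :=
    Set.indicator_nonneg (fun y _ => integral_nonneg fun x => sq_nonneg _) y
  obtain ⟨C, hC⟩ := hH.exists_integral_sq_siteError_le
  have hbound (n y) : |error n y| ≤ max C 0 := by
    rw [abs_of_nonneg (hnonneg n y)]
    exact Set.indicator_apply_le' (fun hy => (hC A (t n) y hy).trans (le_max_left _ _))
      fun _ => le_max_right _ _
  have hlim : ∀ᵐ x : EuclideanSpace ℝ (Fin d),
      Tendsto (fun n => error n (latticeFloor (t n : ℝ) x)) atTop (𝓝 0) := by
    filter_upwards [measure_eq_zero_iff_ae_notMem.1 A.2.1.2,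
      measure_eq_zero_iff_ae_notMem.1 hB₀.2] with x hxA hxB
    by_cases hxi : x ∈ interior B₀
    · exact squeeze_zero (fun n => hnonneg n _)
        (fun n => Set.indicator_le_self' (fun _ _ => integral_nonneg fun _ => sq_nonneg _) _)
        (hH.tendsto_integral_sq_siteError hxi hxA ht)
    · refine tendsto_const_nhds.congr' ?_
      filter_upwards [eventually_notMem_discretization (fun h => hxB ⟨h, hxi⟩) ht ρ] with n hn
      exact (Set.indicator_of_notMem hn _).symm
  have hsum := tendsto_sum_discretization hB₀.1 (fun n => (t n).2) (F := error)
    (fun n y => (hfin n).mem_toFinset.1)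
    (fun n y hy => Set.indicator_of_notMem (fun h => hy ((hfin n).mem_toFinset.2 h)) _) hbound hlim
  rw [integral_zero] at hsum
  refine hsum.congr fun n => ?_
  rw [hH.integral_sq_centred_sub_sum_shift hρ (hfin n).coe_toFinset]
  exact congrArg _ (Finset.sum_congr rfl fun y hy =>
    Set.indicator_of_mem ((hfin n).mem_toFinset.1 hy) _)

theorem tendsto_integral_sq_normalizedSum_sub (hB₀ : IsRiemannMeasurable B₀) (hρ : 0 ≤ ρ)
    (A : RiemannSubset B₀) {t : ℕ → Set.Ici (1 : ℝ)}
    (ht : Tendsto (fun n => (t n : ℝ)) atTop atTop) :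
    Tendsto (fun n => ∫ x, (normalizedSum ((t n : ℝ) ^ d) (latticeFinset A.2.1.1 (t n)) g x
      - (√((t n : ℝ) ^ d))⁻¹ * H.centred P₀ (t n) A x) ^ 2 ∂iidLaw _ P₀) atTop (𝓝 0) := by
  refine (hH.tendsto_integral_sq_centred_sub_sum_shift hB₀ hρ A ht).congr fun n => ?_
  have hpow : 0 ≤ (t n : ℝ) ^ d := pow_nonneg (zero_le_one.trans (t n).2) d
  rw [← integral_const_mul]
  refine integral_congr_ae (Eventually.of_forall fun x => ?_)
  simp only [normalizedSum]
  rw [← mul_sub, mul_pow, inv_pow, Real.sq_sqrt hpow, sub_sq_comm]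

end HasLimitDifference

end RandomSetFunction

section Gaussian

variable {ι κ Ω : Type*} [Fintype κ] [MeasurableSpace Ω] {P : Measure Ω}

theorem charFun_map_toLp {Y : κ → Ω → ℝ} (hY : ∀ i, AEMeasurable (Y i) P)
    (a : EuclideanSpace ℝ κ) :
    charFun (P.map fun ω => (WithLp.toLp 2 fun i => Y i ω : EuclideanSpace ℝ κ)) a
      = ∫ ω, Complex.exp ((∑ i, a i * Y i ω : ℝ) * Complex.I) ∂P := by
  have hmeas : AEMeasurable (fun ω => (WithLp.toLp 2 fun i => Y i ω : EuclideanSpace ℝ κ)) P :=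
    (WithLp.measurable_toLp 2 _).comp_aemeasurable (aemeasurable_pi_lambda _ hY)
  rw [charFun_apply, integral_map hmeas (by fun_prop)]
  simp only [PiLp.inner_apply, RCLike.inner_apply, conj_trivial]

theorem tendstoInDistribution_multivariateGaussian_of_tendsto_integral_exp
    [DecidableEq κ] [IsProbabilityMeasure P] {l : Filter ι} [l.IsCountablyGenerated]
    {Y : ι → κ → Ω → ℝ} (hY : ∀ t i, AEMeasurable (Y t i) P)
    {S : Matrix κ κ ℝ} (hS : S.PosSemidef)
    (h : ∀ a : κ → ℝ, Tendsto
      (fun t => ∫ ω, Complex.exp ((∑ i, a i * Y t i ω : ℝ) * Complex.I) ∂P) l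
      (𝓝 (Real.exp (-(a ⬝ᵥ S.mulVec a) / 2) : ℂ))) :
    TendstoInDistribution (fun t ω => (WithLp.toLp 2 fun i => Y t i ω : EuclideanSpace ℝ κ)) l id
      (fun _ => P) (multivariateGaussian 0 S) where
  forall_aemeasurable t :=
    (WithLp.measurable_toLp 2 _).comp_aemeasurable (aemeasurable_pi_lambda _ (hY t))
  tendsto := by
    refine tendsto_of_seq_tendsto fun t ht => ProbabilityMeasure.tendsto_of_tendsto_charFun
      fun a => ?_
    have hlimit : charFun (multivariateGaussian 0 S) a
        = (Real.exp (-(a.ofLp ⬝ᵥ S.mulVec a.ofLp) / 2) : ℂ) := by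
      simp [charFun_multivariateGaussian hS, neg_div]
    simp only [ProbabilityMeasure.coe_mk, Measure.map_id, hlimit]
    exact ((h a).comp ht).congr fun n => (charFun_map_toLp (hY (t n)) a).symm

end Gaussian

theorem measurePreserving_field_resample {ι E Ω : Type*} [MeasurableSpace E] {P₀ : Measure E}
    [IsProbabilityMeasure P₀] [MeasurableSpace Ω] {P : Measure Ω} [IsProbabilityMeasure P]
    {X : ι → Ω → E} {Xs : Ω → E} (hX : ∀ z, Measurable (X z)) (hXs : Measurable Xs)
    (hXlaw : ∀ z, P.map (X z) = P₀) (hXslaw : P.map Xs = P₀) (hXindep : iIndepFun X P)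
    (hXXs : IndepFun (fun ω z => X z ω) Xs P) :
    MeasurePreserving (fun ω => ((fun z => X z ω), Xs ω)) P ((iidLaw ι P₀).prod P₀) where
  measurable := (measurable_pi_lambda _ hX).prodMk hXs
  map_eq := by
    rw [(indepFun_iff_map_prod_eq_prod_map_map (measurable_pi_lambda _ hX).aemeasurable
      hXs.aemeasurable).1 hXXs, iIndepFun.map_fun_eq_infinitePi_map hX hXindep, hXslaw]
    simp only [hXlaw]

theorem rpow_neg_half_eq_inv_sqrt_pow {t : ℝ} (ht : 0 ≤ t) (d : ℕ) :
    t ^ (-(d : ℝ) / 2) = (√(t ^ d))⁻¹ := by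
  rw [Real.sqrt_eq_rpow, ← Real.rpow_natCast, ← Real.rpow_mul ht, ← Real.rpow_neg ht]
  ring_nf

namespace RandomSetFunction

variable {d : ℕ} {E : Type*} [MeasurableSpace E] {P₀ : Measure E} [IsProbabilityMeasure P₀]
  {ρ : ℝ} {B₀ : Set (EuclideanSpace ℝ (Fin d))}

/-- `H_t(A)` centred at its mean and divided by `t^{d/2}`, as a function of the i.i.d. field. -/
noncomputable def fluctuation (P₀ : Measure E) [IsProbabilityMeasure P₀]
    (H : RandomSetFunction E ρ B₀) (t : Set.Ici (1 : ℝ)) (A : RiemannSubset B₀)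
    (x : (Fin d → ℤ) → E) : ℝ :=
  (t : ℝ) ^ (-(d : ℝ) / 2) * H.centred P₀ t A x

/-- The volume of `A i ∩ A j`, which is the limit of the number of lattice points of
`t (A i ∩ A j)` divided by `t^d` and hence the weight of `σ*_{ij}` in the limiting covariance. -/
noncomputable def overlapVolume {κ : Type*} (A : κ → RiemannSubset B₀) (i j : κ) : ℝ :=
  volume.real ((A i : Set (EuclideanSpace ℝ (Fin d))) ∩ A j)

section Field

variable {κ : Type*} {H : κ → RandomSetFunction E ρ B₀} {g : κ → ((Fin d → ℤ) → E) → ℝ}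
  {t : ℕ → Set.Ici (1 : ℝ)}

theorem tendsto_card_latticeFinset_inter_div (A : κ → RiemannSubset B₀)
    (ht : Tendsto (fun n => (t n : ℝ)) atTop atTop) (i j : κ) :
    Tendsto (fun n => ((latticeFinset (A i).2.1.1 (t n) ∩ latticeFinset (A j).2.1.1 (t n)).card : ℝ)
      / (t n : ℝ) ^ d) atTop (𝓝 (overlapVolume A i j)) :=
  tendsto_card_div_pow ((A i).2.1.inter (A j).2.1) (fun n => (t n).2) ht fun n y => by
    rw [latticeFinset_inter (zero_lt_one.trans_le (t n).2).ne' _ _ ((A i).2.1.inter (A j).2.1).1,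
      mem_latticeFinset]

variable (hH : ∀ i, (H i).HasLimitDifference P₀ (g i))
include hH

theorem memLp_fluctuation (t : Set.Ici (1 : ℝ)) (A : RiemannSubset B₀) (i : κ) :
    MemLp ((H i).fluctuation P₀ t A) 2 (iidLaw _ P₀) :=
  (((hH i).memLp_eval t A).sub (memLp_const _)).const_mul _

theorem tendsto_integral_sq_normalizedSum_sub_fluctuation (hB₀ : IsRiemannMeasurable B₀)
    (hρ : 0 ≤ ρ) (A : κ → RiemannSubset B₀) (ht : Tendsto (fun n => (t n : ℝ)) atTop atTop)
    (i : κ) :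
    Tendsto (fun n => ∫ x, (normalizedSum ((t n : ℝ) ^ d) (latticeFinset (A i).2.1.1 (t n)) (g i) x
      - (H i).fluctuation P₀ (t n) (A i) x) ^ 2 ∂iidLaw _ P₀) atTop (𝓝 0) := by
  simp only [fluctuation, rpow_neg_half_eq_inv_sqrt_pow (zero_le_one.trans (t _).2)]
  exact (hH i).tendsto_integral_sq_normalizedSum_sub hB₀ hρ (A i) ht

variable [Fintype κ] (hB₀ : IsRiemannMeasurable B₀) (hρ : 0 ≤ ρ) (A : κ → RiemannSubset B₀)

omit [Fintype κ] in
include hB₀ hρ in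
theorem tendsto_integral_fluctuation_mul_fluctuation (i j : κ) :
    Tendsto (fun t : Set.Ici (1 : ℝ) => ∫ x, (H i).fluctuation P₀ t (A i) x
      * (H j).fluctuation P₀ t (A j) x ∂iidLaw _ P₀) atTop
      (𝓝 (overlapVolume A i j * ∫ x, g i x * g j x ∂iidLaw _ P₀)) :=
  tendsto_of_seq_tendsto fun t ht => tendsto_integral_mul_of_approx_normalizedSum
    (fun i => (hH i).isStationaryMartingaleDifference)
    (fun n => pow_pos (zero_lt_one.trans_le (t n).2) d)
    (tendsto_card_latticeFinset_inter_div A (tendsto_Ici_atTop.1 ht))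
    (fun i n => memLp_fluctuation hH (t n) (A i) i)
    (tendsto_integral_sq_normalizedSum_sub_fluctuation hH hB₀ hρ A (tendsto_Ici_atTop.1 ht)) i j

include hB₀ hρ in
theorem tendsto_integral_exp_fluctuation (hd : 1 ≤ d) (a : κ → ℝ) :
    Tendsto (fun t : Set.Ici (1 : ℝ) => ∫ x, Complex.exp
      ((∑ i, a i * (H i).fluctuation P₀ t (A i) x : ℝ) * Complex.I) ∂iidLaw _ P₀) atTop
      (𝓝 (Real.exp (-limitVariance P₀ g (overlapVolume A) a / 2) : ℂ)) :=
  tendsto_of_seq_tendsto fun t ht => tendsto_integral_exp_of_approx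
    (fun i => (hH i).isStationaryMartingaleDifference)
    (fun n => pow_pos (zero_lt_one.trans_le (t n).2) d)
    ((tendsto_pow_atTop (Nat.one_le_iff_ne_zero.1 hd)).comp (tendsto_Ici_atTop.1 ht))
    (tendsto_card_latticeFinset_inter_div A (tendsto_Ici_atTop.1 ht))
    (fun i n => memLp_fluctuation hH (t n) (A i) i)
    (tendsto_integral_sq_normalizedSum_sub_fluctuation hH hB₀ hρ A (tendsto_Ici_atTop.1 ht)) a

theorem limitVariance_overlapVolume_nonneg (a : κ → ℝ) :
    0 ≤ limitVariance P₀ g (overlapVolume A) a := by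
  let t : ℕ → Set.Ici (1 : ℝ) := fun n => ⟨n + 1, by simp⟩
  have ht : Tendsto (fun n => (t n : ℝ)) atTop atTop :=
    tendsto_atTop_add_const_right _ _ tendsto_natCast_atTop_atTop
  exact limitVariance_nonneg (fun i => (hH i).isStationaryMartingaleDifference)
    (fun n => pow_pos (zero_lt_one.trans_le (t n).2) d)
    (tendsto_card_latticeFinset_inter_div A ht) a

end Field

section Model

variable {Ω : Type*} [MeasurableSpace Ω] {P : Measure Ω} {X : (Fin d → ℤ) → Ω → E}
  (hX : MeasurePreserving (fun ω z => X z ω) P (iidLaw _ P₀))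
include hX

theorem memLp_var {H : RandomSetFunction E ρ B₀} {g : ((Fin d → ℤ) → E) → ℝ}
    (hH : H.HasLimitDifference P₀ g) (t : Set.Ici (1 : ℝ)) (A : RiemannSubset B₀) :
    MemLp (H.var X t A) 2 P :=
  (hH.memLp_eval t A).comp_measurePreserving hX

theorem var_sub_integral_eq_centred (H : RandomSetFunction E ρ B₀) (t : Set.Ici (1 : ℝ))
    (A : RiemannSubset B₀) (ω : Ω) :
    H.var X t A ω - ∫ ω', H.var X t A ω' ∂P = H.centred P₀ t A fun z => X z ω :=
  congrArg (H.var X t A ω - ·)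
    (integral_comp_measurePreserving hX (stronglyMeasurable_eval t A).aestronglyMeasurable)

variable {k : ℕ} {H : Fin k → RandomSetFunction E ρ B₀} {g : Fin k → ((Fin d → ℤ) → E) → ℝ}
  (hH : ∀ i, (H i).HasLimitDifference P₀ (g i)) (A : Fin k → RiemannSubset B₀)
include hH

theorem rpow_neg_mul_covariance_var (t : Set.Ici (1 : ℝ)) (i j : Fin k) :
    (t : ℝ) ^ (-(d : ℝ)) * cov[(H i).var X t (A i), (H j).var X t (A j); P]
      = ∫ x, (H i).fluctuation P₀ t (A i) x * (H j).fluctuation P₀ t (A j) x ∂iidLaw _ P₀ := by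
  have hfluct (i) := (memLp_fluctuation hH t (A i) i).1
  have hscale : (t : ℝ) ^ (-(d : ℝ)) = (t : ℝ) ^ (-(d : ℝ) / 2) * (t : ℝ) ^ (-(d : ℝ) / 2) := by
    rw [← Real.rpow_add (zero_lt_one.trans_le t.2), add_halves]
  rw [← integral_comp_measurePreserving hX (f := fun x => (H i).fluctuation P₀ t (A i) x
    * (H j).fluctuation P₀ t (A j) x) ((hfluct i).mul (hfluct j)), covariance,
    ← integral_const_mul]
  refine integral_congr_ae (Eventually.of_forall fun ω => ?_)
  simp only [var_sub_integral_eq_centred hX, fluctuation, hscale]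
  ring

variable {D : Fin k → Ω → ℝ} (hD : ∀ i, P[D i | lexPast X 0] =ᵐ[P] fun ω => g i fun z => X z ω)
include hD

theorem sigmaStar_eq_integral (i j : Fin k) :
    sigmaStar P X D i j = ∫ x, g i x * g j x ∂iidLaw _ P₀ := by
  have hg (i) := (hH i).isStationaryMartingaleDifference.memLp.1
  rw [← integral_comp_measurePreserving hX (f := fun x => g i x * g j x) ((hg i).mul (hg j))]
  refine integral_congr_ae ?_
  filter_upwards [hD i, hD j] with ω hi hj
  exact congrArg₂ (· * ·) hi hj

theorem dotProduct_limitCov_mulVec (a : Fin k → ℝ) :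
    a ⬝ᵥ (limitCov P X D A).mulVec a = limitVariance P₀ g (overlapVolume A) a := by
  simp only [limitCov, limitVariance, overlapVolume, dotProduct, Matrix.mulVec, Matrix.of_apply,
    sigmaStar_eq_integral hX hH hD, Finset.mul_sum]
  exact Finset.sum_congr rfl fun i _ => Finset.sum_congr rfl fun j _ => by ring

theorem posSemidef_limitCov : (limitCov P X D A).PosSemidef := by
  refine .of_dotProduct_mulVec_nonneg ?_ fun a => ?_
  · ext i j
    simp only [limitCov, sigmaStar, Matrix.conjTranspose_apply, Matrix.of_apply, star_trivial,
      Set.inter_comm, mul_comm]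
  · rw [star_trivial, dotProduct_limitCov_mulVec hX hH A hD]
    exact limitVariance_overlapVolume_nonneg hH A a

theorem tendsto_rpow_neg_mul_covariance_var (hB₀ : IsRiemannMeasurable B₀) (hρ : 0 ≤ ρ)
    (i j : Fin k) :
    Tendsto (fun t : Set.Ici (1 : ℝ) =>
        (t : ℝ) ^ (-(d : ℝ)) * cov[(H i).var X t (A i), (H j).var X t (A j); P]) atTop
      (𝓝 (sigmaStar P X D i j * overlapVolume A i j)) := by
  simp only [rpow_neg_mul_covariance_var hX hH A]
  rw [sigmaStar_eq_integral hX hH hD, mul_comm]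
  exact tendsto_integral_fluctuation_mul_fluctuation hH hB₀ hρ A i j

theorem tendstoInDistribution_var [IsProbabilityMeasure P] (hd : 1 ≤ d)
    (hB₀ : IsRiemannMeasurable B₀) (hρ : 0 ≤ ρ) :
    TendstoInDistribution
      (fun (t : Set.Ici (1 : ℝ)) ω => (WithLp.toLp 2 fun i : Fin k => (t : ℝ) ^ (-(d : ℝ) / 2) *
        ((H i).var X t (A i) ω - ∫ ω', (H i).var X t (A i) ω' ∂P) : EuclideanSpace ℝ (Fin k)))
      atTop id (fun _ => P) (multivariateGaussian 0 (limitCov P X D A)) := by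
  refine tendstoInDistribution_multivariateGaussian_of_tendsto_integral_exp
    (fun t i => ((memLp_var hX (hH i) t (A i)).1.aemeasurable.sub_const _).const_mul _)
    (posSemidef_limitCov hX hH A hD) fun a => ?_
  rw [dotProduct_limitCov_mulVec hX hH A hD]
  refine (tendsto_integral_exp_fluctuation hH hB₀ hρ A hd a).congr fun t => ?_
  have hmeas (i) := (memLp_fluctuation hH t (A i) i).1.aemeasurable
  have hexp : AEStronglyMeasurable (fun x => Complex.exp
      ((∑ i, a i * (H i).fluctuation P₀ t (A i) x : ℝ) * Complex.I)) (iidLaw _ P₀) := by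
    refine AEMeasurable.aestronglyMeasurable ?_
    fun_prop
  simp only [var_sub_integral_eq_centred hX]
  exact (integral_comp_measurePreserving hX hexp).symm

end Model

end RandomSetFunction

end LatticeCLT

theorem mainTheorem1_general {d k : ℕ} (hd : 1 ≤ d) {E : Type*} [MeasurableSpace E]
    (P₀ : Measure E) [IsProbabilityMeasure P₀]
    {Ω : Type*} [MeasurableSpace Ω] (P : Measure Ω) [IsProbabilityMeasure P]
    (X : (Fin d → ℤ) → Ω → E) (Xs : Ω → E)
    (hX : ∀ z, Measurable (X z)) (hXs : Measurable Xs)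
    (hXlaw : ∀ z, P.map (X z) = P₀) (hXslaw : P.map Xs = P₀)
    (hXindep : iIndepFun X P) (hXXs : IndepFun (fun ω z => X z ω) Xs P)
    (ρ : ℝ) (hρ : 0 ≤ ρ)
    (B₀ : Set (EuclideanSpace ℝ (Fin d))) (hB₀ : LatticeCLT.IsRiemannMeasurable B₀)
    (hB₀pos : 0 < volume B₀)
    (H : Fin k → LatticeCLT.RandomSetFunction E ρ B₀) (D : Fin k → Ω → ℝ)
    (hstab : ∀ i, (H i).Stabilizes P X Xs (D i))
    (hmom : ∀ i, (H i).BoundedMoments P X Xs)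
    (A : Fin k → LatticeCLT.RiemannSubset B₀) :
    (∀ i, MemLp (D i) 2 P) ∧
    (∀ i t, MemLp ((H i).var X t (A i)) 2 P) ∧
    (∀ i j, Tendsto (fun t : Set.Ici (1 : ℝ) =>
        (t : ℝ) ^ (-(d : ℝ)) * cov[(H i).var X t (A i), (H j).var X t (A j); P]) atTop
      (𝓝 (LatticeCLT.sigmaStar P X D i j *
        volume.real ((A i : Set (EuclideanSpace ℝ (Fin d))) ∩ A j)))) ∧
    (LatticeCLT.limitCov P X D A).PosSemidef ∧
    TendstoInDistribution
      (fun (t : Set.Ici (1 : ℝ)) ω => (WithLp.toLp 2 fun i : Fin k =>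
        (t : ℝ) ^ (-(d : ℝ) / 2) *
          ((H i).var X t (A i) ω - ∫ ω', (H i).var X t (A i) ω' ∂P) :
        EuclideanSpace ℝ (Fin k)))
      atTop id (fun _ => P) (multivariateGaussian 0 (LatticeCLT.limitCov P X D A)) := by
  have hpair :=
    LatticeCLT.measurePreserving_field_resample hX hXs hXlaw hXslaw hXindep hXXs
  have hfield := measurePreserving_fst.comp hpair
  choose g hH hD using fun i =>
    (hstab i).exists_hasLimitDifference (hmom i) hB₀ hB₀pos hρ hpair
  exact ⟨fun i => (hstab i).memLp (hmom i) hB₀ hB₀pos hρ hpair.measurable,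
    fun i t => LatticeCLT.RandomSetFunction.memLp_var hfield (hH i) t (A i),
    LatticeCLT.RandomSetFunction.tendsto_rpow_neg_mul_covariance_var hfield hH A hD hB₀ hρ,
    LatticeCLT.RandomSetFunction.posSemidef_limitCov hfield hH A hD,
    LatticeCLT.RandomSetFunction.tendstoInDistribution_var hfield hH A hD hd hB₀ hρ⟩

theorem mainTheorem1 {d k : ℕ} (hd : 1 ≤ d) {E : Type*} [MeasurableSpace E]
    (P₀ : Measure E) [IsProbabilityMeasure P₀]
    {Ω : Type*} [MeasurableSpace Ω] (P : Measure Ω) [IsProbabilityMeasure P]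
    (X : (Fin d → ℤ) → Ω → E) (Xs : Ω → E)
    (hX : ∀ z, Measurable (X z)) (hXs : Measurable Xs)
    (hXlaw : ∀ z, P.map (X z) = P₀) (hXslaw : P.map Xs = P₀)
    (hXindep : iIndepFun X P) (hXXs : IndepFun (fun ω z => X z ω) Xs P)
    (ρ : ℝ) (hρ : √(d : ℝ) ≤ ρ)
    (B₀ : Set (EuclideanSpace ℝ (Fin d))) (hB₀ : LatticeCLT.IsRiemannMeasurable B₀)
    (hB₀pos : 0 < volume B₀)
    (H : Fin k → LatticeCLT.RandomSetFunction E ρ B₀) (D : Fin k → Ω → ℝ)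
    (hstab : ∀ i, (H i).Stabilizes P X Xs (D i))
    (hmom : ∀ i, (H i).BoundedMoments P X Xs)
    (A : Fin k → LatticeCLT.RiemannSubset B₀) :
    (∀ i, MemLp (D i) 2 P) ∧
    (∀ i t, MemLp ((H i).var X t (A i)) 2 P) ∧
    (∀ i j, Tendsto (fun t : Set.Ici (1 : ℝ) =>
        (t : ℝ) ^ (-(d : ℝ)) * cov[(H i).var X t (A i), (H j).var X t (A j); P]) atTop
      (𝓝 (LatticeCLT.sigmaStar P X D i j *
        volume.real ((A i : Set (EuclideanSpace ℝ (Fin d))) ∩ A j)))) ∧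
    (LatticeCLT.limitCov P X D A).PosSemidef ∧
    TendstoInDistribution
      (fun (t : Set.Ici (1 : ℝ)) ω => (WithLp.toLp 2 fun i : Fin k =>
        (t : ℝ) ^ (-(d : ℝ) / 2) *
          ((H i).var X t (A i) ω - ∫ ω', (H i).var X t (A i) ω' ∂P) :
        EuclideanSpace ℝ (Fin k)))
      atTop id (fun _ => P) (multivariateGaussian 0 (LatticeCLT.limitCov P X D A)) :=
  mainTheorem1_general hd P₀ P X Xs hX hXs hXlaw hXslaw hXindep hXXs ρ
    ((Real.sqrt_nonneg _).trans hρ) B₀ hB₀ hB₀pos H D hstab hmom A
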